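/- **Setting.** An $n$-player anytime-constrained Markov game $G$ has a horizon $H\ge 1$, a finite state set $\mathcal S$ with initial state $s_1$, finite nonempty action sets $\mathcal A_1,\dots,\mathcal A_n$ with $\mathcal A=\prod_i\mathcal A_i$, transition laws $P_h(s,a)\in\Delta(\mathcal S)$, reward laws $R_h(s,a)$ on $\mathbb R^n$ with finite mean $r_h(s,a)$, cost laws $C_h(s,a)=\prod_i C_{i,h}(s,a)$ on $\mathbb R^n$ (products of laws on $\mathbb R$ that are bounded above, possibly of infinite support), and a budget $B\in\mathbb R^n$. Put $c^{\max}_i=\sup_{h,s,a}\sup\mathrm{Supp}\,C_{i,h}(s,a)$ and assume $c^{\max}_i>0$ and $Hc^{\max}_i>B_i$ for all $i$. A joint policy $\pi$ maps histories $\tau_h=(s_1,a_1,c_1,\dots,s_h)$ measurably to laws on $\mathcal A$. For $\varepsilon\ge0$, $\pi$ is *$\varepsilon$-additive feasible from $\tau_h$* if $\mathbb P^\pi_G[\forall t\in[H]:\sum_{k\le t}c_k\le B+\varepsilon\mid\tau_h]=1$; it is *$\varepsilon$-additive feasible* if this holds from $(s_1)$, and *feasible* if moreover $\varepsilon=0$.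 The value is $V^\pi_{i,h}(\tau_h)=\mathbb E^\pi_G[\sum_{t=h}^H r_{i,t}(s_t,a_t)\mid\tau_h]$. A deviation of player $i$ is, for CCE, a policy $\pi_i'$ of player $i$ (giving $(\pi_i',\pi_{-i})$), and for CE, a randomized modification $\phi_i$ of the recommended action depending on the history (giving $\phi_i\circ\pi$). A policy $\pi$ is an *$\varepsilon$-additive approximate ACSPE (CE/CCE)* if for every $h\in[H+1]$ and every feasibly realizable history $\tau_h$: (1) $\pi$ is $\varepsilon$-additive feasible from $\tau_h$, and (2) every deviation of every player $i$ either yields a policy that is not ($0$-)feasible from $\tau_h$ or yields a value at $\tau_h$ of at most $V^\pi_{i,h}(\tau_h)$. Here "every feasibly realizable history" means: for every feasible policy $\pi_0$, $\mathbb P^{\pi_0}_G$-almost every $\tau_h$ (in particular every $\tau_h$ of positive probability under some feasible policy). **Algorithm** (with parameter $\ell>0$ and an LP feasibility solver). 1. Replace every cost law $C_{i,h}(s,a)$ by the law of $\lfloor\max(c,\,B_i-Hc^{\max}_i)/\ell\rfloor\,\ell$, $c\sim C_{i,h}(s,a)$, computed from $x\mapsto\Pr[c<x]$. This gives a game $\hat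 G$ with finitely supported costs. 2. Build the AND/OR graph of triples (time, state, cumulative cost) reached from $(1,s_1,0)$ by joint actions that surely keep the budget in the next step. A triple at time $H+1$ is TRUE. An earlier triple is TRUE if some such action leads only to TRUE triples. If the root is FALSE, output "Infeasible". 3. Otherwise form the Markov game whose states are the TRUE triples and whose allowed joint actions are those leading only to TRUE triples. Solve it by backward induction: at each state take a solution, supported on the allowed joint actions, of the CE (resp. CCE) linear feasibility program of the stage game, where the utility of a forbidden joint action is the least allowed utility minus $1$. Output the resulting strategy. The output is played in $G$ by tracking the current state and the cumulative rounded cost. **Statement.** Let $\varepsilon>0$ and $\ell=\varepsilon/H$. (a) For every such game, every LP solver and each of the solution concepts CE, CCE: if the algorithm outputs "Infeasible", then $G$ has no feasible policy; if it outputs a strategy, then the policy obtained by playing it is $\varepsilon$-additive feasible and is an $\varepsilon$-additive approximate ACSPE (CE/CCE) for $G$. (In particular the output is "Infeasible" whenever no $\varepsilon$-additive feasible policy exists.) (b) For all polynomials $p,q$ there are constants $K,d$ such that for every $n\ge1$, every such game $G$ with $n$ players, every $\varepsilon>0$ and every description size $|G|$ that is at least the number $H|\mathcal S||\mathcal A|(|\mathcal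 S|+2n)+2n$ of table entries of $G$: if $\|(H+1)c^{\max}-B\|_\infty\le q(|G|)$, the LP solver runs in time $p(\text{size of the LP})$ and each evaluation of a cost distribution function takes time at most $q(|G|)$, then the algorithm runs in time at most $$K\,\Bigl(|G|^{\,n}+\frac1{\varepsilon^{n}}\Bigr)^{d},$$ which for each fixed number of players is $\mathrm{poly}(|G|,1/\varepsilon^n)$. Time is counted in unit-cost real arithmetic operations, comparisons and roundings, with searches in unsorted tables; the size of an LP with $N$ variables and $m$ constraints is $(N+1)(m+1)$. -/

import Mathlib

open MeasureTheory ProbabilityTheory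

noncomputable section

namespace AnytimeGame

/-! ## Anytime-constrained Markov games -/

/-- An `n`-player tabular finite-horizon anytime-constrained Markov game.  States and actions of
player `i` are numbered.  Time is counted from `0`: the data at time `h` governs the step number
`h + 1`, and only the times `h < H` matter.  `R h s a` is the law of the reward vector, and the law
of the cost vector is the product of the laws `C i h s a` of the costs of the single players, each
bounded from above (but possibly unbounded from below and of infinite support). -/
structure Game (n : ℕ) where
  H : ℕ
  H_pos : 0 < H
  nS : ℕ
  nA : Fin n → ℕ
  nA_pos : ∀ i, 0 < nA i
  s₁ : Fin nS
  P : ℕ → Fin nS → (∀ i, Fin (nA i)) → PMF (Fin nS)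
  R : ℕ → Fin nS → (∀ i, Fin (nA i)) → Measure (Fin n → ℝ)
  R_prob : ∀ h s a, IsProbabilityMeasure (R h s a)
  R_int : ∀ h s a i, Integrable (fun x : Fin n → ℝ => x i) (R h s a)
  C : Fin n → ℕ → Fin nS → (∀ i, Fin (nA i)) → Measure ℝ
  C_prob : ∀ i h s a, IsProbabilityMeasure (C i h s a)
  C_bdd : ∀ i h s a, ∃ M : ℝ, C i h s a (Set.Ioi M) = 0
  B : Fin n → ℝ

variable {n : ℕ}

namespace Game

/-- States. -/
abbrev State (G : Game n) : Type := Fin G.nS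

/-- Joint actions. -/
abbrev Act (G : Game n) : Type := ∀ i, Fin (G.nA i)

/-- The expected reward vector `r_h(s, a)`. -/
def r (G : Game n) (h : ℕ) (s : G.State) (a : G.Act) : Fin n → ℝ :=
  fun i => ∫ x, x i ∂(G.R h s a)

/-- The supremum of the supported costs of player `i` over all times, states and actions. -/
def cmax (G : Game n) (i : Fin n) : ℝ :=
  ⨆ k : Fin G.H × G.State × G.Act, sSup (G.C i k.1 k.2.1 k.2.2).support

/-- The normalization that every player has a budget which some policy could violate, and a
positive maximal cost. -/
def Normalized (G : Game n) : Prop :=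
  ∀ i, 0 < G.cmax i ∧ G.B i < G.H * G.cmax i

/-- The number of entries of the tables describing the game: transition probabilities, expected
rewards, cost distributions, budgets and maximal costs. -/
def tableSize (G : Game n) : ℕ :=
  G.H * G.nS * (∏ i, G.nA i) * (G.nS + 2 * n) + 2 * n

/-- One step of interaction: joint action, cost vector, next state. -/
abbrev Step (G : Game n) : Type := G.Act × (Fin n → ℝ) × G.State

/-- Histories after `t` steps.  Entry `j ≥ 1` is `(a_j, c_j, s_{j+1})` in the usual numbering; of
entry `0` only the state (the initial one) is meaningful. -/
abbrev Hist (G : Game n) (t : ℕ) : Type := (j : Finset.Iic t) → (fun _ : ℕ => G.Step) j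

/-- An arbitrary joint action. -/
def act₀ (G : Game n) : G.Act := fun i => ⟨0, G.nA_pos i⟩

/-- The history at the beginning of the interaction. -/
def initHist (G : Game n) : G.Hist 0 := fun _ => (G.act₀, 0, G.s₁)

/-- The current state of a history. -/
def curState (G : Game n) {t : ℕ} (τ : G.Hist t) : G.State :=
  (τ ⟨t, Finset.mem_Iic.2 le_rfl⟩).2.2

/-- The cost accumulated during the first `m` steps. -/
def cumCost (G : Game n) {t : ℕ} (τ : G.Hist t) (m : ℕ) : Fin n → ℝ :=
  ∑ j : Finset.Iic t, if 1 ≤ (j : ℕ) ∧ (j : ℕ) ≤ m then (τ j).2.1 else 0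

/-- The expected rewards of player `i` along a history, summed from time `h` on. -/
def rewardFrom (G : Game n) {t : ℕ} (i : Fin n) (h : ℕ) (τ : G.Hist t) : ℝ :=
  ∑ k : Fin t, if h ≤ (k : ℕ) then
    G.r k (τ ⟨k, Finset.mem_Iic.2 k.2.le⟩).2.2 (τ ⟨k + 1, Finset.mem_Iic.2 k.2⟩).1 i else 0

/-- The law of `(a, c, s')` when the joint action `a` is played in state `s` at time `h`. -/
def stepLaw (G : Game n) (h : ℕ) (s : G.State) (a : G.Act) : Measure G.Step :=
  (Measure.dirac a).prod ((Measure.pi fun i => G.C i h s a).prod (G.P h s a).toMeasure)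

instance stepLaw_prob (G : Game n) (h : ℕ) (s : G.State) (a : G.Act) :
    IsProbabilityMeasure (G.stepLaw h s a) := by
  have := fun i => G.C_prob i h s a
  unfold stepLaw
  infer_instance

/-- Joint policies: history-dependent, randomized, measurable. -/
structure Policy (G : Game n) where
  act : (t : ℕ) → G.Hist t → PMF G.Act
  meas : ∀ t a, Measurable fun τ => act t τ a

theorem measurable_curState (G : Game n) (t : ℕ) : Measurable (G.curState (t := t)) := by
  unfold curState
  fun_prop

/-- The transition kernel from histories to the next step. -/
def Policy.kernel {G : Game n} (π : G.Policy) (t : ℕ) : Kernel (G.Hist t) G.Step where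
  toFun τ := ∑ a, π.act t τ a • G.stepLaw t (G.curState τ) a
  measurable' := by
    refine Measure.measurable_of_measurable_coe _ fun s _ => ?_
    simp only [Measure.coe_finsetSum, Measure.coe_smul, Finset.sum_apply, Pi.smul_apply,
      smul_eq_mul]
    refine Finset.measurable_sum _ fun a _ => (π.meas t a).mul ?_
    exact (measurable_of_countable fun x : G.State => G.stepLaw t x a s).comp
      (G.measurable_curState t)

instance {G : Game n} (π : G.Policy) (t : ℕ) : IsMarkovKernel (π.kernel t) := by
  refine ⟨fun τ => ⟨?_⟩⟩
  have h : π.kernel t τ = ∑ a, π.act t τ a • G.stepLaw t (G.curState τ) a := rfl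
  rw [h]
  simp only [Measure.coe_finsetSum, Measure.coe_smul, Finset.sum_apply, Pi.smul_apply,
    smul_eq_mul, measure_univ, mul_one]
  exact (tsum_fintype (L := .unconditional _) _).symm.trans (π.act t τ).tsum_coe

/-- The law of the history at time `b` under `π`, given the history at time `a ≤ b`. -/
def Policy.law {G : Game n} (π : G.Policy) (a b : ℕ) (τ : G.Hist a) : Measure (G.Hist b) :=
  Kernel.partialTraj (X := fun _ => G.Step) π.kernel a b τ

/-- Given `τ`, almost surely no partial sum of costs exceeds the budget by more than `ε`. -/
def Policy.FeasibleFrom {G : Game n} (π : G.Policy) (ε : ℝ) {h : ℕ} (τ : G.Hist h) : Prop :=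
  ∀ᵐ τ' ∂(π.law h G.H τ), ∀ m : ℕ, 1 ≤ m → m ≤ G.H → ∀ i, G.cumCost τ' m i ≤ G.B i + ε

/-- `ε`-additive feasible policies. -/
def Policy.AddFeasible {G : Game n} (π : G.Policy) (ε : ℝ) : Prop :=
  π.FeasibleFrom ε G.initHist

/-- Feasible policies. -/
def Policy.Feasible {G : Game n} (π : G.Policy) : Prop := π.AddFeasible 0

/-- The value of player `i` from time `h` on, given the history `τ` at time `h`. -/
def Policy.value {G : Game n} (π : G.Policy) (i : Fin n) {h : ℕ} (τ : G.Hist h) : ℝ :=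
  ∫ τ', G.rewardFrom i h τ' ∂(π.law h G.H τ)

/-- A strategy modification of player `i`: given the history and the action recommended to `i`,
it prescribes a (random) action of `i`. -/
structure Modification (G : Game n) (i : Fin n) where
  act : (t : ℕ) → G.Hist t → Fin (G.nA i) → PMF (Fin (G.nA i))
  meas : ∀ t x y, Measurable fun τ => act t τ x y

/-- A modification that ignores the recommendation, i.e. a deviation policy `π_i'`. -/
def Modification.IgnoresAdvice {G : Game n} {i : Fin n} (φ : G.Modification i) : Prop :=
  ∀ t τ x y, φ.act t τ x = φ.act t τ y

/-- The joint policy after player `i` modifies her actions by `φ`.  If `φ` ignores the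
recommendation this is `(π_i', π_{-i})`, with `π_{-i}` the marginal of `π`. -/
def Policy.modify {G : Game n} (π : G.Policy) {i : Fin n} (φ : G.Modification i) : G.Policy where
  act t τ := (π.act t τ).bind fun a => (φ.act t τ (a i)).map (Function.update a i)
  meas t a := by
    simp only [PMF.bind_apply, PMF.map_apply, tsum_fintype]
    refine Finset.measurable_sum _ fun b _ => (π.meas t b).mul ?_
    refine Finset.measurable_sum _ fun y _ => ?_
    split_ifs
    · exact φ.meas t _ y
    · exact measurable_const

end Game

/-- The two solution concepts: coarse correlated and correlated equilibrium. -/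
inductive EqKind
  | cce
  | ce

/-- The deviations considered by a solution concept. -/
def EqKind.Allows (e : EqKind) {G : Game n} {i : Fin n} (φ : G.Modification i) : Prop :=
  match e with
  | .cce => φ.IgnoresAdvice
  | .ce => True

/-- `ε`-additive approximate anytime-constrained subgame-perfect equilibria: at all times `h` and
all histories realizable by a feasible policy, `π` is `ε`-additive feasible and no feasible
deviation has a higher value.  Realizability is expressed through null sets, since with
continuous costs single histories have probability `0`; whenever a history has positive
probability under a feasible policy, the conditions hold at it. -/
def Game.Policy.IsApproxACSPE {G : Game n} (π : G.Policy) (e : EqKind) (ε : ℝ) : Prop :=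
  ∀ h ≤ G.H, ∀ π₀ : G.Policy, π₀.Feasible → ∀ᵐ τ ∂(π₀.law 0 h G.initHist),
    π.FeasibleFrom ε τ ∧
    ∀ (i : Fin n) (φ : G.Modification i), e.Allows φ →
      ¬ (π.modify φ).FeasibleFrom 0 τ ∨ (π.modify φ).value i τ ≤ π.value i τ

/-! ## Programs with a step count

Programs work on a random access machine with exact real arithmetic; arithmetic operations,
comparisons and rounding of single numbers, and reading one table entry of the input, take one
step each.  Vectors are charged by coordinates.  Finite sets and tables are stored as unsorted
arrays, so searching costs a comparison per stored key. -/

/-- A result together with the number of steps spent on it. -/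
structure Timed (α : Type) where
  val : α
  time : ℕ

instance : Monad Timed where
  pure a := ⟨a, 0⟩
  bind x f := ⟨(f x.val).val, x.time + (f x.val).time⟩

/-- One elementary step. -/
def op {α : Type} (a : α) : Timed α := ⟨a, 1⟩

/-- A finite table. -/
structure Table (ι β : Type) where
  dom : Finset ι
  get : ι → β

instance {ι β : Type} [Inhabited β] : Inhabited (Table ι β) := ⟨⟨∅, fun _ => default⟩⟩

open Classical in
/-- Fill a table by running a program for each key. -/
def tabulate {ι β : Type} [Inhabited β] (D : Finset ι) (f : ι → Timed β) : Timed (Table ι β) :=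
  ⟨⟨D, fun x => if x ∈ D then (f x).val else default⟩, 1 + ∑ x ∈ D, ((f x).time + 1)⟩

/-- Fill an array of length `N`. -/
def tarray {β : Type} {N : ℕ} (f : Fin N → Timed β) : Timed (Fin N → β) :=
  ⟨fun j => (f j).val, 1 + ∑ j, ((f j).time + 1)⟩

/-- Search a key in a table; `w` is the cost of comparing two keys. -/
def lookup {ι β : Type} (w : ℕ) (T : Table ι β) (x : ι) : Timed β :=
  ⟨T.get x, w * (T.dom.card + 1)⟩

open Classical in
/-- Membership test; `w` is the cost of comparing two elements. -/
def member {ι : Type} (w : ℕ) (D : Finset ι) (x : ι) : Timed Bool :=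
  ⟨decide (x ∈ D), w * (D.card + 1)⟩

open Classical in
/-- Does every element pass a test? -/
def tall {ι : Type} (D : Finset ι) (p : ι → Timed Bool) : Timed Bool :=
  ⟨decide (∀ x ∈ D, (p x).val = true), 1 + ∑ x ∈ D, ((p x).time + 1)⟩

/-- The elements that pass a test. -/
def tfilter {ι : Type} (D : Finset ι) (p : ι → Timed Bool) : Timed (Finset ι) :=
  ⟨D.filter fun x => (p x).val = true, 1 + ∑ x ∈ D, ((p x).time + 1)⟩

open Classical in
/-- Image of a set, removing duplicates by pairwise comparison at cost `w` each. -/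
def timage {ι κ : Type} (w : ℕ) (D : Finset ι) (f : ι → Timed κ) : Timed (Finset κ) :=
  ⟨D.image fun x => (f x).val, 1 + ∑ x ∈ D, ((f x).time + 1) + w * D.card ^ 2⟩

open Classical in
/-- Union of sets, removing duplicates by pairwise comparison at cost `w` each. -/
def tunion {ι κ : Type} (w : ℕ) (D : Finset ι) (f : ι → Timed (Finset κ)) : Timed (Finset κ) :=
  ⟨D.biUnion fun x => (f x).val,
    1 + ∑ x ∈ D, ((f x).time + 1) + w * (∑ x ∈ D, (f x).val.card) ^ 2⟩

/-- Sum over a set; `w` is the cost of one addition. -/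
def tsumOver {ι β : Type} [AddCommMonoid β] (w : ℕ) (D : Finset ι) (f : ι → Timed β) : Timed β :=
  ⟨∑ x ∈ D, (f x).val, 1 + ∑ x ∈ D, ((f x).time + w)⟩

/-- Product of `N` real numbers. -/
def tprodOver {N : ℕ} (f : Fin N → Timed ℝ) : Timed ℝ :=
  ⟨∏ j, (f j).val, 1 + ∑ j, ((f j).time + 1)⟩

/-- Apply a program to each element of a list. -/
def tlist {ι β : Type} (f : ι → Timed β) : List ι → Timed (List β)
  | [] => op []
  | x :: l => do
    let y ← f x
    let ys ← tlist f l
    op (y :: ys)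

/-! ## Linear programs -/

/-- The linear feasibility problem in `N` variables `x ≥ 0` with constraints `row · x ≥ b` for
`(row, b)` in `geq` and `row · x = b` for `(row, b)` in `eq`. -/
structure LP (N : ℕ) where
  geq : List ((Fin N → ℝ) × ℝ)
  eq : List ((Fin N → ℝ) × ℝ)

/-- `x` is a feasible point. -/
def LP.Sat {N : ℕ} (L : LP N) (x : Fin N → ℝ) : Prop :=
  (∀ j, 0 ≤ x j) ∧ (∀ c ∈ L.geq, c.2 ≤ ∑ j, c.1 j * x j) ∧ ∀ c ∈ L.eq, ∑ j, c.1 j * x j = c.2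

/-- The size of a linear program. -/
def LP.size {N : ℕ} (L : LP N) : ℕ := (N + 1) * (L.geq.length + L.eq.length + 1)

/-- A linear-program feasibility solver, with its running time. -/
structure LPSolver where
  solve : {N : ℕ} → LP N → Option (Fin N → ℝ)
  time : {N : ℕ} → LP N → ℕ
  sound : ∀ {N : ℕ} (L : LP N) (x : Fin N → ℝ), solve L = some x → L.Sat x
  complete : ∀ {N : ℕ} (L : LP N), solve L = none → ¬ ∃ x, L.Sat x

/-- The solver runs in time at most `p(size)`. -/
def LPSolver.RunsIn (lp : LPSolver) (p : Polynomial ℕ) : Prop :=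
  ∀ {N : ℕ} (L : LP N), lp.time L ≤ p.eval L.size

/-! ## The algorithms -/

/-- Nodes: a state with a cumulative cost vector. -/
abbrev Node (n nS : ℕ) : Type := Fin nS × (Fin n → ℝ)

/-- Joint actions. -/
abbrev JAct {n : ℕ} (nA : Fin n → ℕ) : Type := ∀ i, Fin (nA i)

/-- Anytime-constrained games with cost distributions of finite support, as data.  `C` lists, for
each time `h < H`, state and joint action, the supported cost vectors with their probabilities. -/
structure TabularGame (n nS : ℕ) (nA : Fin n → ℕ) where
  H : ℕ
  s₁ : Fin nS
  B : Fin n → ℝ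
  P : ℕ → Fin nS → JAct nA → Fin nS → ℝ
  r : ℕ → Fin nS → JAct nA → Fin n → ℝ
  C : Table (ℕ × Fin nS × JAct nA) (Table (Fin n → ℝ) ℝ)

section Feasibility

variable {nS : ℕ} {nA : Fin n → ℕ}

open Classical in
/-- Does the joint action `a` surely keep the budget in the next step? -/
def feasibleAction (g : TabularGame n nS nA) (h : ℕ) (v : Node n nS) (a : JAct nA) :
    Timed Bool := do
  let T ← lookup (n + 2) g.C (h, v.1, a)
  tall T.dom fun c => ⟨decide (v.2 + c ≤ g.B), 2 * n + 1⟩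

open Classical in
/-- The possible next nodes after playing `a`. -/
def successors (g : TabularGame n nS nA) (h : ℕ) (v : Node n nS) (a : JAct nA) :
    Timed (Finset (Node n nS)) := do
  let T ← lookup (n + 2) g.C (h, v.1, a)
  let S ← tfilter Finset.univ fun s' => ⟨decide (0 < g.P h v.1 a s'), 2⟩
  timage (n + 2) (S ×ˢ T.dom) fun p => ⟨(p.1, v.2 + p.2), n + 2⟩

/-- The nodes at time `h + 1` reached from a set of nodes at time `h` by feasible actions. -/
def nextLayer (g : TabularGame n nS nA) (h : ℕ) (L : Finset (Node n nS)) :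
    Timed (Finset (Node n nS)) :=
  tunion (n + 2) L fun v => tunion (n + 2) Finset.univ fun a => do
    let ok ← feasibleAction g h v a
    if ok then successors g h v a else op ∅

/-- The OR nodes of the feasibility tree, time by time: from time `h` on, `k` further times. -/
def buildTree (g : TabularGame n nS nA) :
    (k h : ℕ) → Finset (Node n nS) → Timed (List (Finset (Node n nS)))
  | 0, _, L => op [L]
  | k + 1, h, L => do
    let L' ← nextLayer g h L
    let rest ← buildTree g k (h + 1) L'
    op (L :: rest)

/-- The truth value of an OR node at time `h < H`, with the set of its TRUE AND children, given
the truth values at time `h + 1`. -/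
def labelNode (g : TabularGame n nS nA) (h : ℕ)
    (next : Table (Node n nS) (Bool × Finset (JAct nA))) (v : Node n nS) :
    Timed (Bool × Finset (JAct nA)) := do
  let RA ← tfilter Finset.univ fun a => do
    let ok ← feasibleAction g h v a
    if ok then
      let W ← successors g h v a
      tall W fun w => do
        let l ← lookup (n + 2) next w
        op l.1
    else op false
  op (!decide (RA = ∅), RA)

/-- Bottom-up evaluation of the AND/OR tree; nodes at the last time are TRUE. -/
def aoSolve (g : TabularGame n nS nA) :
    ℕ → List (Finset (Node n nS)) →
      Timed (List (Table (Node n nS) (Bool × Finset (JAct nA))))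
  | _, [] => op []
  | _, [L] => do
    let T ← tabulate L fun _ => op (true, ∅)
    op [T]
  | h, L :: L' :: rest => do
    let Ts ← aoSolve g (h + 1) (L' :: rest)
    let T ← tabulate L (labelNode g h (Ts.headD default))
    op (T :: Ts)

/-- The feasibility algorithm: `none` stands for "Infeasible"; otherwise, for each time, the table
of TRUE nodes with their TRUE actions. -/
def feasibility (g : TabularGame n nS nA) :
    Timed (Option (List (Table (Node n nS) (Finset (JAct nA))))) := do
  let tree ← buildTree g g.H 0 {(g.s₁, 0)}
  let labels ← aoSolve g 0 tree
  let root ← lookup (n + 2) (labels.headD default) (g.s₁, 0)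
  if root.1 then
    let out ← tlist (fun T => do
      let D ← tfilter T.dom fun v => do
        let l ← lookup (n + 2) T v
        op l.1
      tabulate D fun v => do
        let l ← lookup (n + 2) T v
        op l.2) labels
    op (some out)
  else op none

/-- Reward vector and transition probabilities of an action of an action-constrained game. -/
structure ActionData (n nS : ℕ) where
  reward : Fin n → ℝ
  trans : Table (Node n nS) ℝ

instance : Inhabited (ActionData n nS) := ⟨⟨0, default⟩⟩

/-- Action-constrained Markov games, as data: for each time, the table of states, and for each of
them the table of its allowed joint actions. -/
abbrev ACGame (n nS : ℕ) (nA : Fin n → ℕ) : Type :=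
  List (Table (Node n nS) (Table (JAct nA) (ActionData n nS)))

/-- Markovian policies, as data: for each time and state, the probabilities of joint actions. -/
abbrev Strategy (n nS : ℕ) (nA : Fin n → ℕ) : Type :=
  List (Table (Node n nS) (Table (JAct nA) ℝ))

/-- Construction of the reduced game from the output of the feasibility algorithm. -/
def reducedGame (g : TabularGame n nS nA) :
    ℕ → List (Table (Node n nS) (Finset (JAct nA))) → Timed (ACGame n nS nA)
  | _, [] => op []
  | h, T :: rest => do
    let layer ← tabulate T.dom fun v => do
      let X ← lookup (n + 2) T v
      tabulate X fun a => do
        let W ← successors g h v a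
        let c ← lookup (n + 2) g.C (h, v.1, a)
        let tr ← tabulate W fun w => do
          let p ← lookup (n + 1) c (w.2 - v.2)
          ⟨p * g.P h v.1 a w.1, n + 2⟩
        ⟨⟨g.r h v.1 a, tr⟩, n + 1⟩
    let rest' ← reducedGame g (h + 1) rest
    op (layer :: rest')

/-- The reduction, for a solver `mgSolve` of action-constrained games. -/
def reduction (mgSolve : ACGame n nS nA → Timed (Strategy n nS nA)) (g : TabularGame n nS nA) :
    Timed (Option (Strategy n nS nA)) := do
  let x ← feasibility g
  match x with
  | none => op none
  | some F => do
    let A ← reducedGame g 0 F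
    let π ← mgSolve A
    op (some π)

/-- The deviations `(i, advice, a_i')` indexing the constraints of the linear program: for coarse
correlated equilibria there is no advice, for correlated ones the deviation applies to one
recommended action. -/
def deviations (nA : Fin n → ℕ) (e : EqKind) :
    List (Σ i : Fin n, Option (Fin (nA i)) × Fin (nA i)) :=
  match e with
  | .cce => (Finset.univ : Finset (Σ i : Fin n, Fin (nA i))).toList.map fun d => ⟨d.1, none, d.2⟩
  | .ce => (Finset.univ : Finset (Σ i : Fin n, Fin (nA i) × Fin (nA i))).toList.map
      fun d => ⟨d.1, some d.2.1, d.2.2⟩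

open Classical in
/-- The coefficient of `σ(a)` in the constraint of the deviation `d`: `u_i(a) - u_i(a_i', a_{-i})`
if the deviation applies to `a`, where `Q` lists the utilities of the allowed joint actions and
`low i` replaces the utility of forbidden ones. -/
def coefficient (Q : Table (JAct nA) (Fin n → ℝ)) (low : Fin n → ℝ)
    (d : Σ i : Fin n, Option (Fin (nA i)) × Fin (nA i)) (a : JAct nA) : Timed ℝ := do
  let applies ← op (decide (d.2.1 = none ∨ d.2.1 = some (a d.1)))
  if applies then
    let b : JAct nA ← ⟨Function.update a d.1 d.2.2, n + 1⟩
    let q ← lookup (n + 1) Q a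
    let ok ← member (n + 1) Q.dom b
    if ok then
      let q' ← lookup (n + 1) Q b
      op (q d.1 - q' d.1)
    else op (q d.1 - low d.1)
  else op 0

open Classical in
/-- Solve the stage game with utilities `Q` by linear programming.  The utility `-∞` of forbidden
joint actions is replaced by the worst utility of an allowed one minus `1`. -/
def solveMatrixGame (lp : LPSolver) (e : EqKind) (Q : Table (JAct nA) (Fin n → ℝ)) :
    Timed (Table (JAct nA) ℝ) := do
  let low : Fin n → ℝ ←
    ⟨fun i => (⨅ a : {a // a ∈ Q.dom}, Q.get a i) - 1, n * (Q.dom.card + 2)⟩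
  let enum : Fin Q.dom.card → JAct nA ← ⟨fun j => (Q.dom.equivFin.symm j).1, Q.dom.card + 1⟩
  let devs ← ⟨deviations nA e, (deviations nA e).length + 1⟩
  let rows : List ((Fin Q.dom.card → ℝ) × ℝ) ← tlist (fun d => do
    let row ← tarray fun j => coefficient Q low d (enum j)
    op (row, (0 : ℝ))) devs
  let L : LP Q.dom.card ← ⟨⟨rows, [(fun _ => 1, 1)]⟩, Q.dom.card + 2⟩
  let x : Option (Fin Q.dom.card → ℝ) ← ⟨lp.solve L, lp.time L⟩
  tabulate Q.dom fun a =>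
    ⟨if ha : a ∈ Q.dom then (x.getD 0) (Q.dom.equivFin ⟨a, ha⟩) else 0,
      (n + 1) * (Q.dom.card + 1)⟩

/-- Solve one stage: the `Q`-values from the values `V` at the next time, an equilibrium of the
stage game, and its values. -/
def solveStage (lp : LPSolver) (e : EqKind) (X : Table (JAct nA) (ActionData n nS))
    (V : Table (Node n nS) (Fin n → ℝ)) : Timed (Table (JAct nA) ℝ × (Fin n → ℝ)) := do
  let Q : Table (JAct nA) (Fin n → ℝ) ← tabulate X.dom fun a => do
    let d ← lookup (n + 1) X a
    let q ← tsumOver (n + 1) d.trans.dom fun w => do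
      let p ← lookup (n + 2) d.trans w
      let u ← lookup (n + 2) V w
      ⟨p • u, n + 1⟩
    ⟨d.reward + q, n + 1⟩
  let σ ← solveMatrixGame lp e Q
  let u : Fin n → ℝ ← tsumOver (n + 1) Q.dom fun a => do
    let p ← lookup (n + 1) σ a
    let q ← lookup (n + 1) Q a
    ⟨p • q, n + 1⟩
  op (σ, u)

/-- Backward induction.  The last entry of the game is the layer of terminal states, of value `0`.
Returns the policy and the values at the first time. -/
def backwardInduction (lp : LPSolver) (e : EqKind) :
    ACGame n nS nA → Timed (Strategy n nS nA × Table (Node n nS) (Fin n → ℝ))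
  | [] => op ([], default)
  | [T] => do
    let V ← tabulate T.dom fun _ => ⟨0, n + 1⟩
    op ([], V)
  | T :: T' :: rest => do
    let y ← backwardInduction lp e (T' :: rest)
    let S ← tabulate T.dom fun v => do
      let X ← lookup (n + 2) T v
      solveStage lp e X y.2
    let σ ← tabulate T.dom fun v => do
      let z ← lookup (n + 2) S v
      op z.1
    let V ← tabulate T.dom fun v => do
      let z ← lookup (n + 2) S v
      op z.2
    op (σ :: y.1, V)

/-- The constrained solver. -/
def constrainedSolver (lp : LPSolver) (e : EqKind) (A : ACGame n nS nA) :
    Timed (Strategy n nS nA) := do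
  let y ← backwardInduction lp e A
  op y.1

end Feasibility

namespace Game

open Classical in
/-- The rounded costs of player `i` (the multiples `k ℓ` for `k` between
`⌊(B_i - H c_i^max) / ℓ⌋` and `⌊c_i^max / ℓ⌋`) of positive probability, with their probabilities:
`Pr[c < x + ℓ]` for the smallest `x`, and `Pr[x ≤ c < x + ℓ]` for the others.  They are computed
from the distribution function `x ↦ Pr[c < x]`, each evaluation of which takes time `cdf`. -/
def roundedCosts (G : Game n) (ℓ : ℝ) (cdf : ℕ) (k : ℕ × G.State × G.Act) (i : Fin n) :
    Timed (Table ℝ ℝ) := do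
  let F : ℝ → Timed ℝ := fun x => ⟨(G.C i k.1 k.2.1 k.2.2).real (Set.Iio x), cdf + 1⟩
  let lo : ℤ ← ⟨⌊(G.B i - G.H * G.cmax i) / ℓ⌋, 7⟩
  let hi : ℤ ← ⟨⌊G.cmax i / ℓ⌋, 4⟩
  let D : Finset ℝ ← ⟨(Finset.Icc lo hi).image fun z : ℤ => (z : ℝ) * ℓ,
    3 * (Finset.Icc lo hi).card + 1⟩
  let T ← tabulate D fun x => do
    let p ← F (x + ℓ)
    let q ← if x = lo * ℓ then op 0 else F x
    ⟨p - q, 4⟩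
  let S ← tfilter D fun x => do
    let p ← lookup 1 T x
    op (decide (0 < p))
  tabulate S fun x => lookup 1 T x

/-- Construction of the approximate game. -/
def approxGame (G : Game n) (ℓ : ℝ) (cdf : ℕ) : Timed (TabularGame n G.nS G.nA) := do
  let C ← tabulate (Finset.range G.H ×ˢ (Finset.univ ×ˢ Finset.univ)) fun k => do
    let T ← tarray fun i => roundedCosts G ℓ cdf k i
    tabulate (Fintype.piFinset fun i => (T i).dom) fun c =>
      tprodOver fun i => lookup 1 (T i) (c i)
  op { H := G.H, s₁ := G.s₁, B := G.B, P := fun h s a s' => (G.P h s a s').toReal, r := G.r, C := C }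

/-- The approximation algorithm; `none` stands for "Infeasible". -/
def approximation (G : Game n) (lp : LPSolver) (e : EqKind) (ℓ : ℝ) (cdf : ℕ) :
    Timed (Option (Strategy n G.nS G.nA)) := do
  let g ← approxGame G ℓ cdf
  reduction (constrainedSolver lp e) g

/-! ## Playing the computed strategy -/

/-- Round a cost of player `i` down to a multiple of `ℓ`, after truncating it from below. -/
def roundCost (G : Game n) (ℓ : ℝ) (i : Fin n) (x : ℝ) : ℝ :=
  ⌊max x (G.B i - G.H * G.cmax i) / ℓ⌋ * ℓ

/-- The cumulative rounded cost of a history. -/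
def cumRounded (G : Game n) (ℓ : ℝ) {t : ℕ} (τ : G.Hist t) : Fin n → ℝ :=
  fun i => ∑ j : Finset.Iic t, if 1 ≤ (j : ℕ) then G.roundCost ℓ i ((τ j).2.1 i) else 0

open Classical in
/-- The distribution with given probabilities; if they are not probabilities, a fixed joint action
is played. -/
def toPMF (G : Game n) (w : G.Act → ℝ) : PMF G.Act :=
  if hw : (∀ a, 0 ≤ w a) ∧ ∑ a, w a = 1 then
    PMF.ofFintype (fun a => ENNReal.ofReal (w a)) (by
      rw [← ENNReal.ofReal_sum_of_nonneg fun a _ => hw.1 a, hw.2, ENNReal.ofReal_one])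
  else PMF.pure G.act₀

open Classical in
/-- The mixed joint action that the strategy prescribes at time `t` at a node; at nodes that are
not listed, a fixed joint action is played. -/
def prescribed (G : Game n) (σ : Strategy n G.nS G.nA) (t : ℕ) (v : Node n G.nS) : PMF G.Act :=
  if v ∈ (σ.getD t default).dom then
    G.toPMF fun a =>
      if a ∈ ((σ.getD t default).get v).dom then ((σ.getD t default).get v).get a else 0
  else PMF.pure G.act₀

theorem measurable_cumRounded (G : Game n) (ℓ : ℝ) (t : ℕ) :
    Measurable (G.cumRounded ℓ (t := t)) := by
  refine measurable_pi_lambda _ fun i => ?_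
  unfold cumRounded roundCost
  refine Finset.measurable_sum _ fun j _ => ?_
  split_ifs
  · refine Measurable.mul_const ?_ _
    refine (measurable_of_countable fun z : ℤ => (z : ℝ)).comp ?_
    refine Int.measurable_floor.comp ?_
    fun_prop
  · exact measurable_const

/-- The history-dependent policy of playing a strategy: at time `t` with history `τ`, look up the
current state and the cumulative rounded cost. -/
def play (G : Game n) (ℓ : ℝ) (σ : Strategy n G.nS G.nA) : G.Policy where
  act t τ := G.prescribed σ t (G.curState τ, G.cumRounded ℓ τ)
  meas t a := by
    have h : Measurable fun v : Node n G.nS => G.prescribed σ t v a := by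
      classical
      set D := (σ.getD t default).dom
      have h1 : ∀ v : Node n G.nS, G.prescribed σ t v a = ∑ u ∈ D,
          (if v = u then G.prescribed σ t u a else 0) + if v ∈ D then 0 else PMF.pure G.act₀ a := by
        intro v
        rw [Finset.sum_ite_eq]
        by_cases hv : v ∈ D
        · rw [if_pos hv, if_pos hv, add_zero]
        · simp only [hv, if_false, zero_add]
          unfold prescribed
          rw [if_neg hv]
      rw [funext h1]
      refine Measurable.add (Finset.measurable_sum _ fun u _ => ?_) ?_
      · exact Measurable.ite (measurableSet_singleton u) measurable_const measurable_const
      · exact Measurable.ite D.measurableSet measurable_const measurable_const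
    exact h.comp ((G.measurable_curState t).prodMk (G.measurable_cumRounded ℓ t))

end Game

end AnytimeGame

end

open MeasureTheory ProbabilityTheory

noncomputable section

namespace AnytimeGame

/-! ## Correlated equilibria supported on an allowed set -/

/-! Correctness. A history is followed in the rounded game through its node, that is, its current
state and cumulative rounded cost. Rounding down loses at most `ℓ` per step, so keeping the rounded
budget exceeds the true one by at most `H ℓ = ε`. Conversely, a feasible policy must never look
infeasible after rounding. Rounding down only helps. Truncation at `B_i - H c_i^max` may raise a
cost, but one cost that low together with maximal costs in the other `H - 1` steps still ends below
the budget. The invariant `RoundingBounds` records both facts. By `isTrue_of_feasibleFrom` and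
`mem_trueActions_of_feasibleFrom`, a feasible policy then visits only TRUE nodes and plays only TRUE
actions there; a FALSE root thus excludes feasible policies.

Equilibrium. The law of the next node depends on the history only through its node
(`integral_node_extend`), so the values of backward induction are the true values of the played
strategy (`play_value`). A deviation that is exactly feasible plays only TRUE actions, so the
artificial utility of forbidden actions never enters, and the stage constraints bound its value by
backward induction (`modify_value_le`).

Solvability of the stage programs is `exists_correlatedEquilibrium`: if the forbidden joint actions
are worst for everybody, some correlated equilibrium lives on the allowed ones. This is the
separation argument of Hart and Schmeidler. Otherwise some nonnegative weights on the deviations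
make the weighted gain of obedience negative at every allowed action. After a perturbation the
weights are positive, and the product of the players' stationary vectors for these rates has total
gain zero, a contradiction.

Running time. The value of every program is first found in closed form, so the sizes of its tables
are known. All are controlled by one number `M` (`SizeBound`), and the time is polynomial in `M`.
Cumulative costs are multiples of `ℓ`; with `m` rounded costs per player a layer has at most `|S| (H
m + 1)^n` nodes, and `m` is of order `|G| q(|G|) / ε`. -/

/-- A positive rate matrix has a positive stationary vector. -/
theorem exists_pos_stationary {ι : Type*} [Fintype ι] [DecidableEq ι] [Nonempty ι]
    (α : ι → ι → ℝ) (hα : ∀ x y, 0 < α x y) :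
    ∃ p : ι → ℝ, (∀ x, 0 < p x) ∧ ∀ y, ∑ x, p x * α x y = p y * ∑ z, α y z := by
  set r : ι → ℝ := fun x => ∑ z, α x z with hr
  have hr0 : ∀ x, 0 < r x := fun x => Finset.sum_pos (fun z _ => hα x z) Finset.univ_nonempty
  -- The Laplacian of the rates kills constants from the right, so it is singular and also has a
  -- left null vector, though of unknown signs.
  let M : Matrix ι ι ℝ := Matrix.of fun x y => (if x = y then r x else 0) - α x y
  have hM : ∃ v, v ≠ 0 ∧ Matrix.mulVec M v = 0 := by
    refine ⟨fun _ => 1, ?_, ?_⟩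
    · intro h
      have := congrFun h (Classical.arbitrary ι)
      simp at this
    · ext x
      simp [M, Matrix.mulVec, dotProduct, hr]
  rw [Matrix.exists_mulVec_eq_zero_iff, ← Matrix.exists_vecMul_eq_zero_iff] at hM
  obtain ⟨v, hv0, hv⟩ := hM
  have hst : ∀ y, ∑ x, v x * α x y = v y * r y := by
    intro y
    have := congrFun hv y
    simp only [M, Matrix.vecMul, dotProduct, Matrix.of_apply, mul_sub, Finset.sum_sub_distrib,
      mul_ite, mul_zero, Finset.sum_ite_eq', Finset.mem_univ, if_true, Pi.zero_apply] at this
    linarith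
  have hle : ∀ y ∈ Finset.univ, |v y| * r y ≤ ∑ x, |v x| * α x y := by
    intro y _
    calc |v y| * r y = |v y * r y| := by rw [abs_mul, abs_of_pos (hr0 y)]
      _ = |∑ x, v x * α x y| := by rw [hst]
      _ ≤ ∑ x, |v x * α x y| := Finset.abs_sum_le_sum_abs _ _
      _ = _ := by simp only [abs_mul, abs_of_pos (hα _ _)]
  have hsum : ∑ y, |v y| * r y = ∑ y, ∑ x, |v x| * α x y := by
    rw [Finset.sum_comm]
    simp only [hr, Finset.mul_sum]
  -- Termwise inequalities with equal totals are equalities, so the absolute values of `v` are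
  -- themselves stationary.
  have heq := (Finset.sum_eq_sum_iff_of_le hle).1 hsum
  refine ⟨fun x => |v x|, ?_, fun y => (heq y (Finset.mem_univ y)).symm⟩
  intro y
  obtain ⟨x, hx⟩ := Function.ne_iff.1 hv0
  have h1 : 0 < |v x| * α x y := mul_pos (abs_pos.2 hx) (hα x y)
  have h2 : |v x| * α x y ≤ ∑ x, |v x| * α x y :=
    Finset.single_le_sum (f := fun x => |v x| * α x y)
      (fun z _ => mul_nonneg (abs_nonneg _) (hα z y).le) (Finset.mem_univ x)
  rw [← heq y (Finset.mem_univ y)] at h2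
  exact pos_of_mul_pos_left (h1.trans_le h2) (hr0 y).le

variable {I : Type*} [Fintype I] [DecidableEq I] {A : I → Type*}

theorem prod_update_mul {p : ∀ i, A i → ℝ} (a : ∀ i, A i) (i : I) (y : A i) :
    ∏ j, p j (Function.update a i y j) = p i y * ∏ j ∈ Finset.univ.erase i, p j (a j) := by
  rw [← Finset.mul_prod_erase _ _ (Finset.mem_univ i), Function.update_self]
  congr 1
  refine Finset.prod_congr rfl fun j hj => ?_
  rw [Function.update_of_ne (Finset.ne_of_mem_erase hj)]

variable [∀ i, Fintype (A i)]

/-- Under a product of stationary vectors, every player's expected gain vanishes. -/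
theorem sum_prod_stationary_gain (w : (∀ i, A i) → ℝ) (p : ∀ i, A i → ℝ) (i : I)
    (α : A i → A i → ℝ) (hp : ∀ y, ∑ x, p i x * α x y = p i y * ∑ z, α y z) :
    ∑ a : ∀ i, A i, (∏ j, p j (a j)) *
      ∑ y, α (a i) y * (w a - w (Function.update a i y)) = 0 := by
  have h1 : ∑ a : ∀ i, A i, ∑ y, (∏ j, p j (a j)) * (α (a i) y * w (Function.update a i y)) =
      ∑ a : ∀ i, A i, ∑ y, (∏ j, p j (Function.update a i y j)) * (α y (a i) * w a) := by
    rw [← Fintype.sum_prod_type' (f := fun (a : ∀ i, A i) (y : A i) =>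
        (∏ j, p j (a j)) * (α (a i) y * w (Function.update a i y))),
      ← Fintype.sum_prod_type' (f := fun (a : ∀ i, A i) (y : A i) =>
        (∏ j, p j (Function.update a i y j)) * (α y (a i) * w a))]
    -- Exchanging the recommended action with the deviation is a bijection of the index set; it
    -- moves the update from the utility to the product weight.
    have hinv : Function.Involutive
        (fun q : (∀ i, A i) × A i => (Function.update q.1 i q.2, q.1 i)) := by
      intro q
      simp
    refine Fintype.sum_equiv hinv.toPerm _ _ fun q => ?_
    simp [Function.Involutive.toPerm]
  have h2 : ∀ a : ∀ i, A i, ∑ y, (∏ j, p j (Function.update a i y j)) * (α y (a i) * w a) =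
      ∑ y, (∏ j, p j (a j)) * (α (a i) y * w a) := by
    intro a
    have h3 : ∀ y, (∏ j, p j (Function.update a i y j)) * (α y (a i) * w a) =
        (p i y * α y (a i)) * ((∏ j ∈ Finset.univ.erase i, p j (a j)) * w a) := by
      intro y
      rw [prod_update_mul]
      ring
    simp only [h3]
    -- Stationarity replaces the inflow into `a i` by the outflow from it.
    rw [← Finset.sum_mul, hp, ← Finset.mul_sum, ← Finset.sum_mul,
      ← Finset.mul_prod_erase _ _ (Finset.mem_univ i)]
    ring
  simp only [mul_sub, Finset.mul_sum, Finset.sum_sub_distrib]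
  rw [h1, Finset.sum_congr rfl fun a _ => h2 a, sub_self]

variable [∀ i, DecidableEq (A i)]

/-- The gain of player `i` from following the advice instead of playing `y` when told `x`, for
`d = (i, x, y)`, at the recommendation `a`. -/
def adviceGain (w : I → (∀ i, A i) → ℝ) (d : Σ i, A i × A i) (a : ∀ i, A i) : ℝ :=
  if a d.1 = d.2.1 then w d.1 a - w d.1 (Function.update a d.1 d.2.2) else 0

theorem sum_rates_mul_adviceGain (w : I → (∀ i, A i) → ℝ) (α : (Σ i, A i × A i) → ℝ)
    (a : ∀ i, A i) :
    ∑ d, α d * adviceGain w d a =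
      ∑ i, ∑ y, α ⟨i, a i, y⟩ * (w i a - w i (Function.update a i y)) := by
  rw [Fintype.sum_sigma]
  refine Finset.sum_congr rfl fun i _ => ?_
  rw [Fintype.sum_prod_type, Finset.sum_eq_single (a i)]
  · simp [adviceGain]
  · intro x _ hx
    simp [adviceGain, Ne.symm hx]
  · simp

/-- If the joint actions outside of a nonempty set `X` are the worst ones for everybody, there is
a correlated equilibrium supported on `X`. -/
theorem exists_correlatedEquilibrium (X : Finset (∀ i, A i)) (hX : X.Nonempty)
    (w : I → (∀ i, A i) → ℝ) (hw : ∀ i, ∀ a ∉ X, ∀ b, w i a ≤ w i b) :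
    ∃ σ : (∀ i, A i) → ℝ, (∀ a, 0 ≤ σ a) ∧ (∀ a ∉ X, σ a = 0) ∧ ∑ a, σ a = 1 ∧
      ∀ d, 0 ≤ ∑ a, σ a * adviceGain w d a := by
  by_contra hcon
  push Not at hcon
  let Φ : ((∀ i, A i) → ℝ) →ₗ[ℝ] ((Σ i, A i × A i) → ℝ) :=
    { toFun := fun σ d => ∑ a, σ a * adviceGain w d a
      map_add' := fun σ τ => by
        ext d
        simp [add_mul, Finset.sum_add_distrib]
      map_smul' := fun c σ => by
        ext d
        simp [Finset.mul_sum, mul_assoc] }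
  -- `S` consists of the distributions supported on `X`. If no equilibrium exists, its compact
  -- convex image under the gain map misses the nonnegative orthant and can be separated from it.
  let S : Set ((∀ i, A i) → ℝ) := stdSimplex ℝ _ ∩ {σ | ∀ a ∉ X, σ a = 0}
  have hSc : Convex ℝ S := by
    refine (convex_stdSimplex ℝ _).inter ?_
    intro σ hσ τ hτ s t _ _ _ a ha
    simp [hσ a ha, hτ a ha]
  have hSk : IsCompact S := by
    refine (isCompact_stdSimplex ℝ _).inter_right ?_
    simp only [Set.ofPred_forall]
    exact isClosed_iInter fun a => isClosed_iInter fun _ =>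
      isClosed_eq (continuous_apply a) continuous_const
  have hT : IsClosed {z : (Σ i, A i × A i) → ℝ | ∀ d, 0 ≤ z d} := by
    simp only [Set.ofPred_forall]
    exact isClosed_iInter fun d => isClosed_le continuous_const (continuous_apply d)
  have hTc : Convex ℝ {z : (Σ i, A i × A i) → ℝ | ∀ d, 0 ≤ z d} := by
    intro z hz z' hz' s t hs ht _ d
    exact add_nonneg (mul_nonneg hs (hz d)) (mul_nonneg ht (hz' d))
  obtain ⟨f, u, v, hfu, huv, hfv⟩ := geometric_hahn_banach_compact_closed
    (hSc.linear_image Φ) (hSk.image (LinearMap.continuous_on_pi Φ)) hTc hT (by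
      rw [Set.disjoint_left]
      rintro _ ⟨σ, hσ, rfl⟩ hpos
      obtain ⟨d, hd⟩ := hcon σ hσ.1.1 hσ.2 hσ.1.2
      exact absurd (hpos d) (not_le.2 hd))
  have hv0 : v < 0 := by simpa using hfv 0 (by simp)
  set β : (Σ i, A i × A i) → ℝ := fun d => f (Pi.single d 1) with hβ
  have hf : ∀ z, f z = ∑ d, β d * z d := by
    intro z
    conv_lhs => rw [pi_eq_sum_univ' z, map_sum]
    refine Finset.sum_congr rfl fun d _ => ?_
    rw [map_smul, smul_eq_mul, mul_comm]
  -- With a negative coefficient, `f` would take the value `v` exactly at a point of the orthant on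
  -- the corresponding axis.
  have hβ0 : ∀ d, 0 ≤ β d := by
    intro d
    by_contra hneg
    rw [not_le] at hneg
    have := hfv ((v / β d) • Pi.single d 1) (by
      intro e
      have h1 : 0 ≤ v / β d := div_nonneg_of_nonpos hv0.le hneg.le
      by_cases he : e = d
      · subst he
        simpa using h1
      · simp [he])
    rw [map_smul, smul_eq_mul, div_mul_cancel₀ _ hneg.ne] at this
    exact lt_irrefl _ this
  have hpure : ∀ a ∈ X, ∑ d, β d * adviceGain w d a < u := by
    intro a ha
    have := hfu (Φ (Pi.single a 1)) ⟨_, ⟨single_mem_stdSimplex ℝ a, fun b hb => by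
      rw [Pi.single_apply, if_neg]
      rintro rfl
      exact hb ha⟩, rfl⟩
    rw [hf] at this
    simpa [Φ, Pi.single_apply] using this
  set s : (∀ i, A i) → ℝ := fun a => ∑ d, adviceGain w d a with hs
  -- Stationary vectors need strictly positive rates. Adding `δ` to every weight raises the gain at
  -- any `a` by at most `-u`, which the strict bound by `u` absorbs.
  set δ : ℝ := -u / (1 + ∑ a, |s a|) with hδ
  have hden : 0 < 1 + ∑ a, |s a| :=
    add_pos_of_pos_of_nonneg one_pos (Finset.sum_nonneg fun a _ => abs_nonneg _)
  have hu0 : u < 0 := huv.trans hv0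
  have hδ0 : 0 < δ := div_pos (neg_pos.2 hu0) hden
  set α : (Σ i, A i × A i) → ℝ := fun d => β d + δ with hα
  have hα0 : ∀ d, 0 < α d := fun d => add_pos_of_nonneg_of_pos (hβ0 d) hδ0
  have hneg : ∀ a ∈ X, ∑ d, α d * adviceGain w d a < 0 := by
    intro a ha
    have h1 : ∑ d, α d * adviceGain w d a = ∑ d, β d * adviceGain w d a + δ * s a := by
      simp only [hα, add_mul, Finset.sum_add_distrib, hs, Finset.mul_sum]
    have h2 : δ * s a ≤ δ * (1 + ∑ a, |s a|) := by
      refine mul_le_mul_of_nonneg_left ?_ hδ0.le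
      have := Finset.single_le_sum (f := fun a => |s a|) (fun b _ => abs_nonneg _)
        (Finset.mem_univ a)
      have h3 := le_abs_self (s a)
      linarith
    rw [hδ, div_mul_cancel₀ _ hden.ne', ← hδ] at h2
    have := hpure a ha
    linarith
  obtain ⟨a₀, ha₀⟩ := hX
  have hst : ∀ i, ∃ p : A i → ℝ, (∀ x, 0 < p x) ∧
      ∀ y, ∑ x, p x * α ⟨i, x, y⟩ = p y * ∑ z, α ⟨i, y, z⟩ := fun i =>
    haveI : Nonempty (A i) := ⟨a₀ i⟩
    exists_pos_stationary (fun x y => α ⟨i, x, y⟩) fun x y => hα0 _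
  choose p hp0 hp using hst
  have hP : ∀ a : ∀ i, A i, 0 < ∏ j, p j (a j) := fun a => Finset.prod_pos fun j _ => hp0 j _
  have hzero : ∑ a : ∀ i, A i, (∏ j, p j (a j)) * ∑ d, α d * adviceGain w d a = 0 := by
    have h1 : ∀ a : ∀ i, A i, (∏ j, p j (a j)) * ∑ d, α d * adviceGain w d a =
        ∑ i, (∏ j, p j (a j)) *
          ∑ y, α ⟨i, a i, y⟩ * (w i a - w i (Function.update a i y)) := fun a => by
      rw [sum_rates_mul_adviceGain, Finset.mul_sum]
    rw [Finset.sum_congr rfl fun a _ => h1 a, Finset.sum_comm]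
    exact Finset.sum_eq_zero fun i _ =>
      sum_prod_stationary_gain (w i) p i (fun x y => α ⟨i, x, y⟩) (hp i)
  have hle : ∀ a : ∀ i, A i, (∏ j, p j (a j)) * ∑ d, α d * adviceGain w d a ≤ 0 := by
    intro a
    refine mul_nonpos_of_nonneg_of_nonpos (hP a).le ?_
    -- On `X` the separation gives the sign; off `X` leaving a worst action never hurts, so
    -- obedience gains nothing.
    by_cases ha : a ∈ X
    · exact (hneg a ha).le
    · refine Finset.sum_nonpos fun d _ => mul_nonpos_of_nonneg_of_nonpos (hα0 d).le ?_
      unfold adviceGain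
      split_ifs
      · exact sub_nonpos.2 (hw _ a ha _)
      · exact le_rfl
  have := (Finset.sum_eq_zero_iff_of_nonpos fun a _ => hle a).1 hzero a₀ (Finset.mem_univ _)
  exact absurd this (mul_neg_of_pos_of_neg (hP a₀) (hneg a₀ ha₀)).ne

/-! ## Results of the elementary programs -/

section Programs

variable {α β ι κ : Type}

@[simp] theorem Timed.val_bind (x : Timed α) (f : α → Timed β) : (x >>= f).val = (f x.val).val := rfl

@[simp] theorem Timed.time_bind (x : Timed α) (f : α → Timed β) :
    (x >>= f).time = x.time + (f x.val).time := rfl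

@[simp] theorem op_val (a : α) : (op a).val = a := rfl

@[simp] theorem op_time (a : α) : (op a).time = 1 := rfl

@[simp] theorem lookup_val (w : ℕ) (T : Table ι β) (x : ι) : (lookup w T x).val = T.get x := rfl

@[simp] theorem tabulate_dom [Inhabited β] (D : Finset ι) (f : ι → Timed β) :
    (tabulate D f).val.dom = D := rfl

theorem tabulate_get [Inhabited β] {D : Finset ι} {f : ι → Timed β} {x : ι} (hx : x ∈ D) :
    (tabulate D f).val.get x = (f x).val := if_pos hx

theorem tabulate_get_of_notMem [Inhabited β] {D : Finset ι} {f : ι → Timed β} {x : ι}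
    (hx : x ∉ D) : (tabulate D f).val.get x = default := if_neg hx

/-- Off `D` both tables hold `default`, so agreement on `D` makes them literally equal. This permits
replacing program outputs by closed forms through rewriting. -/
theorem tabulate_congr [Inhabited β] {D : Finset ι} {f f' : ι → Timed β}
    (h : ∀ x ∈ D, (f x).val = (f' x).val) : (tabulate D f).val = (tabulate D f').val := by
  unfold tabulate
  simp only [Table.mk.injEq, true_and]
  funext x
  split_ifs with hx
  · exact h x hx
  · rfl

@[simp] theorem mem_tfilter {D : Finset ι} {p : ι → Timed Bool} {x : ι} :
    x ∈ (tfilter D p).val ↔ x ∈ D ∧ (p x).val = true := Finset.mem_filter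

@[simp] theorem tall_val_iff {D : Finset ι} {p : ι → Timed Bool} :
    (tall D p).val = true ↔ ∀ x ∈ D, (p x).val = true := by
  classical
  exact decide_eq_true_iff

@[simp] theorem mem_timage {w : ℕ} {D : Finset ι} {f : ι → Timed κ} {y : κ} :
    y ∈ (timage w D f).val ↔ ∃ x ∈ D, (f x).val = y := by
  classical
  exact Finset.mem_image

@[simp] theorem mem_tunion {w : ℕ} {D : Finset ι} {f : ι → Timed (Finset κ)} {y : κ} :
    y ∈ (tunion w D f).val ↔ ∃ x ∈ D, y ∈ (f x).val := by
  classical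
  exact Finset.mem_biUnion

@[simp] theorem tlist_val (f : ι → Timed β) (l : List ι) :
    (tlist f l).val = l.map fun x => (f x).val := by
  induction l with
  | nil => rfl
  | cons x l ih => simp [tlist, ih]

end Programs

/-! ## The feasibility algorithm -/

section FeasibilitySemantics

variable {n nS : ℕ} {nA : Fin n → ℕ} (g : TabularGame n nS nA)

theorem feasibleAction_val_iff {h : ℕ} {v : Node n nS} {a : JAct nA} :
    (feasibleAction g h v a).val = true ↔ ∀ c ∈ (g.C.get (h, v.1, a)).dom, v.2 + c ≤ g.B := by
  simp [feasibleAction]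

theorem mem_successors {h : ℕ} {v w : Node n nS} {a : JAct nA} :
    w ∈ (successors g h v a).val ↔
      ∃ s' c, 0 < g.P h v.1 a s' ∧ c ∈ (g.C.get (h, v.1, a)).dom ∧ w = (s', v.2 + c) := by
  simp only [successors, Timed.val_bind, lookup_val, mem_timage, Finset.mem_product, mem_tfilter,
    Finset.mem_univ, true_and, decide_eq_true_eq, Prod.exists]
  constructor
  · rintro ⟨s', c, ⟨h1, h2⟩, rfl⟩
    exact ⟨s', c, h1, h2, rfl⟩
  · rintro ⟨s', c, h1, h2, rfl⟩
    exact ⟨s', c, ⟨h1, h2⟩, rfl⟩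

theorem mem_nextLayer {h : ℕ} {L : Finset (Node n nS)} {w : Node n nS} :
    w ∈ (nextLayer g h L).val ↔ ∃ v ∈ L, ∃ a, (feasibleAction g h v a).val = true ∧
      w ∈ (successors g h v a).val := by
  simp only [nextLayer, mem_tunion, Finset.mem_univ, true_and, Timed.val_bind]
  refine exists_congr fun v => and_congr_right fun _ => exists_congr fun a => ?_
  split_ifs with hf
  · simp [hf]
  · simp [hf]

/-- The OR nodes at time `h`. -/
def reachLayer : ℕ → Finset (Node n nS)
  | 0 => {(g.s₁, 0)}
  | h + 1 => (nextLayer g h (reachLayer h)).val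

/-- The truth value of a node at time `h`, when `k` steps remain. -/
def truthAfter : (k h : ℕ) → Node n nS → Prop
  | 0, _, _ => True
  | k + 1, h, v => ∃ a, (feasibleAction g h v a).val = true ∧
      ∀ w ∈ (successors g h v a).val, truthAfter k (h + 1) w

/-- The TRUE nodes. -/
def IsTrue (h : ℕ) (v : Node n nS) : Prop := truthAfter g (g.H - h) h v

open Classical in
/-- The actions that lead only to TRUE nodes; none at the last time. -/
def trueActions (h : ℕ) (v : Node n nS) : Finset (JAct nA) :=
  if h < g.H then Finset.univ.filter fun a => (feasibleAction g h v a).val = true ∧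
    ∀ w ∈ (successors g h v a).val, IsTrue g (h + 1) w
  else ∅

variable {g}

theorem mem_trueActions {h : ℕ} (hh : h < g.H) {v : Node n nS} {a : JAct nA} :
    a ∈ trueActions g h v ↔ (feasibleAction g h v a).val = true ∧
      ∀ w ∈ (successors g h v a).val, IsTrue g (h + 1) w := by
  simp [trueActions, hh]

theorem isTrue_iff {h : ℕ} (hh : h < g.H) {v : Node n nS} :
    IsTrue g h v ↔ (trueActions g h v).Nonempty := by
  unfold IsTrue Finset.Nonempty
  obtain ⟨k, hk⟩ : ∃ k, g.H - h = k + 1 := ⟨g.H - h - 1, by lia⟩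
  simp only [mem_trueActions hh, IsTrue, hk, truthAfter]
  rw [show g.H - (h + 1) = k by lia]

theorem isTrue_of_le {h : ℕ} (hh : g.H ≤ h) (v : Node n nS) : IsTrue g h v := by
  unfold IsTrue
  rw [Nat.sub_eq_zero_of_le hh]
  trivial

theorem successors_subset_reachLayer {h : ℕ} {v : Node n nS} (hv : v ∈ reachLayer g h)
    {a : JAct nA} (ha : (feasibleAction g h v a).val = true) :
    (successors g h v a).val ⊆ reachLayer g (h + 1) :=
  fun _ hw => (mem_nextLayer g).2 ⟨v, hv, a, ha, hw⟩

variable (g)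

open Classical in
/-- The table of truth values and TRUE actions at time `h`. -/
def labelTable (h : ℕ) : Table (Node n nS) (Bool × Finset (JAct nA)) :=
  (tabulate (reachLayer g h) fun v => op (decide (IsTrue g h v), trueActions g h v)).val

open Classical in
/-- The TRUE nodes at time `h`. -/
def trueLayer (h : ℕ) : Finset (Node n nS) := (reachLayer g h).filter fun v => IsTrue g h v

/-- The table of TRUE nodes with their TRUE actions at time `h`. -/
def trueTable (h : ℕ) : Table (Node n nS) (Finset (JAct nA)) :=
  (tabulate (trueLayer g h) fun v => op (trueActions g h v)).val

variable {g}

theorem mem_trueLayer {h : ℕ} {v : Node n nS} :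
    v ∈ trueLayer g h ↔ v ∈ reachLayer g h ∧ IsTrue g h v := by
  classical
  exact Finset.mem_filter

open Classical in
theorem labelTable_get {h : ℕ} {v : Node n nS} (hv : v ∈ reachLayer g h) :
    (labelTable g h).get v = (decide (IsTrue g h v), trueActions g h v) := tabulate_get hv

-- Feasible actions lead from a reached node to reached nodes only, so every lookup in the next
-- table hits a genuine label and never a default.
open Classical in
theorem labelNode_val {h : ℕ} (hh : h < g.H) {v : Node n nS} (hv : v ∈ reachLayer g h) :
    (labelNode g h (labelTable g (h + 1)) v).val =
      (decide (IsTrue g h v), trueActions g h v) := by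
  have key : ∀ a, (do
      let ok ← feasibleAction g h v a
      if ok then
        let W ← successors g h v a
        tall W fun w => do
          let l ← lookup (n + 2) (labelTable g (h + 1)) w
          op l.1
      else op false : Timed Bool).val = true ↔ a ∈ trueActions g h v := by
    intro a
    rw [mem_trueActions hh, Timed.val_bind]
    split_ifs with hf
    · simp only [hf, Timed.val_bind, tall_val_iff, lookup_val, op_val, true_and]
      refine forall₂_congr fun w hw => ?_
      rw [labelTable_get (successors_subset_reachLayer hv hf hw)]
      simp
    · simp [hf]
  have hRA : (tfilter Finset.univ fun a => (do
      let ok ← feasibleAction g h v a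
      if ok then
        let W ← successors g h v a
        tall W fun w => do
          let l ← lookup (n + 2) (labelTable g (h + 1)) w
          op l.1
      else op false : Timed Bool)).val = trueActions g h v := by
    ext a
    rw [mem_tfilter, key]
    simp
  rw [labelNode, Timed.val_bind, hRA, op_val]
  congr 1
  rw [← decide_not]
  congr 1
  rw [isTrue_iff hh, Finset.nonempty_iff_ne_empty]

theorem buildTree_val (k h : ℕ) :
    (buildTree g k h (reachLayer g h)).val = (List.range' h (k + 1)).map (reachLayer g) := by
  induction k generalizing h with
  | zero => simp [buildTree]
  | succ k ih =>
    rw [List.range'_succ, List.map_cons, buildTree, Timed.val_bind, Timed.val_bind, op_val]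
    congr 1
    exact ih (h + 1)

theorem aoSolve_val (k h : ℕ) (hk : h + k = g.H) :
    (aoSolve g h ((List.range' h (k + 1)).map (reachLayer g))).val =
      (List.range' h (k + 1)).map (labelTable g) := by
  induction k generalizing h with
  | zero =>
    simp only [zero_add, List.range'_one, List.map_cons, List.map_nil, aoSolve, Timed.val_bind,
      op_val]
    congr 1
    refine tabulate_congr fun v _ => ?_
    have : IsTrue g h v := isTrue_of_le (by lia) v
    simp [this, trueActions, show ¬ h < g.H by lia]
  | succ k ih =>
    have ih' := ih (h + 1) (by lia)
    simp only [List.range'_succ, List.map_cons] at ih' ⊢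
    rw [aoSolve, Timed.val_bind, Timed.val_bind, op_val, ih']
    congr 1
    exact tabulate_congr fun v hv => labelNode_val (by lia) hv

theorem root_mem_reachLayer : (g.s₁, 0) ∈ reachLayer g 0 := Finset.mem_singleton_self _

-- This closed form serves twice: for correctness, and in the time bounds, where it tells which
-- tables the later programs receive.
open Classical in
theorem feasibility_val :
    (feasibility g).val = if IsTrue g 0 (g.s₁, 0) then
      some ((List.range' 0 (g.H + 1)).map (trueTable g)) else none := by
  have h1 : (buildTree g g.H 0 {(g.s₁, 0)}).val =
    (List.range' 0 (g.H + 1)).map (reachLayer g) := buildTree_val g.H 0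
  have h2 := aoSolve_val (g := g) g.H 0 (zero_add _)
  have h3 : ((List.range' 0 (g.H + 1)).map (labelTable g)).headD default = labelTable g 0 := by
    rw [List.range'_succ]
    rfl
  rw [feasibility, Timed.val_bind, Timed.val_bind, Timed.val_bind, h1, h2, h3, lookup_val,
    labelTable_get root_mem_reachLayer]
  by_cases ht : IsTrue g 0 (g.s₁, 0)
  · simp only [ht, decide_true, if_true, Timed.val_bind, op_val, tlist_val, List.map_map,
      Option.some.injEq]
    refine List.map_congr_left fun h _ => ?_
    have hD : (tfilter (labelTable g h).dom fun v => (do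
        let l ← lookup (n + 2) (labelTable g h) v
        op l.1 : Timed Bool)).val = trueLayer g h := by
      ext v
      rw [mem_tfilter, mem_trueLayer]
      refine and_congr_right fun hv => ?_
      rw [Timed.val_bind, lookup_val, labelTable_get hv]
      simp
    simp only [Function.comp_apply]
    rw [hD]
    refine tabulate_congr fun v hv => ?_
    rw [Timed.val_bind, lookup_val, labelTable_get (mem_trueLayer.1 hv).1]
  · simp [ht]

/-! ## The reduced game and backward induction -/

variable (g)

open Classical in
/-- Reward and transition probabilities of a joint action at a node. -/
def nodeAction (h : ℕ) (v : Node n nS) (a : JAct nA) : ActionData n nS :=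
  ⟨g.r h v.1 a, (tabulate (successors g h v a).val fun w =>
    op ((g.C.get (h, v.1, a)).get (w.2 - v.2) * g.P h v.1 a w.1)).val⟩

/-- The allowed joint actions at a node with their data. -/
def nodeActions (h : ℕ) (v : Node n nS) : Table (JAct nA) (ActionData n nS) :=
  (tabulate (trueActions g h v) fun a => op (nodeAction g h v a)).val

/-- The layer of the reduced game at time `h`. -/
def acTable (h : ℕ) : Table (Node n nS) (Table (JAct nA) (ActionData n nS)) :=
  (tabulate (trueLayer g h) fun v => op (nodeActions g h v)).val

variable {g}

theorem reducedGame_val (h m : ℕ) :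
    (reducedGame g h ((List.range' h m).map (trueTable g))).val =
      (List.range' h m).map (acTable g) := by
  induction m generalizing h with
  | zero => rfl
  | succ m ih =>
    rw [List.range'_succ, List.map_cons, List.map_cons, reducedGame, Timed.val_bind,
      Timed.val_bind, op_val, ih]
    congr 1
    refine tabulate_congr fun v hv => ?_
    have hX : (trueTable g h).get v = trueActions g h v := tabulate_get hv
    rw [Timed.val_bind, lookup_val, hX]
    rfl

variable (lp : LPSolver) (e : EqKind) (g)

/-- The table of values of the TRUE nodes at time `h` when `k` steps remain. -/
def valueTableAfter : (k h : ℕ) → Table (Node n nS) (Fin n → ℝ)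
  | 0, h => (tabulate (trueLayer g h) fun _ => op 0).val
  | k + 1, h => (tabulate (trueLayer g h) fun v =>
      op (solveStage lp e (nodeActions g h v) (valueTableAfter k (h + 1))).val.2).val

/-- The table of values of the TRUE nodes at time `h`. -/
def valueTable (h : ℕ) : Table (Node n nS) (Fin n → ℝ) := valueTableAfter g lp e (g.H - h) h

/-- The table of equilibria at the TRUE nodes at time `h`. -/
def stratTable (h : ℕ) : Table (Node n nS) (Table (JAct nA) ℝ) :=
  (tabulate (trueLayer g h) fun v =>
    op (solveStage lp e (nodeActions g h v) (valueTable g lp e (h + 1))).val.1).val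

variable {g}

theorem backwardInduction_val (k h : ℕ) (hk : h + k = g.H) :
    (backwardInduction lp e ((List.range' h (k + 1)).map (acTable g))).val =
      ((List.range' h k).map (stratTable g lp e), valueTable g lp e h) := by
  induction k generalizing h with
  | zero =>
    simp only [zero_add, List.range'_one, List.map_cons, List.map_nil, backwardInduction,
      Timed.val_bind, op_val, List.range'_zero]
    congr 1
    rw [valueTable, show g.H - h = 0 by lia]
    rfl
  | succ k ih =>
    have ih' := ih (h + 1) (by lia)
    have hV : valueTable g lp e h = (tabulate (trueLayer g h) fun v =>
        op (solveStage lp e (nodeActions g h v) (valueTable g lp e (h + 1))).val.2).val := by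
      rw [valueTable, valueTable, show g.H - h = k + 1 by lia, show g.H - (h + 1) = k by lia]
      rfl
    have hS : ∀ v ∈ trueLayer g h, (tabulate (acTable g h).dom fun v => (do
          let X ← lookup (n + 2) (acTable g h) v
          solveStage lp e X (valueTable g lp e (h + 1)) :
            Timed (Table (JAct nA) ℝ × (Fin n → ℝ)))).val.get v =
        (solveStage lp e (nodeActions g h v) (valueTable g lp e (h + 1))).val := by
      intro v hv
      rw [tabulate_get (D := (acTable g h).dom) hv, Timed.val_bind, lookup_val]
      have : (acTable g h).get v = nodeActions g h v := tabulate_get hv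
      rw [this]
    rw [List.range'_succ, List.map_cons]
    rw [List.range'_succ, List.map_cons] at ih' ⊢
    rw [backwardInduction, Timed.val_bind, Timed.val_bind, Timed.val_bind, Timed.val_bind, op_val,
      ih', List.range'_succ, List.map_cons]
    congr 1
    · congr 1
      refine tabulate_congr fun v hv => ?_
      rw [Timed.val_bind, lookup_val, op_val, hS v hv]
      rfl
    · rw [hV]
      refine tabulate_congr fun v hv => ?_
      rw [Timed.val_bind, lookup_val, op_val, hS v hv]
      rfl

open Classical in
theorem reduction_val :
    (reduction (constrainedSolver lp e) g).val = if IsTrue g 0 (g.s₁, 0) then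
      some ((List.range' 0 g.H).map (stratTable g lp e)) else none := by
  rw [reduction, Timed.val_bind, feasibility_val]
  split_ifs
  · simp only [Timed.val_bind, op_val, constrainedSolver]
    rw [reducedGame_val, backwardInduction_val lp e g.H 0 (zero_add _)]
  · rfl

end FeasibilitySemantics

/-! ## Stage games -/

section Stage

variable {n nS : ℕ} {nA : Fin n → ℕ}

open Classical in
/-- The utilities `u` on `X`, extended by the constants `low` to the forbidden joint actions. -/
def extendUtility (X : Finset (JAct nA)) (u : JAct nA → Fin n → ℝ) (low : Fin n → ℝ) (i : Fin n)
    (a : JAct nA) : ℝ := if a ∈ X then u a i else low i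

/-- The gain of following the advice instead of the deviation `d` at the recommendation `a`. -/
def deviationGain (w : Fin n → JAct nA → ℝ) (d : Σ i : Fin n, Option (Fin (nA i)) × Fin (nA i))
    (a : JAct nA) : ℝ :=
  if d.2.1 = none ∨ d.2.1 = some (a d.1) then w d.1 a - w d.1 (Function.update a d.1 d.2.2) else 0

/-- `σ` is an equilibrium of the game on `X` with utilities `w`. -/
structure IsStageEquilibrium (e : EqKind) (X : Finset (JAct nA)) (w : Fin n → JAct nA → ℝ)
    (σ : JAct nA → ℝ) : Prop where
  nonneg : ∀ a ∈ X, 0 ≤ σ a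
  sum_eq_one : ∑ a ∈ X, σ a = 1
  gain_nonneg : ∀ d ∈ deviations nA e, 0 ≤ ∑ a ∈ X, σ a * deviationGain w d a

theorem coefficient_val (Q : Table (JAct nA) (Fin n → ℝ)) (low : Fin n → ℝ)
    (d : Σ i : Fin n, Option (Fin (nA i)) × Fin (nA i)) {a : JAct nA} (ha : a ∈ Q.dom) :
    (coefficient Q low d a).val = deviationGain (extendUtility Q.dom Q.get low) d a := by
  unfold coefficient deviationGain
  rw [Timed.val_bind, op_val]
  by_cases hd : d.2.1 = none ∨ d.2.1 = some (a d.1)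
  · simp only [hd, decide_true, if_true, Timed.val_bind, lookup_val, member, decide_eq_true_eq]
    by_cases hb : Function.update a d.1 d.2.2 ∈ Q.dom
    · simp [hb, ha, extendUtility]
    · simp [hb, ha, extendUtility]
  · simp [hd]

/-- A correlated equilibrium is also a coarse one: the constraint for deviating to `y` without
advice is the sum over `x` of the constraints for playing `y` when told `x`. -/
theorem exists_isStageEquilibrium (e : EqKind) (X : Finset (JAct nA)) (hX : X.Nonempty)
    (w : Fin n → JAct nA → ℝ) (hw : ∀ i, ∀ a ∉ X, ∀ b, w i a ≤ w i b) :
    ∃ σ, IsStageEquilibrium e X w σ := by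
  classical
  obtain ⟨σ, h0, hX0, h1, hσ⟩ := exists_correlatedEquilibrium X hX w hw
  have hsum : ∀ f : JAct nA → ℝ, ∑ a ∈ X, σ a * f a = ∑ a, σ a * f a := fun f =>
    Finset.sum_subset (Finset.subset_univ X) fun a _ ha => by rw [hX0 a ha, zero_mul]
  have hsome : ∀ i x y, 0 ≤ ∑ a, σ a * deviationGain w ⟨i, some x, y⟩ a := by
    intro i x y
    refine (hσ ⟨i, x, y⟩).trans_eq (Finset.sum_congr rfl fun a _ => ?_)
    simp [adviceGain, deviationGain, eq_comm]
  refine ⟨σ, fun a _ => h0 a, ?_, ?_⟩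
  · simpa using (hsum fun _ => 1).trans (by simpa using h1)
  · intro d hd
    rw [hsum]
    cases e with
    | ce =>
      simp only [deviations, List.mem_map, Finset.mem_toList, Finset.mem_univ, true_and] at hd
      obtain ⟨d', rfl⟩ := hd
      exact hsome _ _ _
    | cce =>
      simp only [deviations, List.mem_map, Finset.mem_toList, Finset.mem_univ, true_and] at hd
      obtain ⟨⟨i, y⟩, rfl⟩ := hd
      refine (Finset.sum_nonneg fun x (_ : x ∈ Finset.univ) => hsome i x y).trans_eq ?_
      rw [Finset.sum_comm]
      refine Finset.sum_congr rfl fun a _ => ?_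
      rw [← Finset.mul_sum]
      congr 1
      simp [deviationGain]

variable (lp : LPSolver) (e : EqKind)

theorem solveMatrixGame_spec (Q : Table (JAct nA) (Fin n → ℝ)) (hQ : Q.dom.Nonempty) :
    (solveMatrixGame lp e Q).val.dom = Q.dom ∧
      ∃ low, IsStageEquilibrium e Q.dom (extendUtility Q.dom Q.get low)
        (solveMatrixGame lp e Q).val.get := by
  classical
  refine ⟨rfl, ?_⟩
  set low : Fin n → ℝ := fun i => (⨅ a : {a // a ∈ Q.dom}, Q.get a i) - 1 with hlow
  set w := extendUtility Q.dom Q.get low with hw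
  refine ⟨low, ?_⟩
  -- This makes forbidden actions worst for every player, as the existence theorem requires.
  have hle : ∀ i, ∀ a ∈ Q.dom, low i ≤ Q.get a i := by
    intro i a ha
    have : (⨅ a : {a // a ∈ Q.dom}, Q.get a i) ≤ Q.get a i :=
      ciInf_le (f := fun a : {a // a ∈ Q.dom} => Q.get a i) (Set.finite_range _).bddBelow ⟨a, ha⟩
    simp only [hlow]
    linarith
  set N := Q.dom.card with hN
  let enum : Fin N → JAct nA := fun j => (Q.dom.equivFin.symm j).1
  have hen : ∀ j, enum j ∈ Q.dom := fun j => (Q.dom.equivFin.symm j).2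
  have hsum : ∀ f : JAct nA → ℝ, ∑ j, f (enum j) = ∑ a ∈ Q.dom, f a := by
    intro f
    rw [← Finset.sum_coe_sort Q.dom]
    exact Fintype.sum_equiv Q.dom.equivFin.symm _ _ fun j => rfl
  let L : LP N := ⟨(deviations nA e).map fun d => (fun j => deviationGain w d (enum j), (0 : ℝ)),
    [(fun _ => 1, 1)]⟩
  have hval : (solveMatrixGame lp e Q).val = (tabulate Q.dom fun a =>
      op (if ha : a ∈ Q.dom then ((lp.solve L).getD 0) (Q.dom.equivFin ⟨a, ha⟩) else 0)).val := by
    have hL : (⟨(deviations nA e).map fun d =>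
        (fun j => (coefficient Q low d (enum j)).val, (0 : ℝ)), [(fun _ => 1, 1)]⟩ : LP N) = L := by
      congr 1
      refine List.map_congr_left fun d _ => ?_
      congr 1
      funext j
      exact coefficient_val Q low d (hen j)
    rw [← hL]
    simp only [solveMatrixGame, Timed.val_bind, tlist_val, tarray, op_val]
    rfl
  -- Feasibility of the program rules out the answer `none`, for which the table would be filled
  -- with zeros.
  have hex : ∃ x, L.Sat x := by
    obtain ⟨σ, hσ⟩ := exists_isStageEquilibrium e Q.dom hQ w (by
      intro i a ha b
      simp only [hw, extendUtility, ha, if_false]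
      split_ifs with hb
      · exact hle i b hb
      · exact le_rfl)
    refine ⟨fun j => σ (enum j), fun j => hσ.nonneg _ (hen j), ?_, ?_⟩
    · intro c hc
      simp only [L, List.mem_map] at hc
      obtain ⟨d, hd, rfl⟩ := hc
      have := hσ.gain_nonneg d hd
      rw [← hsum] at this
      simpa only [mul_comm] using this
    · intro c hc
      simp only [L, List.mem_singleton] at hc
      subst hc
      simp only [one_mul]
      rw [hsum, hσ.sum_eq_one]
  obtain ⟨x, hx⟩ : ∃ x, lp.solve L = some x := by
    cases hs : lp.solve L with
    | none => exact absurd hex (lp.complete L hs)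
    | some x => exact ⟨x, rfl⟩
  have hsat := lp.sound L x hx
  have hget : ∀ j, (solveMatrixGame lp e Q).val.get (enum j) = x j := by
    intro j
    rw [hval, tabulate_get (hen j), op_val, dif_pos (hen j), hx]
    simp [enum]
  refine ⟨fun a ha => ?_, ?_, fun d hd => ?_⟩
  · have := hget (Q.dom.equivFin ⟨a, ha⟩)
    simp only [enum, Equiv.symm_apply_apply] at this
    rw [this]
    exact hsat.1 _
  · rw [← hsum]
    simp only [hget]
    simpa [L] using hsat.2.2 _ (List.mem_singleton_self _)
  · rw [← hsum]
    simp only [hget]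
    have := hsat.2.1 _ (List.mem_map_of_mem hd)
    simpa only [mul_comm] using this

/-- The `Q`-value of an allowed joint action, given the values at the next time. -/
def qValue (X : Table (JAct nA) (ActionData n nS)) (V : Table (Node n nS) (Fin n → ℝ))
    (a : JAct nA) : Fin n → ℝ :=
  (X.get a).reward + ∑ w ∈ (X.get a).trans.dom, (X.get a).trans.get w • V.get w

theorem solveStage_spec (X : Table (JAct nA) (ActionData n nS))
    (V : Table (Node n nS) (Fin n → ℝ)) (hX : X.dom.Nonempty) :
    (solveStage lp e X V).val.1.dom = X.dom ∧
      (∃ low, IsStageEquilibrium e X.dom (extendUtility X.dom (qValue X V) low)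
        (solveStage lp e X V).val.1.get) ∧
      (solveStage lp e X V).val.2 =
        ∑ a ∈ X.dom, (solveStage lp e X V).val.1.get a • qValue X V a := by
  let Qt : Timed (Table (JAct nA) (Fin n → ℝ)) := tabulate X.dom fun a => do
    let d ← lookup (n + 1) X a
    let q ← tsumOver (n + 1) d.trans.dom fun w => do
      let p ← lookup (n + 2) d.trans w
      let u ← lookup (n + 2) V w
      ⟨p • u, n + 1⟩
    ⟨d.reward + q, n + 1⟩
  have hQ : ∀ a ∈ X.dom, Qt.val.get a = qValue X V a := fun a ha => tabulate_get ha
  have h1 : (solveStage lp e X V).val.1 = (solveMatrixGame lp e Qt.val).val := rfl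
  have h2 : (solveStage lp e X V).val.2 =
      ∑ a ∈ X.dom, (solveMatrixGame lp e Qt.val).val.get a • Qt.val.get a := rfl
  obtain ⟨hd, low, hlow⟩ := solveMatrixGame_spec lp e Qt.val hX
  refine ⟨hd, ⟨low, ?_⟩, ?_⟩
  · have hE : extendUtility X.dom Qt.val.get low = extendUtility X.dom (qValue X V) low := by
      funext i a
      unfold extendUtility
      split_ifs with ha
      · rw [hQ a ha]
      · rfl
    rw [h1, ← hE]
    exact hlow
  · rw [h2, h1]
    exact Finset.sum_congr rfl fun a ha => by rw [hQ a ha]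

variable {e}

/-- In equilibrium, a modification which never leads to a forbidden joint action is not
profitable. -/
theorem IsStageEquilibrium.modify_le {X : Finset (JAct nA)} {u : JAct nA → Fin n → ℝ}
    {low : Fin n → ℝ} {σ : JAct nA → ℝ} (hσ : IsStageEquilibrium e X (extendUtility X u low) σ)
    (i : Fin n) (φ : Fin (nA i) → Fin (nA i) → ℝ) (h0 : ∀ x y, 0 ≤ φ x y)
    (h1 : ∀ x, ∑ y, φ x y = 1) (he : e = .cce → ∀ x x', φ x = φ x')
    (hφ : ∀ a ∈ X, 0 < σ a → ∀ y, 0 < φ (a i) y → Function.update a i y ∈ X) :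
    ∑ a ∈ X, σ a * ∑ y, φ (a i) y * u (Function.update a i y) i ≤ ∑ a ∈ X, σ a * u a i := by
  classical
  set w := extendUtility X u low with hw
  -- This is the combination of the linear constraints with weights `φ x y`. The constraints for
  -- coarse equilibria carry no advice; there `φ` does not depend on it, so any `a₀` in `X` can
  -- supply the weights.
  have key : 0 ≤ ∑ a ∈ X, σ a * ∑ y, φ (a i) y * (w i a - w i (Function.update a i y)) := by
    cases e with
    | ce =>
      have : ∀ x y, 0 ≤ ∑ a ∈ X, σ a * deviationGain w ⟨i, some x, y⟩ a := fun x y =>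
        hσ.gain_nonneg _ (by
          simp only [deviations, List.mem_map, Finset.mem_toList, Finset.mem_univ, true_and]
          exact ⟨⟨i, x, y⟩, rfl⟩)
      refine (Finset.sum_nonneg fun x (_ : x ∈ Finset.univ) => Finset.sum_nonneg
        fun y (_ : y ∈ Finset.univ) => mul_nonneg (h0 x y) (this x y)).trans_eq ?_
      simp only [Finset.mul_sum]
      rw [Finset.sum_comm, Finset.sum_congr rfl fun y _ => Finset.sum_comm, Finset.sum_comm]
      refine Finset.sum_congr rfl fun a _ => Finset.sum_congr rfl fun y _ => ?_
      rw [Finset.sum_eq_single (a i)]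
      · simp only [deviationGain, or_true, if_true]
        ring
      · intro x _ hx
        simp [deviationGain, hx]
      · simp
    | cce =>
      have : ∀ y, 0 ≤ ∑ a ∈ X, σ a * deviationGain w ⟨i, none, y⟩ a := fun y =>
        hσ.gain_nonneg _ (by
          simp only [deviations, List.mem_map, Finset.mem_toList, Finset.mem_univ, true_and]
          exact ⟨⟨i, y⟩, rfl⟩)
      rcases X.eq_empty_or_nonempty with rfl | ⟨a₀, _⟩
      · simp
      refine (Finset.sum_nonneg fun y (_ : y ∈ Finset.univ) =>
        mul_nonneg (h0 (a₀ i) y) (this y)).trans_eq ?_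
      simp only [Finset.mul_sum]
      rw [Finset.sum_comm]
      refine Finset.sum_congr rfl fun a _ => Finset.sum_congr rfl fun y _ => ?_
      rw [he rfl (a i) (a₀ i)]
      simp only [deviationGain, true_or, if_true]
      ring
  -- Terms with zero weight vanish, and in all others the modified action is allowed. Hence `w` may
  -- be replaced by `u`, and `low` disappears.
  have h2 : ∀ a ∈ X, σ a * ∑ y, φ (a i) y * (w i a - w i (Function.update a i y)) =
      σ a * u a i - σ a * ∑ y, φ (a i) y * u (Function.update a i y) i := by
    intro a ha
    rcases (hσ.nonneg a ha).eq_or_lt with hs | hs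
    · simp [← hs]
    rw [← mul_sub]
    congr 1
    have h3 : ∀ y, φ (a i) y * (w i a - w i (Function.update a i y)) =
        φ (a i) y * u a i - φ (a i) y * u (Function.update a i y) i := by
      intro y
      rcases (h0 (a i) y).eq_or_lt with hp | hp
      · simp [← hp]
      · rw [hw, extendUtility, extendUtility, if_pos ha, if_pos (hφ a ha hs y hp), mul_sub]
    simp only [h3, Finset.sum_sub_distrib]
    rw [← Finset.sum_mul, h1, one_mul]
  rw [Finset.sum_congr rfl h2, Finset.sum_sub_distrib] at key
  linarith

end Stage

/-! ## Histories and their laws -/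

/-- The integral of a function of a random variable with finitely many values. -/
theorem integral_comp_of_ae_mem_finset {Ω β : Type*} [MeasurableSpace Ω] {μ : Measure Ω}
    [IsFiniteMeasure μ] {f : Ω → β} {W : Finset β} (hf : ∀ w ∈ W, MeasurableSet (f ⁻¹' {w}))
    (hW : ∀ᵐ x ∂μ, f x ∈ W) (F : β → ℝ) :
    ∫ x, F (f x) ∂μ = ∑ w ∈ W, μ.real (f ⁻¹' {w}) * F w := by
  classical
  have h1 : (fun x => F (f x)) =ᵐ[μ]
      fun x => ∑ w ∈ W, (f ⁻¹' {w}).indicator (fun _ => F w) x := by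
    filter_upwards [hW] with x hx
    rw [Finset.sum_eq_single (f x)]
    · simp
    · intro w _ hw
      rw [Set.indicator_of_notMem]
      simpa using hw.symm
    · exact fun h => absurd hx h
  rw [integral_congr_ae h1, integral_finsetSum]
  · refine Finset.sum_congr rfl fun w hw => ?_
    rw [integral_indicator_const _ (hf w hw), smul_eq_mul]
  · exact fun w hw => (integrable_const _).indicator (hf w hw)

namespace Game

variable {n : ℕ} {G : Game n}

/-- Append a step to a history. -/
def extend {t : ℕ} (τ : G.Hist t) (x : G.Step) : G.Hist (t + 1) :=
  fun j => if h : (j : ℕ) ≤ t then τ ⟨j, Finset.mem_Iic.2 h⟩ else x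

theorem extend_of_le {t : ℕ} (τ : G.Hist t) (x : G.Step) {j : ℕ} (hj : j ≤ t) :
    extend τ x ⟨j, Finset.mem_Iic.2 (hj.trans t.le_succ)⟩ = τ ⟨j, Finset.mem_Iic.2 hj⟩ :=
  dif_pos hj

theorem extend_last {t : ℕ} (τ : G.Hist t) (x : G.Step) :
    extend τ x ⟨t + 1, Finset.mem_Iic.2 le_rfl⟩ = x := dif_neg (by simp)

@[simp] theorem curState_extend {t : ℕ} (τ : G.Hist t) (x : G.Step) :
    G.curState (extend τ x) = x.2.2 := by
  rw [curState, extend_last]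

/-- Identifies the gluing map inside `Kernel.partialTraj` with `extend`, so that one step of the law
of histories is a pushforward of the step kernel. -/
theorem IicProdIoc_piSingleton {t : ℕ} (τ : G.Hist t) (x : G.Step) :
    IicProdIoc (X := fun _ : ℕ => G.Step) t (t + 1)
      (τ, MeasurableEquiv.piSingleton (X := fun _ : ℕ => G.Step) t x) = extend τ x := by
  funext j
  rw [IicProdIoc_def, extend]
  refine dite_congr rfl (fun h => rfl) fun h => ?_
  obtain ⟨j, hj⟩ := j
  obtain rfl : j = t + 1 := by
    have := Finset.mem_Iic.1 hj
    simp only at h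
    lia
  rfl

theorem measurable_extend {t : ℕ} (τ : G.Hist t) : Measurable (extend τ) := by
  refine measurable_pi_lambda _ fun j => ?_
  unfold extend
  split_ifs
  · exact measurable_const
  · exact measurable_id

/-- The common source of the recursions for the true and the rounded cumulative costs; `F` sees the
index because entry `0` and entries beyond a given time are skipped. -/
theorem sum_Iic_extend {M : Type*} [AddCommMonoid M] (F : ℕ → G.Step → M) {t : ℕ} (τ : G.Hist t)
    (x : G.Step) : ∑ j : Finset.Iic (t + 1), F j (extend τ x j) =
      ∑ j : Finset.Iic t, F j (τ j) + F (t + 1) x := by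
  let g : ℕ → M := fun j => if h : j ≤ t then F j (τ ⟨j, Finset.mem_Iic.2 h⟩) else F j x
  have h1 : ∑ j : Finset.Iic (t + 1), F j (extend τ x j) = ∑ j ∈ Finset.Iic (t + 1), g j := by
    rw [← Finset.sum_coe_sort (Finset.Iic (t + 1)) g]
    refine Finset.sum_congr rfl fun j _ => ?_
    simp only [g, extend]
    split_ifs <;> rfl
  have h2 : ∑ j : Finset.Iic t, F j (τ j) = ∑ j ∈ Finset.Iic t, g j := by
    rw [← Finset.sum_coe_sort (Finset.Iic t) g]
    refine Finset.sum_congr rfl fun j _ => ?_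
    simp only [g]
    rw [dif_pos (Finset.mem_Iic.1 j.2)]
  have h3 : g (t + 1) = F (t + 1) x := dif_neg (by simp)
  rw [h1, h2, ← Nat.range_succ_eq_Iic, ← Nat.range_succ_eq_Iic, Finset.sum_range_succ, h3]

theorem cumCost_extend_of_le {t : ℕ} (τ : G.Hist t) (x : G.Step) {m : ℕ} (hm : m ≤ t) :
    G.cumCost (extend τ x) m = G.cumCost τ m := by
  unfold cumCost
  rw [sum_Iic_extend (fun j y => if 1 ≤ j ∧ j ≤ m then y.2.1 else 0), if_neg (by lia), add_zero]

theorem cumCost_extend_succ {t : ℕ} (τ : G.Hist t) (x : G.Step) :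
    G.cumCost (extend τ x) (t + 1) = G.cumCost τ t + x.2.1 := by
  unfold cumCost
  rw [sum_Iic_extend (fun j y => if 1 ≤ j ∧ j ≤ t + 1 then y.2.1 else 0), if_pos (by lia)]
  congr 1
  refine Finset.sum_congr rfl fun j _ => ?_
  have := Finset.mem_Iic.1 j.2
  refine if_congr ?_ rfl rfl
  lia

/-- Round a cost vector. -/
def roundVec (G : Game n) (ℓ : ℝ) (c : Fin n → ℝ) : Fin n → ℝ := fun i => G.roundCost ℓ i (c i)

theorem cumRounded_extend (ℓ : ℝ) {t : ℕ} (τ : G.Hist t) (x : G.Step) :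
    G.cumRounded ℓ (extend τ x) = G.cumRounded ℓ τ + G.roundVec ℓ x.2.1 := by
  funext i
  unfold cumRounded
  rw [sum_Iic_extend (fun j y => if 1 ≤ j then G.roundCost ℓ i (y.2.1 i) else 0),
    if_pos (by lia)]
  rfl

theorem sum_Iic_zero {M : Type*} [AddCommMonoid M] (f : Finset.Iic 0 → M) :
    ∑ j, f j = f ⟨0, Finset.mem_Iic.2 le_rfl⟩ := by
  have : Unique (Finset.Iic 0) :=
    ⟨⟨⟨0, Finset.mem_Iic.2 le_rfl⟩⟩, fun j => Subtype.ext (Nat.le_zero.1 (Finset.mem_Iic.1 j.2))⟩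
  rw [Fintype.sum_unique]
  congr 1
  exact Subsingleton.elim _ _

theorem cumRounded_zero (ℓ : ℝ) (τ : G.Hist 0) : G.cumRounded ℓ τ = 0 := by
  funext i
  unfold cumRounded
  rw [sum_Iic_zero]
  simp

/-! ### Laws of histories: almost sure statements and feasibility, one step at a time -/

namespace Policy

variable (π : G.Policy)

theorem kernel_apply (t : ℕ) (τ : G.Hist t) :
    π.kernel t τ = ∑ a, π.act t τ a • G.stepLaw t (G.curState τ) a := rfl

instance (a b : ℕ) (τ : G.Hist a) : IsProbabilityMeasure (π.law a b τ) := by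
  unfold law
  infer_instance

theorem law_self {t : ℕ} (τ : G.Hist t) : π.law t t τ = Measure.dirac τ := by
  rw [law, Kernel.partialTraj_self, Kernel.id_apply]

theorem law_succ {t : ℕ} (τ : G.Hist t) :
    π.law t (t + 1) τ = (π.kernel t τ).map (extend τ) := by
  have hm := (MeasurableEquiv.piSingleton (X := fun _ : ℕ => G.Step) t).measurable
  have : IsMarkovKernel ((π.kernel t).map
    (MeasurableEquiv.piSingleton (X := fun _ : ℕ => G.Step) t)) := Kernel.IsMarkovKernel.map _ hm
  rw [law, Kernel.partialTraj_succ_self, Kernel.map_apply (f := IicProdIoc (X := fun _ : ℕ => G.Step) t (t + 1)) _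
      measurable_IicProdIoc,
    Kernel.prod_apply, Kernel.id_apply, Kernel.map_apply _ hm, Measure.dirac_prod]
  have hI : Measurable (IicProdIoc (X := fun _ : ℕ => G.Step) t (t + 1)) := measurable_IicProdIoc
  refine (congrArg (Measure.map _) (Measure.map_map measurable_prodMk_left hm)).trans ?_
  refine (Measure.map_map hI (measurable_prodMk_left.comp hm)).trans ?_
  congr 1
  funext x
  exact IicProdIoc_piSingleton τ x

theorem law_eq_bind {a b c : ℕ} (hab : a ≤ b) (hbc : b ≤ c) (τ : G.Hist a) :
    π.law a c τ =
      (π.law a b τ).bind (Kernel.partialTraj (X := fun _ => G.Step) π.kernel b c) := by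
  rw [law, ← Kernel.partialTraj_comp_partialTraj hab hbc, Kernel.comp_apply, law]

/-- By composition of kernels, a set is null for the law up to `c` exactly when it is null given
almost every history at the intermediate time `b`. -/
theorem ae_law_iff {a b c : ℕ} (hab : a ≤ b) (hbc : b ≤ c) (τ : G.Hist a) {p : G.Hist c → Prop}
    (hp : MeasurableSet {τ | p τ}) :
    (∀ᵐ τ' ∂π.law a c τ, p τ') ↔ ∀ᵐ τ₁ ∂π.law a b τ, ∀ᵐ τ' ∂π.law b c τ₁, p τ' := by
  rw [law_eq_bind π hab hbc]
  exact Measure.ae_comp_iff hp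

theorem measurableSet_ae_law {a b : ℕ} {p : G.Hist b → Prop} (hp : MeasurableSet {τ | p τ}) :
    MeasurableSet {τ : G.Hist a | ∀ᵐ τ' ∂π.law a b τ, p τ'} := by
  have : {τ : G.Hist a | ∀ᵐ τ' ∂π.law a b τ, p τ'} =
      {τ | Kernel.partialTraj (X := fun _ => G.Step) π.kernel a b τ {τ | p τ}ᶜ = 0} := rfl
  rw [this]
  exact (Kernel.measurable_coe _ hp.compl) (measurableSet_singleton 0)

/-- The kernel is a finite mixture, so its null sets are the common null sets of the components with
nonzero weight. Feasibility thereby becomes a condition on each action that is actually played. -/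
theorem ae_kernel_iff {t : ℕ} (τ : G.Hist t) {p : G.Step → Prop} :
    (∀ᵐ x ∂π.kernel t τ, p x) ↔
      ∀ a, π.act t τ a ≠ 0 → ∀ᵐ x ∂G.stepLaw t (G.curState τ) a, p x := by
  simp only [ae_iff, kernel_apply, Measure.coe_finsetSum, Finset.sum_apply, Measure.coe_smul,
    Pi.smul_apply, smul_eq_mul, Finset.sum_eq_zero_iff, Finset.mem_univ, true_imp_iff, mul_eq_zero,
    or_iff_not_imp_left, ne_eq]

theorem ae_law_succ_iff {t : ℕ} (τ : G.Hist t) {p : G.Hist (t + 1) → Prop}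
    (hp : MeasurableSet {τ | p τ}) :
    (∀ᵐ τ' ∂π.law t (t + 1) τ, p τ') ↔
      ∀ a, π.act t τ a ≠ 0 → ∀ᵐ x ∂G.stepLaw t (G.curState τ) a, p (extend τ x) := by
  rw [law_succ, ae_map_iff (measurable_extend τ).aemeasurable hp, ae_kernel_iff]

theorem ae_law_step_iff {t c : ℕ} (hc : t < c) (τ : G.Hist t) {p : G.Hist c → Prop}
    (hp : MeasurableSet {τ | p τ}) :
    (∀ᵐ τ' ∂π.law t c τ, p τ') ↔ ∀ a, π.act t τ a ≠ 0 →
      ∀ᵐ x ∂G.stepLaw t (G.curState τ) a, ∀ᵐ τ' ∂π.law (t + 1) c (extend τ x), p τ' := by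
  rw [ae_law_iff π t.le_succ hc τ hp, ae_law_succ_iff π τ (measurableSet_ae_law π hp)]

theorem exists_act_ne_zero {t : ℕ} (τ : G.Hist t) : ∃ a, π.act t τ a ≠ 0 :=
  (π.act t τ).support_nonempty

/-- The future of a history extends it. -/
theorem ae_law_prefix {a b : ℕ} (hab : a ≤ b) (τ : G.Hist a) :
    ∀ᵐ τ' ∂π.law a b τ, ∀ j (hj : j ≤ a),
      τ' ⟨j, Finset.mem_Iic.2 (hj.trans hab)⟩ = τ ⟨j, Finset.mem_Iic.2 hj⟩ := by
  have h1 := Kernel.partialTraj_map_frestrictLe₂_apply (X := fun _ => G.Step) (κ := π.kernel)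
    (a := a) τ hab
  rw [Kernel.partialTraj_self, Kernel.id_apply] at h1
  have h2 : ∀ᵐ y ∂((Kernel.partialTraj (X := fun _ => G.Step) π.kernel a b τ).map
      (Preorder.frestrictLe₂ (π := fun _ => G.Step) hab)), y = τ := by
    rw [h1]
    exact (ae_dirac_iff (measurableSet_singleton τ)).2 rfl
  filter_upwards [ae_of_ae_map (Preorder.measurable_frestrictLe₂ hab).aemeasurable h2] with τ' h
  intro j hj
  rw [← h]
  rfl

theorem measurableSet_withinBudget (ε : ℝ) {t : ℕ} : MeasurableSet
    {τ : G.Hist t | ∀ m : ℕ, 1 ≤ m → m ≤ G.H → ∀ i, G.cumCost τ m i ≤ G.B i + ε} := by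
  have hm : ∀ m i, Measurable fun τ : G.Hist t => G.cumCost τ m i := by
    intro m i
    unfold cumCost
    simp only [Finset.sum_apply]
    refine Finset.measurable_sum _ fun j _ => ?_
    split_ifs
    · fun_prop
    · exact measurable_const
  simp only [Set.ofPred_forall]
  exact MeasurableSet.iInter fun m => MeasurableSet.iInter fun _ => MeasurableSet.iInter fun _ =>
    MeasurableSet.iInter fun i => measurableSet_le (hm m i) measurable_const

theorem feasibleFrom_step_iff {t : ℕ} (ht : t < G.H) (ε : ℝ) (τ : G.Hist t) :
    π.FeasibleFrom ε τ ↔ ∀ a, π.act t τ a ≠ 0 →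
      ∀ᵐ x ∂G.stepLaw t (G.curState τ) a, π.FeasibleFrom ε (extend τ x) :=
  ae_law_step_iff π ht τ (measurableSet_withinBudget ε)

theorem feasibleFrom_horizon_iff (ε : ℝ) (τ : G.Hist G.H) :
    π.FeasibleFrom ε τ ↔ ∀ m : ℕ, 1 ≤ m → m ≤ G.H → ∀ i, G.cumCost τ m i ≤ G.B i + ε := by
  rw [FeasibleFrom, law_self]
  exact ae_dirac_iff (measurableSet_withinBudget ε)

theorem measurableSet_feasibleFrom (ε : ℝ) {t : ℕ} :
    MeasurableSet {τ : G.Hist t | π.FeasibleFrom ε τ} :=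
  measurableSet_ae_law π (measurableSet_withinBudget ε)

/-- Feasibility from `τ` also constrains the costs already paid: some continuation stays within the
bound, and continuing does not change the earlier partial sums. -/
theorem FeasibleFrom.cumCost_le {π : G.Policy} {ε : ℝ} {t : ℕ} {τ : G.Hist t} (ht : t ≤ G.H)
    (h : π.FeasibleFrom ε τ) {m : ℕ} (hm : 1 ≤ m) (hmt : m ≤ t) (i : Fin n) :
    G.cumCost τ m i ≤ G.B i + ε := by
  obtain ⟨k, hk⟩ := Nat.exists_eq_add_of_le ht
  induction k generalizing t with
  | zero =>
    obtain rfl : t = G.H := hk.symm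
    exact (feasibleFrom_horizon_iff π ε τ).1 h m hm hmt i
  | succ k ih =>
    obtain ⟨a, ha⟩ := exists_act_ne_zero π τ
    obtain ⟨x, hx⟩ := ((feasibleFrom_step_iff π (by lia) ε τ).1 h a ha).exists
    rw [← cumCost_extend_of_le τ x hmt]
    exact ih (by lia) hx (by lia) (by lia)

/-! ## Values -/

theorem measurable_rewardFrom (i : Fin n) (h : ℕ) {t : ℕ} :
    Measurable fun τ : G.Hist t => G.rewardFrom i h τ := by
  unfold rewardFrom
  refine Finset.measurable_sum _ fun k _ => ?_
  split_ifs
  · exact (measurable_of_countable fun q : G.State × G.Act => G.r k q.1 q.2 i).comp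
      (f := fun τ : G.Hist t => ((τ ⟨k, Finset.mem_Iic.2 k.2.le⟩).2.2,
        (τ ⟨k + 1, Finset.mem_Iic.2 k.2⟩).1)) (by fun_prop)
  · exact measurable_const

/-- Only finitely many mean rewards occur before time `t`. This makes all values bounded and all
integrals below legitimate, whatever the policy. -/
theorem exists_rewardFrom_bound (i : Fin n) (t : ℕ) :
    ∃ C : ℝ, ∀ h, ∀ τ : G.Hist t, ‖G.rewardFrom i h τ‖ ≤ C := by
  refine ⟨∑ k : Fin t, ∑ s, ∑ a, ‖G.r k s a i‖, fun h τ => ?_⟩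
  refine (norm_sum_le _ _).trans (Finset.sum_le_sum fun k _ => ?_)
  have h0 : ∀ s, 0 ≤ ∑ a, ‖G.r k s a i‖ := fun s => Finset.sum_nonneg fun a _ => norm_nonneg _
  split_ifs
  · exact (Finset.single_le_sum (f := fun a => ‖G.r k _ a i‖) (fun a _ => norm_nonneg _)
      (Finset.mem_univ _)).trans
      (Finset.single_le_sum (f := fun s => ∑ a, ‖G.r k s a i‖) (fun s _ => h0 s)
        (Finset.mem_univ _))
  · simpa using Finset.sum_nonneg fun s _ => h0 s

theorem integrable_rewardFrom (i : Fin n) (h : ℕ) {t : ℕ} (μ : Measure (G.Hist t))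
    [IsFiniteMeasure μ] : Integrable (fun τ => G.rewardFrom i h τ) μ := by
  obtain ⟨C, hC⟩ := exists_rewardFrom_bound (G := G) i t
  exact Integrable.of_bound (measurable_rewardFrom i h).aestronglyMeasurable C
    (Filter.Eventually.of_forall fun τ => hC h τ)

theorem measurable_value (i : Fin n) {t : ℕ} : Measurable fun τ : G.Hist t => π.value i τ :=
  ((measurable_rewardFrom (G := G) i t).stronglyMeasurable.integral_kernel
    (κ := Kernel.partialTraj (X := fun _ => G.Step) π.kernel t G.H)).measurable

theorem exists_value_bound (i : Fin n) (t : ℕ) :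
    ∃ C : ℝ, ∀ τ : G.Hist t, ‖π.value i τ‖ ≤ C := by
  obtain ⟨C, hC⟩ := exists_rewardFrom_bound (G := G) i G.H
  refine ⟨C, fun τ => ?_⟩
  exact (norm_integral_le_of_norm_le_const (μ := π.law t G.H τ)
    (Filter.Eventually.of_forall fun τ' => hC t τ')).trans_eq (by simp)

theorem integrable_value_extend (i : Fin n) {t : ℕ} (τ : G.Hist t) (μ : Measure G.Step)
    [IsFiniteMeasure μ] : Integrable (fun x => π.value i (extend τ x)) μ := by
  obtain ⟨C, hC⟩ := exists_value_bound π i (t + 1)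
  exact Integrable.of_bound
    ((measurable_value π i).comp (measurable_extend τ)).aestronglyMeasurable C
    (Filter.Eventually.of_forall fun τ => hC _)

theorem value_horizon (i : Fin n) (τ : G.Hist G.H) : π.value i τ = 0 := by
  have : ∀ τ' : G.Hist G.H, G.rewardFrom i G.H τ' = 0 := fun τ' =>
    Finset.sum_eq_zero fun k _ => if_neg (not_le.2 k.2)
  simp [value, this]

theorem rewardFrom_eq_add (i : Fin n) {h t : ℕ} (ht : h < t) (τ : G.Hist t) :
    G.rewardFrom i h τ = G.r h (τ ⟨h, Finset.mem_Iic.2 ht.le⟩).2.2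
      (τ ⟨h + 1, Finset.mem_Iic.2 ht⟩).1 i + G.rewardFrom i (h + 1) τ := by
  unfold rewardFrom
  have h1 : ∀ k : Fin t, (if h ≤ (k : ℕ) then
      G.r k (τ ⟨k, Finset.mem_Iic.2 k.2.le⟩).2.2 (τ ⟨k + 1, Finset.mem_Iic.2 k.2⟩).1 i else 0) =
    (if k = ⟨h, ht⟩ then
      G.r k (τ ⟨k, Finset.mem_Iic.2 k.2.le⟩).2.2 (τ ⟨k + 1, Finset.mem_Iic.2 k.2⟩).1 i else 0) +
    (if h + 1 ≤ (k : ℕ) then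
      G.r k (τ ⟨k, Finset.mem_Iic.2 k.2.le⟩).2.2 (τ ⟨k + 1, Finset.mem_Iic.2 k.2⟩).1 i
        else 0) := by
    intro k
    rcases lt_trichotomy (k : ℕ) h with hk | hk | hk
    · rw [if_neg (by lia), if_neg (by rintro rfl; simp at hk), if_neg (by lia), add_zero]
    · rw [if_pos (by lia), if_pos (Fin.ext hk), if_neg (by lia), add_zero]
    · rw [if_pos (by lia), if_neg (by rintro rfl; simp at hk), if_pos (by lia), zero_add]
  rw [Finset.sum_congr rfl fun k _ => h1 k, Finset.sum_add_distrib, Finset.sum_ite_eq']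
  simp

theorem ae_stepLaw_act (G : Game n) (h : ℕ) (s : G.State) (a : G.Act) :
    ∀ᵐ x ∂G.stepLaw h s a, x.1 = a := by
  have : ∀ᵐ y ∂(G.stepLaw h s a).map Prod.fst, y = a := by
    have := fun i => G.C_prob i h s a
    have h1 : (G.stepLaw h s a).map Prod.fst = Measure.dirac a := by
      unfold stepLaw
      rw [Measure.map_fst_prod, measure_univ, one_smul]
    rw [h1]
    exact (ae_dirac_iff (measurableSet_singleton a)).2 rfl
  exact ae_of_ae_map measurable_fst.aemeasurable this

theorem integral_law_extend (i : Fin n) {t : ℕ} (ht : t < G.H) (τ : G.Hist t) (x : G.Step) :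
    ∫ τ', G.rewardFrom i t τ' ∂π.law (t + 1) G.H (extend τ x) =
      G.r t (G.curState τ) x.1 i + π.value i (extend τ x) := by
  have h1 : (fun τ' => G.rewardFrom i t τ') =ᵐ[π.law (t + 1) G.H (extend τ x)]
      fun τ' => G.r t (G.curState τ) x.1 i + G.rewardFrom i (t + 1) τ' := by
    filter_upwards [ae_law_prefix π ht (extend τ x)] with τ' hτ'
    rw [rewardFrom_eq_add i ht, hτ' t t.le_succ, hτ' (t + 1) le_rfl, extend_last,
      extend_of_le τ x le_rfl]
    rfl
  rw [integral_congr_ae h1, integral_add (integrable_const _) (integrable_rewardFrom i _ _)]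
  simp [value]

/-- The Bellman equation. Given the first step, its reward is determined by the current state and
the action, and the later rewards have mean `value` at the extended history; averaging over the
mixture of actions gives the formula. -/
theorem value_step (i : Fin n) {t : ℕ} (ht : t < G.H) (τ : G.Hist t) :
    π.value i τ = ∑ a, (π.act t τ a).toReal * (G.r t (G.curState τ) a i +
      ∫ x, π.value i (extend τ x) ∂G.stepLaw t (G.curState τ) a) := by
  have h1 : π.value i τ = ∫ x, (G.r t (G.curState τ) x.1 i + π.value i (extend τ x))
      ∂π.kernel t τ := by
    have hint := integrable_rewardFrom (G := G) i t (π.law t G.H τ)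
    have hL : π.law t G.H τ = ((Kernel.partialTraj (X := fun _ => G.Step) π.kernel (t + 1) G.H) ∘ₖ
        (Kernel.partialTraj (X := fun _ => G.Step) π.kernel t (t + 1))) τ := by
      rw [Kernel.partialTraj_comp_partialTraj t.le_succ ht]
      rfl
    have hs : Kernel.partialTraj (X := fun _ => G.Step) π.kernel t (t + 1) τ =
      (π.kernel t τ).map (extend τ) := law_succ π τ
    rw [hL] at hint
    rw [value, hL, Kernel.integral_comp hint, hs, integral_map (measurable_extend τ).aemeasurable]
    · refine integral_congr_ae (Filter.Eventually.of_forall fun x => ?_)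
      exact integral_law_extend π i ht τ x
    · exact ((measurable_rewardFrom (G := G) i t).stronglyMeasurable.integral_kernel
        (κ := Kernel.partialTraj (X := fun _ => G.Step) π.kernel (t + 1) G.H)).aestronglyMeasurable
  have hr : ∀ μ : Measure G.Step, IsFiniteMeasure μ →
      Integrable (fun x : G.Step => G.r t (G.curState τ) x.1 i) μ := by
    intro μ _
    refine Integrable.of_bound ((measurable_of_countable fun a : G.Act =>
      G.r t (G.curState τ) a i).comp measurable_fst).aestronglyMeasurable
      (∑ a, ‖G.r t (G.curState τ) a i‖) (Filter.Eventually.of_forall fun x => ?_)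
    exact Finset.single_le_sum (f := fun a => ‖G.r t (G.curState τ) a i‖)
      (fun a _ => norm_nonneg _) (Finset.mem_univ _)
  have hsm : ∀ a, IsFiniteMeasure (π.act t τ a • G.stepLaw t (G.curState τ) a) := fun a =>
    Measure.smul_finite _ ((π.act t τ).apply_ne_top a)
  have hrv : ∀ a, Integrable (fun x : G.Step => G.r t (G.curState τ) x.1 i +
      π.value i (extend τ x)) (π.act t τ a • G.stepLaw t (G.curState τ) a) := fun a =>
    have := hsm a
    (hr _ (hsm a)).add (integrable_value_extend π i τ _)
  rw [h1, kernel_apply, integral_finsetSum_measure fun a _ => hrv a]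
  refine Finset.sum_congr rfl fun a _ => ?_
  rw [integral_smul_measure, integral_add (hr _ inferInstance) (integrable_value_extend π i τ _),
    smul_eq_mul]
  congr 2
  have h2 : (fun x : G.Step => G.r t (G.curState τ) x.1 i) =ᵐ[G.stepLaw t (G.curState τ) a]
      fun _ => G.r t (G.curState τ) a i := by
    filter_upwards [ae_stepLaw_act G t (G.curState τ) a] with x hx
    rw [hx]
  rw [integral_congr_ae h2]
  simp

end Policy

end Game

/-! ## The rounded game -/

namespace Game

variable {n : ℕ} {G : Game n} {ℓ : ℝ}

/-- A law is carried by its topological support, which is bounded above by `C_bdd`, and only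
finitely many laws enter `cmax`. Both suprema are therefore genuine and not default values. -/
theorem ae_cost_le (i : Fin n) {h : ℕ} (hh : h < G.H) (s : G.State) (a : G.Act) :
    ∀ᵐ c ∂G.C i h s a, c ≤ G.cmax i := by
  obtain ⟨M, hM⟩ := G.C_bdd i h s a
  have hb : BddAbove (G.C i h s a).support := by
    refine ⟨M, fun x hx => ?_⟩
    refine Measure.support_subset_of_isClosed isClosed_Iic ?_ hx
    rw [mem_ae_iff, Set.compl_Iic]
    exact hM
  filter_upwards [Measure.support_mem_ae (μ := G.C i h s a)] with c hc
  exact (le_csSup hb hc).trans (le_ciSup (f := fun k : Fin G.H × G.State × G.Act =>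
    sSup (G.C i k.1 k.2.1 k.2.2).support) (Set.finite_range _).bddAbove (⟨h, hh⟩, s, a))

theorem measurable_roundCost (ℓ : ℝ) (i : Fin n) : Measurable (G.roundCost ℓ i) := by
  unfold roundCost
  refine Measurable.mul_const ?_ _
  refine (measurable_of_countable fun z : ℤ => (z : ℝ)).comp ?_
  refine Int.measurable_floor.comp ?_
  fun_prop

theorem roundCost_le (hℓ : 0 < ℓ) (i : Fin n) (x : ℝ) :
    G.roundCost ℓ i x ≤ max x (G.B i - G.H * G.cmax i) := by
  unfold roundCost
  rw [← le_div_iff₀ hℓ]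
  exact Int.floor_le _

/-- Truncation only raises a cost and rounding lowers it by less than `ℓ`. This is the source of the
additive error. -/
theorem sub_le_roundCost (hℓ : 0 < ℓ) (i : Fin n) (x : ℝ) : x - ℓ ≤ G.roundCost ℓ i x := by
  have h1 := Int.lt_floor_add_one (max x (G.B i - G.H * G.cmax i) / ℓ)
  rw [div_lt_iff₀ hℓ] at h1
  have h2 := le_max_left x (G.B i - G.H * G.cmax i)
  unfold roundCost
  linarith

theorem roundCost_eq_iff (hℓ : 0 < ℓ) (i : Fin n) (x : ℝ) (z : ℤ) :
    G.roundCost ℓ i x = z * ℓ ↔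
      z * ℓ ≤ max x (G.B i - G.H * G.cmax i) ∧
        max x (G.B i - G.H * G.cmax i) < z * ℓ + ℓ := by
  unfold roundCost
  rw [mul_left_inj' hℓ.ne', Int.cast_inj, Int.floor_eq_iff, le_div_iff₀ hℓ, div_lt_iff₀ hℓ,
    add_one_mul]

/-- The least multiple of `ℓ` that is used for rounding, divided by `ℓ`. -/
def roundLo (G : Game n) (ℓ : ℝ) (i : Fin n) : ℤ := ⌊(G.B i - G.H * G.cmax i) / ℓ⌋

/-- The greatest multiple of `ℓ` that is used for rounding, divided by `ℓ`. -/
def roundHi (G : Game n) (ℓ : ℝ) (i : Fin n) : ℤ := ⌊G.cmax i / ℓ⌋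

theorem roundLo_mul_le (hℓ : 0 < ℓ) (i : Fin n) :
    G.roundLo ℓ i * ℓ ≤ G.B i - G.H * G.cmax i := by
  rw [← le_div_iff₀ hℓ]
  exact Int.floor_le _

theorem lt_roundLo_mul (hℓ : 0 < ℓ) (i : Fin n) :
    G.B i - G.H * G.cmax i < G.roundLo ℓ i * ℓ + ℓ := by
  have := Int.lt_floor_add_one ((G.B i - G.H * G.cmax i) / ℓ)
  rw [div_lt_iff₀ hℓ, add_one_mul] at this
  exact this

/-- The truncation level lies in the lowest cell, so this cell collects all costs below its upper
end. Hence its probability is a single value of the distribution function. -/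
theorem roundCost_eq_roundLo_iff (hℓ : 0 < ℓ) (i : Fin n) (x : ℝ) :
    G.roundCost ℓ i x = G.roundLo ℓ i * ℓ ↔ x < G.roundLo ℓ i * ℓ + ℓ := by
  rw [roundCost_eq_iff hℓ, max_lt_iff]
  have h1 := roundLo_mul_le (G := G) hℓ i
  have h2 := lt_roundLo_mul (G := G) hℓ i
  exact ⟨fun h => h.2.1, fun h => ⟨le_max_of_le_right h1, h, h2⟩⟩

/-- Every other cell lies entirely above the truncation level, where only the rounding acts; its
probability is a difference of two values of the distribution function. -/
theorem roundCost_eq_iff_of_lt (hℓ : 0 < ℓ) (i : Fin n) (x : ℝ) {z : ℤ}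
    (hz : G.roundLo ℓ i < z) :
    G.roundCost ℓ i x = z * ℓ ↔ x ∈ Set.Iio (z * ℓ + ℓ) \ Set.Iio (z * ℓ) := by
  have h2 := lt_roundLo_mul (G := G) hℓ i
  have h3 : (G.roundLo ℓ i : ℝ) * ℓ + ℓ ≤ z * ℓ := by
    have : ((G.roundLo ℓ i : ℝ) + 1) ≤ z := by exact_mod_cast hz
    nlinarith
  rw [roundCost_eq_iff hℓ, max_lt_iff, Set.mem_sdiff, Set.mem_Iio, Set.mem_Iio, not_lt, le_max_iff]
  constructor
  · rintro ⟨h4 | h4, h5, -⟩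
    · exact ⟨h5, h4⟩
    · linarith
  · rintro ⟨h4, h5⟩
    exact ⟨Or.inl h5, h4, by linarith⟩

/-- Normalization makes the truncation level negative and `cmax` positive, so truncation cannot push
a cost above the highest cell. -/
theorem roundCost_mem_image (hN : G.Normalized) (hℓ : 0 < ℓ) (i : Fin n) {x : ℝ}
    (hx : x ≤ G.cmax i) :
    ∃ z ∈ Finset.Icc (G.roundLo ℓ i) (G.roundHi ℓ i), (z : ℝ) * ℓ = G.roundCost ℓ i x := by
  refine ⟨⌊max x (G.B i - G.H * G.cmax i) / ℓ⌋, Finset.mem_Icc.2 ⟨?_, ?_⟩, rfl⟩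
  · refine Int.floor_le_floor ?_
    gcongr
    exact le_max_right _ _
  · refine Int.floor_le_floor ?_
    gcongr
    refine max_le hx ?_
    have := hN i
    linarith

variable (cdf : ℕ)

theorem roundedCosts_spec (hℓ : 0 < ℓ) (i : Fin n) (h : ℕ)
    (s : G.State) (a : G.Act) :
    (∀ x, x ∈ (G.roundedCosts ℓ cdf (h, s, a) i).val.dom ↔
      (∃ z ∈ Finset.Icc (G.roundLo ℓ i) (G.roundHi ℓ i), (z : ℝ) * ℓ = x) ∧
        0 < (G.C i h s a).real (G.roundCost ℓ i ⁻¹' {x})) ∧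
    ∀ x ∈ (G.roundedCosts ℓ cdf (h, s, a) i).val.dom,
      (G.roundedCosts ℓ cdf (h, s, a) i).val.get x =
        (G.C i h s a).real (G.roundCost ℓ i ⁻¹' {x}) := by
  classical
  have hprob := G.C_prob i h s a
  set D : Finset ℝ := (Finset.Icc (G.roundLo ℓ i) (G.roundHi ℓ i)).image fun z : ℤ => (z : ℝ) * ℓ
    with hD
  have hmem : ∀ x, x ∈ D ↔ ∃ z ∈ Finset.Icc (G.roundLo ℓ i) (G.roundHi ℓ i), (z : ℝ) * ℓ = x :=
    fun x => Finset.mem_image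
  let T : Table ℝ ℝ := (tabulate D fun x => op ((G.C i h s a).real (Set.Iio (x + ℓ)) -
    if x = (G.roundLo ℓ i : ℝ) * ℓ then 0 else (G.C i h s a).real (Set.Iio x))).val
  have hT : ∀ x ∈ D, T.get x = (G.C i h s a).real (G.roundCost ℓ i ⁻¹' {x}) := by
    intro x hx
    rw [show T.get x = _ from tabulate_get hx, op_val]
    obtain ⟨z, hz, rfl⟩ := (hmem x).1 hx
    rcases (Finset.mem_Icc.1 hz).1.eq_or_lt with hlo | hlo
    · rw [← hlo, if_pos rfl, sub_zero]
      congr 1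
      ext c
      exact (roundCost_eq_roundLo_iff hℓ i c).symm
    · rw [if_neg (by
        rw [mul_left_inj' hℓ.ne', Int.cast_inj]
        exact hlo.ne')]
      have : G.roundCost ℓ i ⁻¹' {(z : ℝ) * ℓ} = Set.Iio (z * ℓ + ℓ) \ Set.Iio (z * ℓ) := by
        ext c
        exact roundCost_eq_iff_of_lt hℓ i c hlo
      rw [this, measureReal_sdiff (Set.Iio_subset_Iio (by linarith)) measurableSet_Iio]
  have hval : (G.roundedCosts ℓ cdf (h, s, a) i).val =
      (tabulate (D.filter fun x => 0 < T.get x) fun x => lookup 1 T x).val := by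
    let f : ℝ → Timed ℝ := fun x =>
      (⟨(G.C i h s a).real (Set.Iio (x + ℓ)), cdf + 1⟩ : Timed ℝ) >>= fun p =>
        if x = (G.roundLo ℓ i : ℝ) * ℓ then op 0 >>= fun q => ⟨p - q, 4⟩
        else (⟨(G.C i h s a).real (Set.Iio x), cdf + 1⟩ : Timed ℝ) >>= fun q => ⟨p - q, 4⟩
    have h1 : (tabulate D f).val = T := by
      refine tabulate_congr fun x _ => ?_
      simp only [f, Timed.val_bind, op_val]
      split_ifs <;> rfl
    have h2 : (G.roundedCosts ℓ cdf (h, s, a) i).val =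
        (tabulate (tfilter D fun x => lookup 1 (tabulate D f).val x >>= fun p =>
          op (decide (0 < p))).val fun x => lookup 1 (tabulate D f).val x).val := rfl
    rw [h2, h1]
    congr 2
    ext x
    rw [mem_tfilter, Finset.mem_filter]
    exact and_congr_right fun _ => decide_eq_true_iff
  rw [hval]
  refine ⟨fun x => ?_, fun x hx => ?_⟩
  · rw [tabulate_dom, Finset.mem_filter, ← hmem]
    exact and_congr_right fun hx => by rw [hT x hx]
  · rw [tabulate_dom] at hx
    rw [tabulate_get hx, lookup_val]
    exact hT x (Finset.mem_filter.1 hx).1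

/-- A cell of positive probability contains a cost of at most `cmax`, hence belongs to the finite
range that is searched. -/
theorem mem_roundedCosts_iff (hN : G.Normalized) (hℓ : 0 < ℓ) (i : Fin n) {h : ℕ} (hh : h < G.H)
    (s : G.State) (a : G.Act) (x : ℝ) :
    x ∈ (G.roundedCosts ℓ cdf (h, s, a) i).val.dom ↔
      0 < (G.C i h s a).real (G.roundCost ℓ i ⁻¹' {x}) := by
  rw [(roundedCosts_spec cdf hℓ i h s a).1, and_iff_right_iff_imp]
  intro hpos
  have hprob := G.C_prob i h s a
  rw [measureReal_def, ENNReal.toReal_pos_iff] at hpos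
  by_contra hcon
  refine hpos.1.ne' (measure_mono_null ?_ (ae_iff.1 (ae_cost_le i hh s a)))
  rintro c rfl
  exact fun hc => hcon (roundCost_mem_image hN hℓ i hc)

/-- There are countably many multiples of `ℓ`, and those missing from the table have probability
zero. -/
theorem ae_roundCost_mem (hN : G.Normalized) (hℓ : 0 < ℓ) (i : Fin n) {h : ℕ} (hh : h < G.H)
    (s : G.State) (a : G.Act) :
    ∀ᵐ c ∂G.C i h s a, G.roundCost ℓ i c ∈ (G.roundedCosts ℓ cdf (h, s, a) i).val.dom := by
  classical
  have hprob := G.C_prob i h s a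
  have h1 : ∀ z : ℤ, ∀ᵐ c ∂G.C i h s a, (z : ℝ) * ℓ = G.roundCost ℓ i c →
      G.roundCost ℓ i c ∈ (G.roundedCosts ℓ cdf (h, s, a) i).val.dom := by
    intro z
    by_cases hz : (z : ℝ) * ℓ ∈ (G.roundedCosts ℓ cdf (h, s, a) i).val.dom
    · exact Filter.Eventually.of_forall fun c hc => hc ▸ hz
    · rw [mem_roundedCosts_iff cdf hN hℓ i hh, measureReal_def, ENNReal.toReal_pos_iff, not_and] at hz
      have h0 : G.C i h s a (G.roundCost ℓ i ⁻¹' {(z : ℝ) * ℓ}) = 0 := by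
        by_contra hne
        exact hz (pos_iff_ne_zero.2 hne) (measure_lt_top _ _)
      have : ∀ᵐ c ∂G.C i h s a, c ∉ G.roundCost ℓ i ⁻¹' {(z : ℝ) * ℓ} := measure_eq_zero_iff_ae_notMem.1 h0
      filter_upwards [this] with c hc heq
      exact absurd heq.symm hc
  filter_upwards [ae_all_iff.2 h1] with c hc
  exact hc _ rfl

/-! ### Nodes of histories and the transition law of the rounded game -/

variable (G ℓ)

/-- The node of a history in the rounded game. -/
def node {t : ℕ} (τ : G.Hist t) : Node n G.nS := (G.curState τ, G.cumRounded ℓ τ)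

variable {G ℓ}

theorem node_extend {t : ℕ} (τ : G.Hist t) (x : G.Step) :
    G.node ℓ (extend τ x) = (x.2.2, (G.node ℓ τ).2 + G.roundVec ℓ x.2.1) := by
  rw [node, curState_extend, cumRounded_extend]
  rfl

theorem measurable_node (t : ℕ) : Measurable (G.node ℓ (t := t)) :=
  (G.measurable_curState t).prodMk (G.measurable_cumRounded ℓ t)

theorem approxGame_C_get {h : ℕ} (hh : h < G.H) (s : G.State) (a : G.Act) :
    (G.approxGame ℓ cdf).val.C.get (h, s, a) =
      (tabulate (Fintype.piFinset fun i => (G.roundedCosts ℓ cdf (h, s, a) i).val.dom) fun c =>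
        tprodOver fun i => lookup 1 (G.roundedCosts ℓ cdf (h, s, a) i).val (c i)).val :=
  tabulate_get (D := Finset.range G.H ×ˢ (Finset.univ ×ˢ Finset.univ)) (by simpa using hh)

variable {cdf}

theorem roundVec_preimage (c : Fin n → ℝ) :
    G.roundVec ℓ ⁻¹' {c} = Set.univ.pi fun i => G.roundCost ℓ i ⁻¹' {c i} := by
  ext y
  simp [roundVec, funext_iff]

theorem mem_approxGame_dom_iff {h : ℕ} (hh : h < G.H) {s : G.State} {a : G.Act}
    {c : Fin n → ℝ} : c ∈ ((G.approxGame ℓ cdf).val.C.get (h, s, a)).dom ↔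
      ∀ i, c i ∈ (G.roundedCosts ℓ cdf (h, s, a) i).val.dom := by
  rw [approxGame_C_get cdf hh, tabulate_dom, Fintype.mem_piFinset]

theorem approxGame_prob (hN : G.Normalized) (hℓ : 0 < ℓ) {h : ℕ} (hh : h < G.H) {s : G.State}
    {a : G.Act} {c : Fin n → ℝ} (hc : c ∈ ((G.approxGame ℓ cdf).val.C.get (h, s, a)).dom) :
    ((G.approxGame ℓ cdf).val.C.get (h, s, a)).get c =
      (Measure.pi fun i => G.C i h s a).real (G.roundVec ℓ ⁻¹' {c}) ∧
    0 < ((G.approxGame ℓ cdf).val.C.get (h, s, a)).get c := by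
  have hprob := fun i => G.C_prob i h s a
  have hc' := (mem_approxGame_dom_iff hh).1 hc
  rw [approxGame_C_get cdf hh] at hc ⊢
  have hget : ∀ i, (G.roundedCosts ℓ cdf (h, s, a) i).val.get (c i) =
      (G.C i h s a).real (G.roundCost ℓ i ⁻¹' {c i}) := fun i =>
    (roundedCosts_spec cdf hℓ i h s a).2 _ (hc' i)
  have h1 : (tprodOver fun i => lookup 1 (G.roundedCosts ℓ cdf (h, s, a) i).val (c i)).val =
      ∏ i, (G.C i h s a).real (G.roundCost ℓ i ⁻¹' {c i}) :=
    Fintype.prod_congr _ _ hget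
  rw [tabulate_dom] at hc
  rw [tabulate_get hc, h1]
  refine ⟨?_, Finset.prod_pos fun i _ => (mem_roundedCosts_iff cdf hN hℓ i hh s a _).1 (hc' i)⟩
  rw [roundVec_preimage, measureReal_def, Measure.pi_pi, ENNReal.toReal_prod]
  rfl

theorem ae_stepLaw_cost {h : ℕ} {s : G.State} {a : G.Act} {p : (Fin n → ℝ) → Prop}
    (hp : ∀ᵐ c ∂Measure.pi fun i => G.C i h s a, p c) :
    ∀ᵐ x ∂G.stepLaw h s a, p x.2.1 := by
  have hprob := fun i => G.C_prob i h s a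
  have h1 : ∀ᵐ y ∂((Measure.pi fun i => G.C i h s a).prod (G.P h s a).toMeasure), p y.1 :=
    Measure.quasiMeasurePreserving_fst.ae hp
  exact Measure.quasiMeasurePreserving_snd.ae h1

theorem ae_stepLaw_state {h : ℕ} {s : G.State} {a : G.Act} :
    ∀ᵐ x ∂G.stepLaw h s a, G.P h s a x.2.2 ≠ 0 := by
  have hprob := fun i => G.C_prob i h s a
  have h0 : ∀ᵐ s' ∂(G.P h s a).toMeasure, G.P h s a s' ≠ 0 := by
    rw [ae_iff_of_countable]
    intro s' hs'
    rwa [PMF.toMeasure_apply_singleton _ _ (measurableSet_singleton s')] at hs'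
  have h1 : ∀ᵐ y ∂((Measure.pi fun i => G.C i h s a).prod (G.P h s a).toMeasure),
      G.P h s a y.2 ≠ 0 := Measure.quasiMeasurePreserving_snd.ae h0
  exact Measure.quasiMeasurePreserving_snd.ae h1

theorem ae_stepLaw_cost_le {h : ℕ} (hh : h < G.H) (s : G.State) (a : G.Act) :
    ∀ᵐ x ∂G.stepLaw h s a, ∀ i, x.2.1 i ≤ G.cmax i := by
  have hprob := fun i => G.C_prob i h s a
  refine ae_stepLaw_cost (p := fun c => ∀ i, c i ≤ G.cmax i) (ae_all_iff.2 fun i => ?_)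
  exact (Measure.quasiMeasurePreserving_eval (fun i => G.C i h s a) i).ae (ae_cost_le i hh s a)

theorem stepLaw_fiber (h : ℕ) (s : G.State) (a : G.Act) (c : Fin n → ℝ) (s' : G.State) :
    (G.stepLaw h s a).real {x | x.2.2 = s' ∧ G.roundVec ℓ x.2.1 = c} =
      (Measure.pi fun i => G.C i h s a).real (G.roundVec ℓ ⁻¹' {c}) * (G.P h s a s').toReal := by
  have hprob := fun i => G.C_prob i h s a
  have h1 : {x : G.Step | x.2.2 = s' ∧ G.roundVec ℓ x.2.1 = c} =
      Set.univ ×ˢ ((G.roundVec ℓ ⁻¹' {c}) ×ˢ {s'}) := by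
    ext x
    simp [and_comm]
  rw [h1, stepLaw, measureReal_def, Measure.prod_prod, Measure.prod_prod, measure_univ, one_mul,
    ENNReal.toReal_mul, PMF.toMeasure_apply_singleton _ _ (measurableSet_singleton s')]
  rfl

/-- Together with `exists_node_extend_eq` this shows that the successor relation of the program is
exactly positive-probability reachability. -/
theorem ae_node_extend_mem (hN : G.Normalized) (hℓ : 0 < ℓ) {t : ℕ} (ht : t < G.H)
    (τ : G.Hist t) (a : G.Act) : ∀ᵐ x ∂G.stepLaw t (G.curState τ) a,
      G.node ℓ (extend τ x) ∈ (successors (G.approxGame ℓ cdf).val t (G.node ℓ τ) a).val := by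
  have hprob := fun i => G.C_prob i t (G.curState τ) a
  have h1 : ∀ᵐ x ∂G.stepLaw t (G.curState τ) a, ∀ i, G.roundCost ℓ i (x.2.1 i) ∈
      (G.roundedCosts ℓ cdf (t, G.curState τ, a) i).val.dom := by
    refine ae_stepLaw_cost (p := fun c => ∀ i, G.roundCost ℓ i (c i) ∈
      (G.roundedCosts ℓ cdf (t, G.curState τ, a) i).val.dom) (ae_all_iff.2 fun i => ?_)
    exact (Measure.quasiMeasurePreserving_eval (fun i => G.C i t (G.curState τ) a) i).ae
      (ae_roundCost_mem cdf hN hℓ i ht _ a)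
  filter_upwards [h1, ae_stepLaw_state] with x hx hs
  rw [mem_successors]
  exact ⟨x.2.2, G.roundVec ℓ x.2.1, ENNReal.toReal_pos hs (PMF.apply_ne_top _ _),
    (mem_approxGame_dom_iff ht).2 hx, node_extend τ x⟩

/-- Every successor of a node is reached with positive probability. -/
theorem exists_node_extend_eq (hN : G.Normalized) (hℓ : 0 < ℓ) {t : ℕ} (ht : t < G.H)
    (τ : G.Hist t) (a : G.Act) {w : Node n G.nS}
    (hw : w ∈ (successors (G.approxGame ℓ cdf).val t (G.node ℓ τ) a).val) {p : G.Step → Prop}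
    (hp : ∀ᵐ x ∂G.stepLaw t (G.curState τ) a, p x) : ∃ x, p x ∧ G.node ℓ (extend τ x) = w := by
  obtain ⟨s', c, hs', hc, rfl⟩ := (mem_successors _).1 hw
  obtain ⟨h1, h2⟩ := approxGame_prob hN hℓ ht hc
  have hpos : 0 < (G.stepLaw t (G.curState τ) a).real
      {x | x.2.2 = s' ∧ G.roundVec ℓ x.2.1 = c} := by
    rw [stepLaw_fiber]
    exact mul_pos (h1 ▸ h2) hs'
  -- The steps leading to `w` have positive probability, so they cannot all lie in the null set
  -- where `p` fails.
  by_contra hcon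
  push Not at hcon
  rw [measureReal_def, ENNReal.toReal_pos_iff] at hpos
  refine hpos.1.ne' (measure_mono_null ?_ (ae_iff.1 hp))
  rintro x ⟨hx1, hx2⟩ hx
  refine hcon x hx ?_
  rw [node_extend, hx1, hx2]

theorem exists_roundVec_eq (hN : G.Normalized) (hℓ : 0 < ℓ) {t : ℕ} (ht : t < G.H)
    (τ : G.Hist t) (a : G.Act) {c : Fin n → ℝ}
    (hc : c ∈ ((G.approxGame ℓ cdf).val.C.get (t, G.curState τ, a)).dom) {p : G.Step → Prop}
    (hp : ∀ᵐ x ∂G.stepLaw t (G.curState τ) a, p x) :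
    ∃ x, p x ∧ G.cumRounded ℓ (extend τ x) = G.cumRounded ℓ τ + c := by
  obtain ⟨s', hs'⟩ := (G.P t (G.curState τ) a).support_nonempty
  obtain ⟨x, hx, hw⟩ := exists_node_extend_eq (cdf := cdf) hN hℓ ht τ a
    (w := (s', (G.node ℓ τ).2 + c)) ((mem_successors _).2 ⟨s', c,
      ENNReal.toReal_pos hs' (PMF.apply_ne_top _ _), hc, rfl⟩) hp
  exact ⟨x, hx, congrArg Prod.snd hw⟩

/-- The next node is a function of the current node, the next state and the rounded cost, and the
law of the latter two depends only on time, state and action. The rounded game is thus an exact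
Markov model of the nodes, although the true costs are hidden. -/
theorem integral_node_extend (hN : G.Normalized) (hℓ : 0 < ℓ) {t : ℕ} (ht : t < G.H)
    (τ : G.Hist t) (a : G.Act) (F : Node n G.nS → ℝ) :
    ∫ x, F (G.node ℓ (extend τ x)) ∂G.stepLaw t (G.curState τ) a =
      ∑ w ∈ (nodeAction (G.approxGame ℓ cdf).val t (G.node ℓ τ) a).trans.dom,
        (nodeAction (G.approxGame ℓ cdf).val t (G.node ℓ τ) a).trans.get w * F w := by
  rw [integral_comp_of_ae_mem_finset (f := fun x => G.node ℓ (extend τ x))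
    (fun w _ => ((measurable_node (t + 1)).comp (measurable_extend τ)) (measurableSet_singleton w))
    (ae_node_extend_mem (cdf := cdf) hN hℓ ht τ a)]
  refine Finset.sum_congr rfl fun w hw => ?_
  congr 1
  rw [show (nodeAction (G.approxGame ℓ cdf).val t (G.node ℓ τ) a).trans.get w = _ from
    tabulate_get hw, op_val]
  obtain ⟨s', c, hs', hc, rfl⟩ := (mem_successors _).1 hw
  -- The program searches its cost table for the increment `w.2 - v.2`, which recovers `c`.
  rw [add_sub_cancel_left, (approxGame_prob hN hℓ ht hc).1]
  refine Eq.trans ?_ (stepLaw_fiber (ℓ := ℓ) t (G.curState τ) a c s')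
  congr 1
  ext x
  simp only [Set.mem_preimage, Set.mem_singleton_iff, node_extend, Prod.mk.injEq, add_right_inj]
  rfl

end Game

/-! ## Correctness of the algorithm -/

namespace Game

variable {n : ℕ} {G : Game n} {ℓ : ℝ}

/-- Bounds relating the rounded cumulative costs of a history to the true ones: they exceed the
true ones only if some cost was truncated, and then they leave slack `c_max` for all remaining
steps. -/
def RoundingBounds (ℓ : ℝ) {t : ℕ} (τ : G.Hist t) : Prop :=
  ∀ i, (G.cumRounded ℓ τ i ≤ G.cumCost τ t i ∨
      G.cumRounded ℓ τ i ≤ G.B i - (G.H - t + 1) * G.cmax i) ∧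
    G.cumRounded ℓ τ i ≤ t * G.cmax i ∧ G.cumCost τ t i ≤ G.cumRounded ℓ τ i + t * ℓ

theorem cumCost_zero {t : ℕ} (τ : G.Hist t) : G.cumCost τ 0 = 0 :=
  Finset.sum_eq_zero fun j _ => if_neg (by lia)

theorem roundingBounds_zero (ℓ : ℝ) (τ : G.Hist 0) : RoundingBounds ℓ τ := by
  intro i
  simp [cumRounded_zero, cumCost_zero]

theorem RoundingBounds.extend (hN : G.Normalized) (hℓ : 0 < ℓ) {t : ℕ} {τ : G.Hist t}
    (hτ : RoundingBounds ℓ τ) {x : G.Step} (hx : ∀ i, x.2.1 i ≤ G.cmax i) :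
    RoundingBounds ℓ (Game.extend τ x) := by
  intro i
  obtain ⟨h1, h2, h3⟩ := hτ i
  rw [cumRounded_extend, cumCost_extend_succ, Pi.add_apply, Pi.add_apply]
  have hle := roundCost_le (G := G) hℓ i (x.2.1 i)
  have hge := sub_le_roundCost (G := G) hℓ i (x.2.1 i)
  obtain ⟨hc, hB⟩ := hN i
  have hmax : max (x.2.1 i) (G.B i - G.H * G.cmax i) ≤ G.cmax i := max_le (hx i) (by linarith)
  have hr : G.roundVec ℓ x.2.1 i = G.roundCost ℓ i (x.2.1 i) := rfl
  rw [hr]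
  push_cast
  refine ⟨?_, by linarith, by linarith⟩
  rcases h1 with h1 | h1
  -- Without truncation the rounded cost is at most the true one. With truncation it is at most `B_i
  -- - H c_max`; adding the bound `t c_max` for the past gives `B_i - (H - t) c_max`, the required
  -- slack at time `t + 1`.
  · rcases le_total (G.B i - G.H * G.cmax i) (x.2.1 i) with h4 | h4
    · rw [max_eq_left h4] at hle
      left
      linarith
    · rw [max_eq_right h4] at hle
      right
      linarith
  · right
    linarith

theorem RoundingBounds.cumRounded_le (hN : G.Normalized) {t : ℕ} (ht : t ≤ G.H)
    {τ : G.Hist t} (hτ : RoundingBounds ℓ τ) {i : Fin n} (h : G.cumCost τ t i ≤ G.B i) :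
    G.cumRounded ℓ τ i ≤ G.B i := by
  rcases (hτ i).1 with h1 | h1
  · exact h1.trans h
  · refine h1.trans (sub_le_self _ (mul_nonneg ?_ (hN i).1.le))
    have : (t : ℝ) ≤ G.H := by exact_mod_cast ht
    linarith

theorem measurableSet_roundingBounds (ℓ : ℝ) (t : ℕ) :
    MeasurableSet {τ : G.Hist t | RoundingBounds ℓ τ} := by
  have h1 : ∀ i, Measurable fun τ : G.Hist t => G.cumRounded ℓ τ i := fun i =>
    (measurable_pi_apply i).comp (G.measurable_cumRounded ℓ t)
  have h2 : ∀ i, Measurable fun τ : G.Hist t => G.cumCost τ t i := by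
    intro i
    unfold cumCost
    simp only [Finset.sum_apply]
    refine Finset.measurable_sum _ fun j _ => ?_
    split_ifs
    · fun_prop
    · exact measurable_const
  unfold RoundingBounds
  simp only [Set.ofPred_forall]
  refine MeasurableSet.iInter fun i => ?_
  exact ((measurableSet_le (h1 i) (h2 i)).union (measurableSet_le (h1 i) measurable_const)).inter
    ((measurableSet_le (h1 i) measurable_const).inter
      (measurableSet_le (h2 i) ((h1 i).add_const _)))

/-! ### Feasible policies stay on TRUE nodes -/

variable {cdf : ℕ} {π : G.Policy}

/-- A policy that keeps the budget only plays actions that keep the rounded budget. -/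
theorem feasibleAction_of_feasibleFrom (hN : G.Normalized) (hℓ : 0 < ℓ) {t : ℕ} (ht : t < G.H)
    {τ : G.Hist t} (hτ : RoundingBounds ℓ τ) (hπ : π.FeasibleFrom 0 τ) {a : G.Act}
    (ha : π.act t τ a ≠ 0) :
    (feasibleAction (G.approxGame ℓ cdf).val t (G.node ℓ τ) a).val = true := by
  rw [feasibleAction_val_iff]
  intro c hc
  -- Each supported rounded cost is realized by a step after which `π` is still feasible; there the
  -- true budget holds, and by the invariant so does the rounded one.
  obtain ⟨x, ⟨hx1, hx2⟩, hx⟩ := exists_roundVec_eq hN hℓ ht τ a hc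
    (((Policy.feasibleFrom_step_iff π ht 0 τ).1 hπ a ha).and (ae_stepLaw_cost_le ht _ a))
  rw [show (G.node ℓ τ).2 + c = G.cumRounded ℓ (extend τ x) from hx.symm]
  intro i
  refine (hτ.extend hN hℓ hx2).cumRounded_le hN ht ?_
  simpa using hx1.cumCost_le ht (by lia) le_rfl i

/-- Any action played by `π` witnesses truth: every successor node arises from an extension at which
`π` is still feasible, so induction on the remaining steps applies. -/
theorem isTrue_of_feasibleFrom (hN : G.Normalized) (hℓ : 0 < ℓ) {t : ℕ} (ht : t ≤ G.H)
    {τ : G.Hist t} (hτ : RoundingBounds ℓ τ) (hπ : π.FeasibleFrom 0 τ) :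
    IsTrue (G.approxGame ℓ cdf).val t (G.node ℓ τ) := by
  obtain ⟨k, hk⟩ := Nat.exists_eq_add_of_le ht
  induction k generalizing t with
  | zero => exact isTrue_of_le hk.le _
  | succ k ih =>
    have ht' : t < G.H := by lia
    obtain ⟨a, ha⟩ := Policy.exists_act_ne_zero π τ
    rw [isTrue_iff (g := (G.approxGame ℓ cdf).val) ht']
    refine ⟨a, (mem_trueActions (g := (G.approxGame ℓ cdf).val) ht').2
      ⟨feasibleAction_of_feasibleFrom hN hℓ ht' hτ hπ ha, fun w hw => ?_⟩⟩
    obtain ⟨x, ⟨hx1, hx2⟩, rfl⟩ := exists_node_extend_eq hN hℓ ht' τ a hw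
      (((Policy.feasibleFrom_step_iff π ht' 0 τ).1 hπ a ha).and (ae_stepLaw_cost_le ht' _ a))
    exact ih ht' (hτ.extend hN hℓ hx2) hx1 (by lia)

/-- Needed for arbitrary policies, since it is later applied to a deviation from the computed
strategy. -/
theorem mem_trueActions_of_feasibleFrom (hN : G.Normalized) (hℓ : 0 < ℓ) {t : ℕ} (ht : t < G.H)
    {τ : G.Hist t} (hτ : RoundingBounds ℓ τ) (hπ : π.FeasibleFrom 0 τ) {a : G.Act}
    (ha : π.act t τ a ≠ 0) :
    a ∈ trueActions (G.approxGame ℓ cdf).val t (G.node ℓ τ) := by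
  refine (mem_trueActions (g := (G.approxGame ℓ cdf).val) ht).2
    ⟨feasibleAction_of_feasibleFrom hN hℓ ht hτ hπ ha, fun w hw => ?_⟩
  obtain ⟨x, ⟨hx1, hx2⟩, rfl⟩ := exists_node_extend_eq hN hℓ ht τ a hw
    (((Policy.feasibleFrom_step_iff π ht 0 τ).1 hπ a ha).and (ae_stepLaw_cost_le ht _ a))
  exact isTrue_of_feasibleFrom hN hℓ ht (hτ.extend hN hℓ hx2) hx1

theorem node_initHist (ℓ : ℝ) : G.node ℓ G.initHist = (G.s₁, 0) := by
  rw [node, cumRounded_zero]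
  rfl

/-- Feasible policies only realize histories at reached nodes. -/
theorem ae_law_of_feasible (hN : G.Normalized) (hℓ : 0 < ℓ) (hπ : π.Feasible) {t : ℕ}
    (ht : t ≤ G.H) : ∀ᵐ τ ∂π.law 0 t G.initHist,
      (G.node ℓ τ ∈ reachLayer (G.approxGame ℓ cdf).val t ∧ RoundingBounds ℓ τ) ∧
        π.FeasibleFrom 0 τ := by
  have hms : ∀ t, MeasurableSet {τ : G.Hist t |
      (G.node ℓ τ ∈ reachLayer (G.approxGame ℓ cdf).val t ∧ RoundingBounds ℓ τ) ∧
        π.FeasibleFrom 0 τ} := fun t =>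
    ((measurable_node t (reachLayer (G.approxGame ℓ cdf).val t).measurableSet).inter
      (measurableSet_roundingBounds ℓ t)).inter (Policy.measurableSet_feasibleFrom π 0)
  induction t with
  | zero =>
    rw [Policy.law_self, ae_dirac_iff (hms 0), node_initHist]
    exact ⟨⟨root_mem_reachLayer, roundingBounds_zero ℓ _⟩, hπ⟩
  | succ t ih =>
    rw [Policy.ae_law_iff π t.zero_le t.le_succ _ (hms (t + 1))]
    filter_upwards [ih (by lia)] with τ hτ
    rw [Policy.ae_law_succ_iff π τ (hms (t + 1))]
    intro a ha
    filter_upwards [(Policy.feasibleFrom_step_iff π ht 0 τ).1 hτ.2 a ha,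
      ae_stepLaw_cost_le ht _ a, ae_node_extend_mem hN hℓ ht τ a] with x h1 h2 h3
    exact ⟨⟨successors_subset_reachLayer hτ.1.1
      (feasibleAction_of_feasibleFrom hN hℓ ht hτ.1.2 hτ.2 ha) h3, hτ.1.2.extend hN hℓ h2⟩, h1⟩

/-! ### The computed strategy -/

variable (lp : LPSolver) (e : EqKind)

variable (G ℓ cdf) in
/-- The strategy computed by backward induction. -/
def computedStrategy : Strategy n G.nS G.nA :=
  (List.range' 0 G.H).map (stratTable (G.approxGame ℓ cdf).val lp e)

/-- The computed probabilities of joint actions at a node. -/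
def stageWeight (g : TabularGame n G.nS G.nA) (t : ℕ) (v : Node n G.nS) : G.Act → ℝ :=
  (solveStage lp e (nodeActions g t v) (valueTable g lp e (t + 1))).val.1.get

/-- The computed `Q`-values at a node. -/
def stageQ (g : TabularGame n G.nS G.nA) (t : ℕ) (v : Node n G.nS) : G.Act → Fin n → ℝ :=
  qValue (nodeActions g t v) (valueTable g lp e (t + 1))

variable {g : TabularGame n G.nS G.nA}

theorem stage_spec {t : ℕ} (ht : t < g.H) {v : Node n G.nS} (hv : v ∈ trueLayer g t) :
    (∃ low, IsStageEquilibrium e (trueActions g t v)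
      (extendUtility (trueActions g t v) (stageQ lp e g t v) low) (stageWeight lp e g t v)) ∧
    (valueTable g lp e t).get v =
      ∑ a ∈ trueActions g t v, stageWeight lp e g t v a • stageQ lp e g t v a := by
  obtain ⟨-, h2, h3⟩ := solveStage_spec lp e (nodeActions g t v) (valueTable g lp e (t + 1))
    ((isTrue_iff ht).1 (mem_trueLayer.1 hv).2)
  refine ⟨h2, ?_⟩
  have hV : valueTable g lp e t = (tabulate (trueLayer g t) fun v =>
      op (solveStage lp e (nodeActions g t v) (valueTable g lp e (t + 1))).val.2).val := by
    obtain ⟨k, hk⟩ := Nat.exists_eq_add_of_lt ht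
    rw [valueTable, valueTable, show g.H - t = k + 1 by lia, show g.H - (t + 1) = k by lia]
    rfl
  rw [hV, tabulate_get hv]
  exact h3

theorem stageQ_apply {t : ℕ} {v : Node n G.nS} {a : G.Act} (ha : a ∈ trueActions g t v)
    (i : Fin n) : stageQ lp e g t v a i = g.r t v.1 a i +
      ∑ w ∈ (nodeAction g t v a).trans.dom,
        (nodeAction g t v a).trans.get w * (valueTable g lp e (t + 1)).get w i := by
  have : (nodeActions g t v).get a = nodeAction g t v a := tabulate_get ha
  simp only [stageQ, qValue, this, Pi.add_apply, Finset.sum_apply, Pi.smul_apply, smul_eq_mul]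
  rfl

theorem valueTable_horizon {v : Node n G.nS} (hv : v ∈ trueLayer g g.H) :
    (valueTable g lp e g.H).get v = 0 := by
  rw [valueTable, Nat.sub_self]
  exact tabulate_get hv

-- At a TRUE node the stage solution is a probability vector, so the fallback actions in
-- `prescribed` and `toPMF` are not used.
open Classical in
theorem prescribed_toReal {t : ℕ} (ht : t < G.H) {v : Node n G.nS}
    (hv : v ∈ trueLayer (G.approxGame ℓ cdf).val t) (a : G.Act) :
    (G.prescribed (G.computedStrategy ℓ cdf lp e) t v a).toReal =
      if a ∈ trueActions (G.approxGame ℓ cdf).val t v then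
        stageWeight lp e (G.approxGame ℓ cdf).val t v a else 0 := by
  set g := (G.approxGame ℓ cdf).val with hg
  obtain ⟨⟨low, hσ⟩, -⟩ := stage_spec lp e (g := g) ht hv
  have hget : (G.computedStrategy ℓ cdf lp e).getD t default = stratTable g lp e t := by
    unfold computedStrategy
    rw [List.getD_eq_getElem _ _ (by simpa using ht)]
    simp [← hg]
  have hdom : v ∈ (stratTable g lp e t).dom := hv
  have hst : (stratTable g lp e t).get v =
    (solveStage lp e (nodeActions g t v) (valueTable g lp e (t + 1))).val.1 := tabulate_get hv
  have hX : ((stratTable g lp e t).get v).dom = trueActions g t v := by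
    rw [hst]
    rfl
  set w : G.Act → ℝ := fun a => if a ∈ trueActions g t v then stageWeight lp e g t v a else 0
    with hw
  have hw0 : ∀ a, 0 ≤ w a := by
    intro a
    simp only [hw]
    split_ifs with ha
    · exact hσ.nonneg a ha
    · exact le_rfl
  have hw1 : ∑ a, w a = 1 := by
    rw [← hσ.sum_eq_one, Finset.sum_ite_mem, Finset.univ_inter]
  have hpre : G.prescribed (G.computedStrategy ℓ cdf lp e) t v = G.toPMF w := by
    unfold prescribed
    rw [hget, if_pos hdom]
    congr 1
    funext a
    rw [hX, hst]
    rfl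
  rw [hpre, toPMF, dif_pos ⟨hw0, hw1⟩, PMF.ofFintype_apply, ENNReal.toReal_ofReal (hw0 a)]

theorem play_toReal {t : ℕ} (ht : t < G.H) {τ : G.Hist t}
    (hτ : G.node ℓ τ ∈ trueLayer (G.approxGame ℓ cdf).val t) (a : G.Act) [Decidable (a ∈
      trueActions (G.approxGame ℓ cdf).val t (G.node ℓ τ))] :
    ((G.play ℓ (G.computedStrategy ℓ cdf lp e)).act t τ a).toReal =
      if a ∈ trueActions (G.approxGame ℓ cdf).val t (G.node ℓ τ) then
        stageWeight lp e (G.approxGame ℓ cdf).val t (G.node ℓ τ) a else 0 := by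
  refine (prescribed_toReal lp e ht hτ a).trans ?_
  congr

theorem mem_trueActions_of_play {t : ℕ} (ht : t < G.H) {τ : G.Hist t}
    (hτ : G.node ℓ τ ∈ trueLayer (G.approxGame ℓ cdf).val t) {a : G.Act}
    (ha : (G.play ℓ (G.computedStrategy ℓ cdf lp e)).act t τ a ≠ 0) :
    a ∈ trueActions (G.approxGame ℓ cdf).val t (G.node ℓ τ) := by
  classical
  by_contra hcon
  have := play_toReal lp e ht hτ a
  rw [if_neg hcon, ENNReal.toReal_eq_zero_iff] at this
  exact this.elim ha (PMF.apply_ne_top _ _)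

theorem ae_node_extend_mem_trueLayer (hN : G.Normalized) (hℓ : 0 < ℓ) {t : ℕ} (ht : t < G.H)
    {τ : G.Hist t} (hτ : G.node ℓ τ ∈ trueLayer (G.approxGame ℓ cdf).val t) {a : G.Act}
    (ha : a ∈ trueActions (G.approxGame ℓ cdf).val t (G.node ℓ τ)) :
    ∀ᵐ x ∂G.stepLaw t (G.curState τ) a,
      G.node ℓ (extend τ x) ∈ trueLayer (G.approxGame ℓ cdf).val (t + 1) ∧
        G.cumRounded ℓ (extend τ x) ≤ G.B := by
  obtain ⟨h1, h2⟩ := (mem_trueActions (g := (G.approxGame ℓ cdf).val) ht).1 ha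
  filter_upwards [ae_node_extend_mem (cdf := cdf) hN hℓ ht τ a] with x hx
  refine ⟨mem_trueLayer.2 ⟨successors_subset_reachLayer (mem_trueLayer.1 hτ).1 h1 hx, h2 _ hx⟩, ?_⟩
  obtain ⟨s', c, -, hc, hw⟩ := (mem_successors _).1 hx
  rw [show G.cumRounded ℓ (extend τ x) = _ from congrArg Prod.snd hw]
  exact (feasibleAction_val_iff _).1 h1 c hc

/-! ### Feasibility, value and deviations of the computed strategy -/

/-- Playing the computed strategy from a TRUE node exceeds the budget by at most `H ℓ`. -/
theorem play_feasibleFrom (hN : G.Normalized) (hℓ : 0 < ℓ) {t : ℕ} (ht : t ≤ G.H)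
    {τ : G.Hist t} (hτ : G.node ℓ τ ∈ trueLayer (G.approxGame ℓ cdf).val t)
    (hr : RoundingBounds ℓ τ)
    (hB : ∀ m, 1 ≤ m → m ≤ t → ∀ i, G.cumCost τ m i ≤ G.B i + G.H * ℓ) :
    (G.play ℓ (G.computedStrategy ℓ cdf lp e)).FeasibleFrom (G.H * ℓ) τ := by
  obtain ⟨k, hk⟩ := Nat.exists_eq_add_of_le ht
  induction k generalizing t with
  | zero =>
    obtain rfl : t = G.H := hk.symm
    exact (Policy.feasibleFrom_horizon_iff _ _ τ).2 hB
  | succ k ih =>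
    have ht' : t < G.H := by lia
    rw [Policy.feasibleFrom_step_iff _ ht']
    intro a ha
    filter_upwards [ae_stepLaw_cost_le ht' _ a, ae_node_extend_mem_trueLayer hN hℓ ht' hτ
      (mem_trueActions_of_play lp e ht' hτ ha)] with x h1 h2
    have hr' := hr.extend hN hℓ h1
    refine ih ht' h2.1 hr' (fun m hm hmt i => ?_) (by lia)
    rcases hmt.eq_or_lt with rfl | hlt
    -- For the newest partial sum, the rounded cost keeps the budget exactly and the accumulated
    -- rounding error is at most `(t + 1) ℓ ≤ H ℓ`.
    · refine ((hr' i).2.2).trans (add_le_add (h2.2 i) ?_)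
      exact mul_le_mul_of_nonneg_right (by exact_mod_cast ht') hℓ.le
    · rw [cumCost_extend_of_le τ x (by lia)]
      exact hB m hm (by lia) i

/-- The computed values are the values of the computed strategy. -/
theorem play_value (hN : G.Normalized) (hℓ : 0 < ℓ) (i : Fin n) {t : ℕ} (ht : t ≤ G.H)
    {τ : G.Hist t} (hτ : G.node ℓ τ ∈ trueLayer (G.approxGame ℓ cdf).val t) :
    (G.play ℓ (G.computedStrategy ℓ cdf lp e)).value i τ =
      (valueTable (G.approxGame ℓ cdf).val lp e t).get (G.node ℓ τ) i := by
  classical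
  obtain ⟨k, hk⟩ := Nat.exists_eq_add_of_le ht
  induction k generalizing t with
  | zero =>
    obtain rfl : t = G.H := hk.symm
    have h0 := valueTable_horizon lp e (g := (G.approxGame ℓ cdf).val) hτ
    rw [Policy.value_horizon, show (valueTable (G.approxGame ℓ cdf).val lp e G.H).get _ = 0 from h0]
    rfl
  | succ k ih =>
    have ht' : t < G.H := by lia
    rw [Policy.value_step _ i ht', (stage_spec lp e (g := (G.approxGame ℓ cdf).val) ht' hτ).2,
      Finset.sum_apply, ← Finset.sum_subset (Finset.subset_univ
        (trueActions (G.approxGame ℓ cdf).val t (G.node ℓ τ)))]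
    · refine Finset.sum_congr rfl fun a ha => ?_
      rw [play_toReal lp e ht' hτ, if_pos ha, Pi.smul_apply, smul_eq_mul, stageQ_apply lp e ha]
      congr 2
      rw [← integral_node_extend hN hℓ ht' τ a
        fun w => (valueTable (G.approxGame ℓ cdf).val lp e (t + 1)).get w i]
      refine integral_congr_ae ?_
      filter_upwards [ae_node_extend_mem_trueLayer hN hℓ ht' hτ ha] with x hx
      exact ih ht' hx.1 (by lia)
    · intro a _ ha
      rw [play_toReal lp e ht' hτ, if_neg ha, zero_mul]

theorem modify_act_ne_zero (π : G.Policy) {i : Fin n} (φ : G.Modification i) {t : ℕ}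
    {τ : G.Hist t} {a : G.Act} {y : Fin (G.nA i)} (ha : π.act t τ a ≠ 0)
    (hy : φ.act t τ (a i) y ≠ 0) : (π.modify φ).act t τ (Function.update a i y) ≠ 0 := by
  change _ ∈ ((π.act t τ).bind fun a => (φ.act t τ (a i)).map (Function.update a i)).support
  rw [PMF.mem_support_bind_iff]
  exact ⟨a, ha, (PMF.mem_support_map_iff _ _ _).2 ⟨y, hy, rfl⟩⟩

theorem sum_modify_mul (π : G.Policy) {i : Fin n} (φ : G.Modification i) {t : ℕ} (τ : G.Hist t)
    (f : G.Act → ℝ) : ∑ a, ((π.modify φ).act t τ a).toReal * f a =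
      ∑ b, (π.act t τ b).toReal *
        ∑ y, (φ.act t τ (b i) y).toReal * f (Function.update b i y) := by
  classical
  have h1 : ∀ a, ((π.modify φ).act t τ a).toReal = ∑ b, (π.act t τ b).toReal *
      ∑ y, if a = Function.update b i y then (φ.act t τ (b i) y).toReal else 0 := by
    intro a
    change ((π.act t τ).bind (fun b => (φ.act t τ (b i)).map (Function.update b i)) a).toReal = _
    rw [PMF.bind_apply, tsum_fintype, ENNReal.toReal_sum fun b _ =>
      ENNReal.mul_ne_top (PMF.apply_ne_top _ _) (PMF.apply_ne_top _ _)]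
    refine Finset.sum_congr rfl fun b _ => ?_
    rw [ENNReal.toReal_mul, PMF.map_apply, tsum_fintype, ENNReal.toReal_sum fun y _ => ?_]
    · congr 1
      refine Finset.sum_congr rfl fun y _ => ?_
      split_ifs <;> rfl
    · split_ifs
      · exact PMF.apply_ne_top _ _
      · exact ENNReal.zero_ne_top
  simp only [h1, Finset.sum_mul, mul_assoc]
  rw [Finset.sum_comm]
  refine Finset.sum_congr rfl fun b _ => ?_
  rw [← Finset.mul_sum]
  congr 1
  rw [Finset.sum_comm]
  refine Finset.sum_congr rfl fun y _ => ?_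
  simp

/-- No deviation that keeps the budget has a higher value. -/
theorem modify_value_le (hN : G.Normalized) (hℓ : 0 < ℓ) {i : Fin n} {φ : G.Modification i}
    (hφ : e.Allows φ) {t : ℕ} (ht : t ≤ G.H) {τ : G.Hist t}
    (hτ : G.node ℓ τ ∈ trueLayer (G.approxGame ℓ cdf).val t) (hr : RoundingBounds ℓ τ)
    (hf : ((G.play ℓ (G.computedStrategy ℓ cdf lp e)).modify φ).FeasibleFrom 0 τ) :
    ((G.play ℓ (G.computedStrategy ℓ cdf lp e)).modify φ).value i τ ≤
      (valueTable (G.approxGame ℓ cdf).val lp e t).get (G.node ℓ τ) i := by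
  classical
  obtain ⟨k, hk⟩ := Nat.exists_eq_add_of_le ht
  induction k generalizing t with
  | zero =>
    obtain rfl : t = G.H := hk.symm
    have h0 := valueTable_horizon lp e (g := (G.approxGame ℓ cdf).val) hτ
    rw [Policy.value_horizon, show (valueTable (G.approxGame ℓ cdf).val lp e G.H).get _ = 0 from h0]
    exact le_rfl
  | succ k ih =>
    have ht' : t < G.H := by lia
    set g := (G.approxGame ℓ cdf).val with hg
    set π := G.play ℓ (G.computedStrategy ℓ cdf lp e) with hπ
    obtain ⟨⟨low, hσ⟩, hV⟩ := stage_spec lp e (g := g) ht' hτ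
    -- The computed strategy may exceed the true budget, but the deviation does not; hence every
    -- action it plays is allowed in the reduced game.
    have hmem : ∀ a, (π.modify φ).act t τ a ≠ 0 → a ∈ trueActions g t (G.node ℓ τ) := fun a ha =>
      mem_trueActions_of_feasibleFrom hN hℓ ht' hr hf ha
    calc (π.modify φ).value i τ
        ≤ ∑ a, ((π.modify φ).act t τ a).toReal * stageQ lp e g t (G.node ℓ τ) a i := by
          rw [Policy.value_step _ i ht']
          refine Finset.sum_le_sum fun a _ => ?_
          by_cases h0 : (π.modify φ).act t τ a = 0
          · simp [h0]
          refine mul_le_mul_of_nonneg_left ?_ ENNReal.toReal_nonneg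
          rw [stageQ_apply lp e (hmem a h0)]
          refine add_le_add le_rfl ?_
          rw [← integral_node_extend hN hℓ ht' τ a fun w => (valueTable g lp e (t + 1)).get w i]
          have hae := ae_node_extend_mem_trueLayer hN hℓ ht' hτ (hmem a h0)
          refine integral_mono_ae (Policy.integrable_value_extend _ i τ _) ?_ ?_
          -- The tabulated values agree almost surely with the values of `π`, which are bounded and
          -- measurable.
          · refine (Policy.integrable_value_extend π i τ _).congr ?_
            filter_upwards [hae] with x hx
            exact play_value lp e hN hℓ i ht' hx.1
          · filter_upwards [hae, ae_stepLaw_cost_le ht' _ a,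
              (Policy.feasibleFrom_step_iff _ ht' 0 τ).1 hf a h0] with x h1 h2 h3
            exact ih ht' h1.1 (hr.extend hN hℓ h2) h3 (by lia)
      _ = ∑ b ∈ trueActions g t (G.node ℓ τ), stageWeight lp e g t (G.node ℓ τ) b *
            ∑ y, (φ.act t τ (b i) y).toReal *
              stageQ lp e g t (G.node ℓ τ) (Function.update b i y) i := by
          rw [sum_modify_mul, ← Finset.sum_subset (Finset.subset_univ
            (trueActions g t (G.node ℓ τ)))]
          · refine Finset.sum_congr rfl fun a ha => ?_
            rw [hπ, play_toReal lp e ht' hτ, if_pos ha]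
          · intro a _ ha
            rw [hπ, play_toReal lp e ht' hτ, if_neg ha, zero_mul]
      _ ≤ ∑ b ∈ trueActions g t (G.node ℓ τ), stageWeight lp e g t (G.node ℓ τ) b *
            stageQ lp e g t (G.node ℓ τ) b i := by
          refine hσ.modify_le i (fun x y => (φ.act t τ x y).toReal)
            (fun x y => ENNReal.toReal_nonneg) (fun x => ?_) ?_ ?_
          · rw [← ENNReal.toReal_sum fun y _ => PMF.apply_ne_top _ _, ← tsum_fintype (L := .unconditional _),
              PMF.tsum_coe, ENNReal.toReal_one]
          · rintro rfl x x'
            funext y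
            rw [show φ.act t τ x = φ.act t τ x' from hφ t τ x x']
          -- Advice and response that both have positive probability yield a joint action which the
          -- deviating policy really plays, hence an allowed one.
          · intro a ha hpos y hy
            refine hmem _ (modify_act_ne_zero π φ ?_ ?_)
            · intro h0
              have := play_toReal lp e ht' hτ a
              rw [if_pos ha, ← hπ, h0, ENNReal.toReal_zero] at this
              exact hpos.ne this
            · intro h0
              simp [h0] at hy
      _ = (valueTable g lp e t).get (G.node ℓ τ) i := by
          rw [hV, Finset.sum_apply]
          rfl

/-- Correctness of the approximation algorithm. -/
theorem approximation_correct (G : Game n) (lp : LPSolver) (e : EqKind) (cdf : ℕ) (ε : ℝ)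
    (hN : G.Normalized) (hε : 0 < ε) :
    ((G.approximation lp e (ε / G.H) cdf).val = none → ¬ ∃ π : G.Policy, π.Feasible) ∧
    ∀ σ, (G.approximation lp e (ε / G.H) cdf).val = some σ →
      (G.play (ε / G.H) σ).AddFeasible ε ∧ (G.play (ε / G.H) σ).IsApproxACSPE e ε := by
  classical
  set ℓ := ε / G.H with hℓd
  have hH : (0 : ℝ) < G.H := by exact_mod_cast G.H_pos
  have hℓ : 0 < ℓ := div_pos hε hH
  have hHℓ : G.H * ℓ = ε := mul_div_cancel₀ _ hH.ne'
  have hval : (G.approximation lp e ℓ cdf).val =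
      (reduction (constrainedSolver lp e) (G.approxGame ℓ cdf).val).val := rfl
  have hs₁ : ((G.approxGame ℓ cdf).val.s₁, (0 : Fin n → ℝ)) = G.node ℓ G.initHist :=
    (node_initHist ℓ).symm
  rw [hval, reduction_val, hs₁]
  split_ifs with ht
  · refine ⟨fun h => absurd h (by simp), fun σ hσ => ?_⟩
    obtain rfl : G.computedStrategy ℓ cdf lp e = σ := Option.some.inj hσ
    constructor
    · have h0 : G.node ℓ G.initHist ∈ trueLayer (G.approxGame ℓ cdf).val 0 :=
        mem_trueLayer.2 ⟨hs₁ ▸ root_mem_reachLayer, ht⟩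
      have := play_feasibleFrom lp e hN hℓ G.H.zero_le h0 (roundingBounds_zero ℓ _)
        fun m h1 h2 => by lia
      rwa [hHℓ] at this
    · intro h hh π₀ hπ₀
      -- The policy `π₀` serves only to certify that `τ` sits at a reached TRUE node, with valid
      -- rounding bounds and a past within the budget.
      filter_upwards [ae_law_of_feasible (cdf := cdf) hN hℓ hπ₀ hh] with τ hτ
      have hτt : G.node ℓ τ ∈ trueLayer (G.approxGame ℓ cdf).val h :=
        mem_trueLayer.2 ⟨hτ.1.1, isTrue_of_feasibleFrom hN hℓ hh hτ.1.2 hτ.2⟩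
      constructor
      · have := play_feasibleFrom lp e hN hℓ hh hτt hτ.1.2 fun m h1 h2 i => by
          have := hτ.2.cumCost_le hh h1 h2 i
          rw [hHℓ]
          linarith
        rwa [hHℓ] at this
      · intro i φ hφ
        by_cases hf : ((G.play ℓ (G.computedStrategy ℓ cdf lp e)).modify φ).FeasibleFrom 0 τ
        · right
          rw [play_value lp e hN hℓ i hh hτt]
          exact modify_value_le lp e hN hℓ hφ hh hτt hτ.1.2 hf
        · exact Or.inl hf
  · refine ⟨fun _ => ?_, fun σ hσ => absurd hσ (by simp)⟩
    rintro ⟨π, hπ⟩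
    exact ht (isTrue_of_feasibleFrom hN hℓ G.H.zero_le (roundingBounds_zero ℓ _) hπ)

end Game

/-! ## Running times of the elementary programs -/

section ProgramTimes

variable {α β ι κ : Type} {m b w : ℕ}

theorem sum_le_of_card_le {D : Finset ι} {f : ι → ℕ} (hD : D.card ≤ m) (hf : ∀ x ∈ D, f x ≤ b) :
    ∑ x ∈ D, f x ≤ m * b :=
  (Finset.sum_le_card_nsmul D f b hf).trans (Nat.mul_le_mul_right b hD)

theorem tabulate_time_le [Inhabited β] {D : Finset ι} {f : ι → Timed β} (hD : D.card ≤ m)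
    (hf : ∀ x ∈ D, (f x).time ≤ b) : (tabulate D f).time ≤ 1 + m * (b + 1) :=
  Nat.add_le_add_left (sum_le_of_card_le hD fun x hx => Nat.add_le_add_right (hf x hx) 1) 1

theorem tall_time_le {D : Finset ι} {f : ι → Timed Bool} (hD : D.card ≤ m)
    (hf : ∀ x ∈ D, (f x).time ≤ b) : (tall D f).time ≤ 1 + m * (b + 1) :=
  Nat.add_le_add_left (sum_le_of_card_le hD fun x hx => Nat.add_le_add_right (hf x hx) 1) 1

theorem tfilter_time_le {D : Finset ι} {f : ι → Timed Bool} (hD : D.card ≤ m)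
    (hf : ∀ x ∈ D, (f x).time ≤ b) : (tfilter D f).time ≤ 1 + m * (b + 1) :=
  Nat.add_le_add_left (sum_le_of_card_le hD fun x hx => Nat.add_le_add_right (hf x hx) 1) 1

theorem tarray_time_le {N : ℕ} {f : Fin N → Timed β} (hN : N ≤ m) (hf : ∀ j, (f j).time ≤ b) :
    (tarray f).time ≤ 1 + m * (b + 1) :=
  Nat.add_le_add_left (sum_le_of_card_le (by simpa using hN)
    fun x _ => Nat.add_le_add_right (hf x) 1) 1

theorem tprodOver_time_le {N : ℕ} {f : Fin N → Timed ℝ} (hN : N ≤ m) (hf : ∀ j, (f j).time ≤ b) :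
    (tprodOver f).time ≤ 1 + m * (b + 1) :=
  Nat.add_le_add_left (sum_le_of_card_le (by simpa using hN)
    fun x _ => Nat.add_le_add_right (hf x) 1) 1

theorem tsumOver_time_le [AddCommMonoid β] {w' : ℕ} {D : Finset ι} {f : ι → Timed β}
    (hw : w ≤ w') (hD : D.card ≤ m) (hf : ∀ x ∈ D, (f x).time ≤ b) :
    (tsumOver w D f).time ≤ 1 + m * (b + w') :=
  Nat.add_le_add_left (sum_le_of_card_le hD fun x hx => Nat.add_le_add (hf x hx) hw) 1

theorem timage_time_le {w' : ℕ} {D : Finset ι} {f : ι → Timed κ} (hw : w ≤ w') (hD : D.card ≤ m)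
    (hf : ∀ x ∈ D, (f x).time ≤ b) : (timage w D f).time ≤ 1 + m * (b + 1) + w' * m ^ 2 :=
  Nat.add_le_add (Nat.add_le_add_left (sum_le_of_card_le hD fun x hx =>
    Nat.add_le_add_right (hf x hx) 1) 1) (Nat.mul_le_mul hw (Nat.pow_le_pow_left hD 2))

theorem timage_card_le {D : Finset ι} {f : ι → Timed κ} (hD : D.card ≤ m) :
    (timage w D f).val.card ≤ m := by
  classical
  exact Finset.card_image_le.trans hD

theorem tunion_time_le {w' k : ℕ} {D : Finset ι} {f : ι → Timed (Finset κ)} (hw : w ≤ w')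
    (hD : D.card ≤ m) (hf : ∀ x ∈ D, (f x).time ≤ b) (hk : ∀ x ∈ D, (f x).val.card ≤ k) :
    (tunion w D f).time ≤ 1 + m * (b + 1) + w' * (m * k) ^ 2 :=
  Nat.add_le_add (Nat.add_le_add_left (sum_le_of_card_le hD fun x hx =>
    Nat.add_le_add_right (hf x hx) 1) 1)
    (Nat.mul_le_mul hw (Nat.pow_le_pow_left (sum_le_of_card_le hD hk) 2))

theorem tunion_card_le {k : ℕ} {D : Finset ι} {f : ι → Timed (Finset κ)} (hD : D.card ≤ m)
    (hk : ∀ x ∈ D, (f x).val.card ≤ k) : (tunion w D f).val.card ≤ m * k := by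
  classical
  exact Finset.card_biUnion_le.trans (sum_le_of_card_le hD hk)

theorem lookup_time_le {w' : ℕ} {T : Table ι β} (hw : w ≤ w') (hT : T.dom.card ≤ m) (x : ι) :
    (lookup w T x).time ≤ w' * (m + 1) :=
  Nat.mul_le_mul hw (Nat.add_le_add_right hT 1)

theorem member_time_le {w' : ℕ} {D : Finset ι} (hw : w ≤ w') (hD : D.card ≤ m) (x : ι) :
    (member w D x).time ≤ w' * (m + 1) :=
  Nat.mul_le_mul hw (Nat.add_le_add_right hD 1)

theorem tlist_time_le {f : ι → Timed β} {l : List ι} (hl : l.length ≤ m)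
    (hf : ∀ x ∈ l, (f x).time ≤ b) : (tlist f l).time ≤ 1 + m * (b + 1) := by
  have : (tlist f l).time ≤ 1 + l.length * (b + 1) := by
    clear hl
    induction l with
    | nil => simp [tlist]
    | cons x l ih =>
      have h1 := hf x List.mem_cons_self
      have h2 := ih fun y hy => hf y (List.mem_cons_of_mem x hy)
      simp only [tlist, Timed.time_bind, op_time, List.length_cons, add_one_mul]
      lia
  exact this.trans (Nat.add_le_add_left (Nat.mul_le_mul_right _ hl) 1)

end ProgramTimes

/-! ## Polynomially bounded functions -/

/-- Functions bounded by a polynomial. -/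
def PolyBounded (F : ℕ → ℕ) : Prop := ∃ K d : ℕ, ∀ x, F x ≤ K * (x + 1) ^ d

namespace PolyBounded

variable {F F' : ℕ → ℕ}

theorem const (c : ℕ) : PolyBounded fun _ => c := ⟨c, 0, fun x => by simp⟩

theorem id : PolyBounded fun x => x := ⟨1, 1, fun x => by simp⟩

theorem add (h : PolyBounded F) (h' : PolyBounded F') : PolyBounded fun x => F x + F' x := by
  obtain ⟨K, d, hK⟩ := h
  obtain ⟨K', d', hK'⟩ := h'
  refine ⟨K + K', max d d', fun x => ?_⟩
  rw [add_mul]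
  refine add_le_add ((hK x).trans ?_) ((hK' x).trans ?_)
  · exact Nat.mul_le_mul_left _ (Nat.pow_le_pow_right x.succ_pos (le_max_left _ _))
  · exact Nat.mul_le_mul_left _ (Nat.pow_le_pow_right x.succ_pos (le_max_right _ _))

theorem mul (h : PolyBounded F) (h' : PolyBounded F') : PolyBounded fun x => F x * F' x := by
  obtain ⟨K, d, hK⟩ := h
  obtain ⟨K', d', hK'⟩ := h'
  refine ⟨K * K', d + d', fun x => ?_⟩
  refine (Nat.mul_le_mul (hK x) (hK' x)).trans_eq ?_
  ring

theorem pow (h : PolyBounded F) (k : ℕ) : PolyBounded fun x => F x ^ k := by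
  induction k with
  | zero => simpa using const 1
  | succ k ih => simpa only [pow_succ] using ih.mul h

theorem comp (h : PolyBounded F) (h' : PolyBounded F') : PolyBounded fun x => F (F' x) := by
  obtain ⟨K, d, hK⟩ := h
  obtain ⟨K', d', hK'⟩ := ((h'.add (const 1)).pow d).mul (const K)
  refine ⟨K', d', fun x => ((hK (F' x)).trans_eq (mul_comm _ _)).trans (hK' x)⟩

theorem eval (p : Polynomial ℕ) : PolyBounded fun x => p.eval x := by
  induction p using Polynomial.induction_on' with
  | add p q hp hq => simpa only [Polynomial.eval_add] using hp.add hq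
  | monomial k c => simpa only [Polynomial.eval_monomial] using (const c).mul (id.pow k)

end PolyBounded

/-! ## Running time of the feasibility algorithm -/

section FeasibilityTimes

variable {n nS : ℕ} {nA : Fin n → ℕ}

/-- Bounds on the sizes of the objects that occur in the algorithms. -/
structure SizeBound (g : TabularGame n nS nA) (M : ℕ) : Prop where
  players : n + 2 ≤ M
  horizon : g.H + 1 ≤ M
  states : nS ≤ M
  acts : Fintype.card (JAct nA) ≤ M
  act : ∀ i, nA i ≤ M
  keys : g.C.dom.card ≤ M
  costs : ∀ k, (g.C.get k).dom.card ≤ M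
  layers : ∀ h ≤ g.H, (reachLayer g h).card ≤ M

/-- Time bound for `feasibleAction`. -/
def feasibleActionBound (M : ℕ) : ℕ := M * (M + 1) + (1 + M * (2 * M + 1 + 1))

/-- Time bound for `successors`. -/
def successorsBound (M : ℕ) : ℕ :=
  M * (M + 1) + (1 + M * (2 + 1) + (1 + M * M * (M + 1) + M * (M * M) ^ 2))

/-- Time bound for the successors of all actions. -/
def expandBound (M : ℕ) : ℕ :=
  1 + M * (feasibleActionBound M + (successorsBound M + 1) + 1) + M * (M * (M * M)) ^ 2

/-- Time bound for `nextLayer`. -/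
def nextLayerBound (M : ℕ) : ℕ :=
  1 + M * (expandBound M + 1) + M * (M * (M * (M * M))) ^ 2

/-- Time bound for `labelNode`. -/
def labelNodeBound (M : ℕ) : ℕ :=
  1 + M * (feasibleActionBound M + (successorsBound M +
    (1 + M * M * (M * (M + 1) + 1 + 1)) + 1) + 1) + 1

/-- Time bound for `feasibility`. -/
def feasibilityBound (M : ℕ) : ℕ :=
  (1 + M * (nextLayerBound M + 1)) + (M * (1 + M * (labelNodeBound M + 1) + 1) + (M * (M + 1) +
    (1 + M * (1 + M * (M * (M + 1) + 1 + 1) + (1 + M * (M * (M + 1) + 1 + 1)) + 1) + 1)))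

theorem feasibleActionBound_poly : PolyBounded feasibleActionBound := by
  unfold feasibleActionBound
  with_reducible repeat' first
    | exact PolyBounded.const _ | exact PolyBounded.id
    | apply PolyBounded.add | apply PolyBounded.mul

theorem successorsBound_poly : PolyBounded successorsBound := by
  unfold successorsBound
  with_reducible repeat' first
    | exact PolyBounded.const _ | exact PolyBounded.id
    | apply PolyBounded.add | apply PolyBounded.mul | apply PolyBounded.pow

theorem nextLayerBound_poly : PolyBounded nextLayerBound := by
  unfold nextLayerBound expandBound
  with_reducible repeat' first
    | exact PolyBounded.const _ | exact PolyBounded.id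
    | exact feasibleActionBound_poly | exact successorsBound_poly
    | apply PolyBounded.add | apply PolyBounded.mul | apply PolyBounded.pow

theorem feasibilityBound_poly : PolyBounded feasibilityBound := by
  unfold feasibilityBound labelNodeBound
  with_reducible repeat' first
    | exact PolyBounded.const _ | exact PolyBounded.id
    | exact feasibleActionBound_poly | exact successorsBound_poly | exact nextLayerBound_poly
    | apply PolyBounded.add | apply PolyBounded.mul

variable {g : TabularGame n nS nA} {M : ℕ}

theorem feasibleAction_time_le (hg : SizeBound g M) (h : ℕ) (v : Node n nS) (a : JAct nA) :
    (feasibleAction g h v a).time ≤ feasibleActionBound M := by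
  rw [feasibleAction, Timed.time_bind]
  refine add_le_add (lookup_time_le hg.players hg.keys _) (tall_time_le (hg.costs _) ?_)
  intro c _
  have := hg.players
  change 2 * n + 1 ≤ 2 * M + 1
  lia

theorem successors_time_le (hg : SizeBound g M) (h : ℕ) (v : Node n nS) (a : JAct nA) :
    (successors g h v a).time ≤ successorsBound M := by
  rw [successors, Timed.time_bind, Timed.time_bind]
  refine add_le_add (lookup_time_le hg.players hg.keys _)
    (add_le_add (tfilter_time_le (by simpa using hg.states) fun _ _ => le_rfl)
      (timage_time_le hg.players ?_ fun _ _ => hg.players))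
  rw [Finset.card_product]
  refine Nat.mul_le_mul ((Finset.card_le_univ _).trans ?_) (hg.costs _)
  simpa using hg.states

theorem successors_card_le (hg : SizeBound g M) (h : ℕ) (v : Node n nS) (a : JAct nA) :
    (successors g h v a).val.card ≤ M * M := by
  rw [successors, Timed.val_bind, Timed.val_bind]
  refine timage_card_le ?_
  rw [Finset.card_product]
  refine Nat.mul_le_mul ((Finset.card_le_univ _).trans ?_) (hg.costs _)
  simpa using hg.states

theorem nextLayer_time_le (hg : SizeBound g M) (h : ℕ) {L : Finset (Node n nS)}
    (hL : L.card ≤ M) : (nextLayer g h L).time ≤ nextLayerBound M := by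
  have hcard : ∀ v a, (do
      let ok ← feasibleAction g h v a
      if ok then successors g h v a else op ∅ : Timed (Finset (Node n nS))).val.card ≤ M * M := by
    intro v a
    rw [Timed.val_bind]
    split_ifs
    · exact successors_card_le hg h v a
    · simp
  refine tunion_time_le hg.players hL (fun v _ => tunion_time_le hg.players ?_ ?_
    fun a _ => hcard v a) fun v _ => tunion_card_le ?_ fun a _ => hcard v a
  · exact hg.acts
  · intro a _
    rw [Timed.time_bind]
    refine add_le_add (feasibleAction_time_le hg h v a) ?_
    split_ifs
    · exact (successors_time_le hg h v a).trans (Nat.le_succ _)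
    · exact Nat.le_add_left _ _
  · exact hg.acts

/-- The size of each layer is bounded directly by `M` through `SizeBound.layers`. Iterating the
growth factor of a single expansion would give a bound exponential in the horizon. -/
theorem buildTree_time_le (hg : SizeBound g M) (k h : ℕ) (hk : h + k = g.H) :
    (buildTree g k h (reachLayer g h)).time ≤ 1 + k * (nextLayerBound M + 1) := by
  induction k generalizing h with
  | zero => simp [buildTree]
  | succ k ih =>
    rw [buildTree, Timed.time_bind, Timed.time_bind, op_time]
    have h1 := nextLayer_time_le hg h (hg.layers h (by lia))
    have h2 := ih (h + 1) (by lia)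
    rw [show reachLayer g (h + 1) = (nextLayer g h (reachLayer g h)).val from rfl] at h2
    rw [add_one_mul]
    lia

theorem labelNode_time_le (hg : SizeBound g M) (h : ℕ)
    {next : Table (Node n nS) (Bool × Finset (JAct nA))} (hn : next.dom.card ≤ M)
    (v : Node n nS) : (labelNode g h next v).time ≤ labelNodeBound M := by
  rw [labelNode, Timed.time_bind, op_time]
  refine Nat.add_le_add_right (tfilter_time_le hg.acts fun a _ => ?_) 1
  rw [Timed.time_bind]
  refine add_le_add (feasibleAction_time_le hg h v a) ?_
  split_ifs
  · rw [Timed.time_bind]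
    refine (add_le_add (successors_time_le hg h v a) (tall_time_le (successors_card_le hg h v a)
      fun w _ => ?_)).trans (Nat.le_succ _)
    exact Nat.add_le_add_right (lookup_time_le hg.players hn w) 1
  · exact Nat.le_add_left _ _

theorem aoSolve_time_le (hg : SizeBound g M) (k h : ℕ) (hk : h + k = g.H) :
    (aoSolve g h ((List.range' h (k + 1)).map (reachLayer g))).time ≤
      (k + 1) * (1 + M * (labelNodeBound M + 1) + 1) := by
  induction k generalizing h with
  | zero =>
    simp only [zero_add, List.range'_one, List.map_cons, List.map_nil, aoSolve, Timed.time_bind,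
      op_time, one_mul]
    refine Nat.add_le_add_right (tabulate_time_le (hg.layers h (by lia)) fun v _ => ?_) 1
    exact Nat.le_add_left _ _
  | succ k ih =>
    have h1 := ih (h + 1) (by lia)
    have h2 := aoSolve_val (g := g) k (h + 1) (by lia)
    rw [List.range'_succ, List.map_cons]
    simp only [List.range'_succ, List.map_cons] at h1 h2 ⊢
    rw [aoSolve, Timed.time_bind, Timed.time_bind, op_time, h2, add_one_mul (k + 1)]
    have h3 := tabulate_time_le (b := labelNodeBound M) (hg.layers h (by lia))
      fun v (_ : v ∈ reachLayer g h) =>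
        labelNode_time_le hg h (next := labelTable g (h + 1)) (hg.layers (h + 1) (by lia)) v
    simp only [List.headD_cons]
    lia

theorem labelTable_card_le (hg : SizeBound g M) {h : ℕ} (hh : h ≤ g.H) :
    (labelTable g h).dom.card ≤ M := hg.layers h hh

theorem trueLayer_card_le (hg : SizeBound g M) {h : ℕ} (hh : h ≤ g.H) :
    (trueLayer g h).card ≤ M := by
  classical
  exact (Finset.card_filter_le _ _).trans (hg.layers h hh)

theorem feasibility_time_le (hg : SizeBound g M) :
    (feasibility g).time ≤ feasibilityBound M := by
  have h1 : (buildTree g g.H 0 {(g.s₁, 0)}).val =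
    (List.range' 0 (g.H + 1)).map (reachLayer g) := buildTree_val g.H 0
  have h1t : (buildTree g g.H 0 {(g.s₁, 0)}).time ≤ 1 + g.H * (nextLayerBound M + 1) :=
    buildTree_time_le hg g.H 0 (zero_add _)
  have h2 := aoSolve_val (g := g) g.H 0 (zero_add _)
  have h2t := aoSolve_time_le hg g.H 0 (zero_add _)
  have h3 : ((List.range' 0 (g.H + 1)).map (labelTable g)).headD default = labelTable g 0 := by
    rw [List.range'_succ]
    rfl
  have hH : g.H ≤ M := (Nat.le_succ _).trans hg.horizon
  rw [feasibility, Timed.time_bind, Timed.time_bind, Timed.time_bind, h1, h2, h3]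
  refine add_le_add (h1t.trans ?_) (add_le_add (h2t.trans ?_)
    (add_le_add (lookup_time_le hg.players (labelTable_card_le hg g.H.zero_le) _) ?_))
  · gcongr
  · exact Nat.mul_le_mul_right _ hg.horizon
  split_ifs
  · rw [Timed.time_bind, op_time]
    refine Nat.add_le_add_right (tlist_time_le ?_ ?_) 1
    · simpa using hg.horizon
    · intro T hT
      obtain ⟨h, hh, rfl⟩ := List.mem_map.1 hT
      have hh' : h ≤ g.H := by
        rw [List.mem_range'_1] at hh
        lia
      have hL := labelTable_card_le hg hh'
      rw [Timed.time_bind]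
      refine add_le_add (tfilter_time_le hL fun v _ => ?_) (tabulate_time_le ?_ fun v _ => ?_)
      · exact Nat.add_le_add_right (lookup_time_le hg.players hL v) 1
      · exact (Finset.card_filter_le _ _).trans hL
      · exact Nat.add_le_add_right (lookup_time_le hg.players hL v) 1
  · exact Nat.le_add_left _ _

/-! ## Running time of the construction of the reduced game -/

/-- Time bound for one layer of the reduced game. -/
def layerBound (M : ℕ) : ℕ :=
  1 + M * (M * (M + 1) + (1 + M * (successorsBound M + (M * (M + 1) +
    (1 + M * M * (M * (M + 1) + M + 1) + M)) + 1)) + 1)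

theorem layerBound_poly : PolyBounded layerBound := by
  unfold layerBound
  with_reducible repeat' first
    | exact PolyBounded.const _ | exact PolyBounded.id
    | exact successorsBound_poly
    | apply PolyBounded.add | apply PolyBounded.mul

theorem trueActions_card_le (hg : SizeBound g M) (h : ℕ) (v : Node n nS) :
    (trueActions g h v).card ≤ M := (Finset.card_le_univ _).trans hg.acts

theorem reducedGame_time_le (hg : SizeBound g M) (m h : ℕ) (hm : h + m ≤ g.H + 1) :
    (reducedGame g h ((List.range' h m).map (trueTable g))).time ≤
      1 + m * (layerBound M + 1) := by
  induction m generalizing h with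
  | zero => simp [reducedGame]
  | succ m ih =>
    have hn1 : n + 1 ≤ M := (Nat.le_succ _).trans hg.players
    have hT := trueLayer_card_le hg (h := h) (by lia)
    rw [List.range'_succ, List.map_cons, reducedGame, Timed.time_bind, Timed.time_bind, op_time]
    have h1 := ih (h + 1) (by lia)
    rw [add_one_mul]
    refine (add_le_add (b := layerBound M) (tabulate_time_le hT fun v hv => ?_)
      (Nat.add_le_add_right h1 1)).trans (by lia)
    have hX : (trueTable g h).get v = trueActions g h v := tabulate_get hv
    rw [Timed.time_bind]
    refine add_le_add (lookup_time_le hg.players hT v) ?_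
    rw [lookup_val, hX]
    refine tabulate_time_le (trueActions_card_le hg h v) fun a _ => ?_
    rw [Timed.time_bind, Timed.time_bind, Timed.time_bind]
    refine add_le_add (successors_time_le hg h v a)
      (add_le_add (lookup_time_le hg.players hg.keys _) (add_le_add (tabulate_time_le
        (successors_card_le hg h v a) fun w _ => ?_) hn1))
    rw [Timed.time_bind]
    exact add_le_add (lookup_time_le hn1 (hg.costs _) _) hg.players

/-! ## Running time of backward induction -/

/-- Time bound for `coefficient`. -/
def coefficientBound (M : ℕ) : ℕ := 1 + (M + (M * (M + 1) + (M * (M + 1) + (M * (M + 1) + 1))))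

/-- Time bound for `solveMatrixGame`, with a solver of running time `p`. -/
def matrixGameBound (p : Polynomial ℕ) (M : ℕ) : ℕ :=
  M * (M + 2) + (M + 1 + (M * (M * M) + 1 + (1 + M * (M * M) *
    (1 + M * (coefficientBound M + 1) + 1 + 1) + (M + 2 + (p.eval ((M + 1) * (M * (M * M) + 1 + 1)) +
      (1 + M * (M * (M + 1) + 1)))))))

/-- Time bound for `solveStage`. -/
def stageBound (p : Polynomial ℕ) (M : ℕ) : ℕ :=
  1 + M * (M * (M + 1) + (1 + M * M * (M * (M * M + 1) + (M * (M + 1) + M) + M) + M) + 1) +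
    (matrixGameBound p M + (1 + M * (M * (M + 1) + (M * (M + 1) + M) + M) + 1))

/-- Time bound for one layer of backward induction. -/
def inductionBound (p : Polynomial ℕ) (M : ℕ) : ℕ :=
  1 + M * (M * (M + 1) + stageBound p M + 1) + (1 + M * (M * (M + 1) + 1 + 1) +
    (1 + M * (M * (M + 1) + 1 + 1) + 1))

theorem inductionBound_poly (p : Polynomial ℕ) : PolyBounded (inductionBound p) := by
  have hp : PolyBounded fun M => p.eval ((M + 1) * (M * (M * M) + 1 + 1)) := by
    refine (PolyBounded.eval p).comp (F' := fun M => (M + 1) * (M * (M * M) + 1 + 1)) ?_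
    with_reducible repeat' first
      | exact PolyBounded.const _ | exact PolyBounded.id
      | apply PolyBounded.add | apply PolyBounded.mul
  unfold inductionBound stageBound matrixGameBound coefficientBound
  with_reducible repeat' first
    | exact PolyBounded.const _ | exact PolyBounded.id | exact hp
    | apply PolyBounded.add | apply PolyBounded.mul

theorem deviations_length_le (hg : SizeBound g M) (e : EqKind) :
    (deviations nA e).length ≤ M * (M * M) := by
  have hn : n ≤ M := by
    have := hg.players
    lia
  cases e with
  | ce =>
    simp only [deviations, List.length_map, Finset.length_toList, Finset.card_univ,
      Fintype.card_sigma, Fintype.card_prod, Fintype.card_fin]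
    exact sum_le_of_card_le (by simpa using hn) fun i _ => Nat.mul_le_mul (hg.act i) (hg.act i)
  | cce =>
    simp only [deviations, List.length_map, Finset.length_toList, Finset.card_univ,
      Fintype.card_sigma, Fintype.card_fin]
    refine sum_le_of_card_le (by simpa using hn) fun i _ => (hg.act i).trans ?_
    exact Nat.le_mul_of_pos_left M ((Nat.succ_pos _).trans_le hg.horizon)

theorem coefficient_time_le (hg : SizeBound g M) {Q : Table (JAct nA) (Fin n → ℝ)}
    (hQ : Q.dom.card ≤ M) (low : Fin n → ℝ)
    (d : Σ i : Fin n, Option (Fin (nA i)) × Fin (nA i)) (a : JAct nA) :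
    (coefficient Q low d a).time ≤ coefficientBound M := by
  have hn1 : n + 1 ≤ M := (Nat.le_succ _).trans hg.players
  rw [coefficient, Timed.time_bind]
  refine add_le_add le_rfl ?_
  split_ifs
  · rw [Timed.time_bind, Timed.time_bind, Timed.time_bind]
    refine add_le_add hn1 (add_le_add (lookup_time_le hn1 hQ _)
      (add_le_add (member_time_le hn1 hQ _) ?_))
    split_ifs
    · rw [Timed.time_bind]
      exact add_le_add (lookup_time_le hn1 hQ _) le_rfl
    · exact Nat.le_add_left _ _
  · rw [op_time]
    lia

/-- Natural coefficients make the polynomial monotone, so the solver's time can be bounded through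
an upper bound on the size of the program. -/
theorem eval_mono_nat (p : Polynomial ℕ) {x y : ℕ} (h : x ≤ y) :
    p.eval x ≤ p.eval y := by
  rw [Polynomial.eval_eq_sum, Polynomial.eval_eq_sum]
  exact Finset.sum_le_sum fun k _ => Nat.mul_le_mul_left _ (Nat.pow_le_pow_left h k)

variable {lp : LPSolver} {p : Polynomial ℕ} (e : EqKind)

theorem solveMatrixGame_time_le (hg : SizeBound g M) (hlp : lp.RunsIn p)
    {Q : Table (JAct nA) (Fin n → ℝ)} (hQ : Q.dom.card ≤ M) :
    (solveMatrixGame lp e Q).time ≤ matrixGameBound p M := by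
  have hn : n ≤ M := by
    have := hg.players
    lia
  have hn1 : n + 1 ≤ M := (Nat.le_succ _).trans hg.players
  have hdev := deviations_length_le hg e
  rw [solveMatrixGame, Timed.time_bind, Timed.time_bind, Timed.time_bind, Timed.time_bind,
    Timed.time_bind, Timed.time_bind]
  refine add_le_add (Nat.mul_le_mul hn (Nat.add_le_add_right hQ 2)) (add_le_add
    (Nat.add_le_add_right hQ 1) (add_le_add (Nat.add_le_add_right hdev 1) (add_le_add
      (tlist_time_le hdev fun d _ => ?_) (add_le_add (Nat.add_le_add_right hQ 2) (add_le_add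
        ((hlp _).trans (eval_mono_nat p ?_)) (tabulate_time_le hQ fun a _ => ?_))))))
  · rw [Timed.time_bind]
    exact Nat.add_le_add_right (tarray_time_le hQ fun j => coefficient_time_le hg hQ _ d _) 1
  -- There are at most `M` variables, `M ^ 3` incentive constraints (a player, an advice and an
  -- action each) and one normalization.
  · rw [tlist_val]
    refine Nat.mul_le_mul (Nat.add_le_add_right hQ 1) (Nat.add_le_add_right (Nat.add_le_add ?_
      le_rfl) 1)
    change (List.map _ _).length ≤ _
    rw [List.length_map]
    exact hdev
  · exact Nat.mul_le_mul hn1 (Nat.add_le_add_right hQ 1)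

theorem solveStage_time_le (hg : SizeBound g M) (hlp : lp.RunsIn p)
    {X : Table (JAct nA) (ActionData n nS)} {V : Table (Node n nS) (Fin n → ℝ)}
    (hX : X.dom.card ≤ M) (hV : V.dom.card ≤ M)
    (ht : ∀ a ∈ X.dom, (X.get a).trans.dom.card ≤ M * M) :
    (solveStage lp e X V).time ≤ stageBound p M := by
  have hn1 : n + 1 ≤ M := (Nat.le_succ _).trans hg.players
  rw [solveStage, Timed.time_bind, Timed.time_bind, Timed.time_bind, op_time]
  refine add_le_add (tabulate_time_le hX fun a ha => ?_) (add_le_add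
    (solveMatrixGame_time_le e hg hlp hX) (Nat.add_le_add_right
      (tsumOver_time_le hn1 hX fun a _ => ?_) 1))
  · rw [Timed.time_bind, Timed.time_bind]
    refine add_le_add (lookup_time_le hn1 hX a) (add_le_add (tsumOver_time_le hn1 (ht a ha)
      fun w _ => ?_) hn1)
    rw [Timed.time_bind, Timed.time_bind]
    exact add_le_add (lookup_time_le hg.players (ht a ha) w)
      (add_le_add (lookup_time_le hg.players hV w) hn1)
  · rw [Timed.time_bind, Timed.time_bind]
    exact add_le_add (lookup_time_le hn1 hX a) (add_le_add (lookup_time_le hn1 hX a) hn1)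

theorem valueTable_dom {h : ℕ} : (valueTable g lp e h).dom = trueLayer g h := by
  unfold valueTable
  cases g.H - h <;> rfl

theorem backwardInduction_time_le (hg : SizeBound g M) (hlp : lp.RunsIn p) (k h : ℕ)
    (hk : h + k = g.H) :
    (backwardInduction lp e ((List.range' h (k + 1)).map (acTable g))).time ≤
      (k + 1) * inductionBound p M := by
  induction k generalizing h with
  | zero =>
    simp only [zero_add, List.range'_one, List.map_cons, List.map_nil, backwardInduction,
      Timed.time_bind, op_time, one_mul]
    have h1 : (tabulate (acTable g h).dom fun _ => (⟨0, n + 1⟩ : Timed (Fin n → ℝ))).time ≤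
        1 + M * (M + 1) :=
      tabulate_time_le (trueLayer_card_le hg (by lia)) fun _ _ =>
        (Nat.le_succ _).trans hg.players
    unfold inductionBound
    refine (Nat.add_le_add_right h1 1).trans ?_
    have h2 : M * (M + 1) ≤ M * (M * (M + 1) + 1 + 1) := by
      refine Nat.mul_le_mul_left M ?_
      nlinarith
    lia
  | succ k ih =>
    have h1 := ih (h + 1) (by lia)
    have h2 := backwardInduction_val (g := g) lp e k (h + 1) (by lia)
    have hT := trueLayer_card_le hg (h := h) (by lia)
    rw [List.range'_succ, List.map_cons]
    simp only [List.range'_succ, List.map_cons] at h1 h2 ⊢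
    rw [backwardInduction, Timed.time_bind, Timed.time_bind, Timed.time_bind, Timed.time_bind,
      op_time, h2, add_one_mul (k + 1)]
    refine (add_le_add h1 (add_le_add (tabulate_time_le hT fun v hv => ?_) (add_le_add
      (tabulate_time_le hT fun v _ => ?_) (Nat.add_le_add_right
        (tabulate_time_le hT fun v _ => ?_) 1)))).trans_eq rfl
    · have hX : (acTable g h).get v = nodeActions g h v := tabulate_get hv
      rw [Timed.time_bind, lookup_val, hX]
      refine add_le_add (lookup_time_le hg.players hT v) (solveStage_time_le e hg hlp
        (trueActions_card_le hg h v) ?_ fun a ha => ?_)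
      · rw [valueTable_dom]
        exact trueLayer_card_le hg (by lia)
      · rw [show (nodeActions g h v).get a = nodeAction g h v a from tabulate_get ha]
        exact successors_card_le hg h v a
    · exact Nat.add_le_add_right (lookup_time_le hg.players hT v) 1
    · exact Nat.add_le_add_right (lookup_time_le hg.players hT v) 1

/-- Time bound for `reduction`. -/
def reductionBound (p : Polynomial ℕ) (M : ℕ) : ℕ :=
  feasibilityBound M + (1 + M * (layerBound M + 1) + (M * inductionBound p M + 1 + 1))

theorem reductionBound_poly (p : Polynomial ℕ) : PolyBounded (reductionBound p) := by
  unfold reductionBound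
  with_reducible repeat' first
    | exact PolyBounded.const _ | exact PolyBounded.id
    | exact feasibilityBound_poly | exact layerBound_poly | exact inductionBound_poly p
    | apply PolyBounded.add | apply PolyBounded.mul

theorem reduction_time_le (hg : SizeBound g M) (hlp : lp.RunsIn p) :
    (reduction (constrainedSolver lp e) g).time ≤ reductionBound p M := by
  classical
  rw [reduction, Timed.time_bind, feasibility_val]
  refine add_le_add (feasibility_time_le hg) ?_
  split_ifs
  · simp only [Timed.time_bind, op_time, constrainedSolver]
    rw [reducedGame_val]
    refine add_le_add ((reducedGame_time_le hg (g.H + 1) 0 (by lia)).trans ?_)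
      (Nat.add_le_add_right (Nat.add_le_add_right ((backwardInduction_time_le e hg hlp g.H 0
        (zero_add _)).trans ?_) 1) 1)
    · exact Nat.add_le_add_left (Nat.mul_le_mul_right _ hg.horizon) 1
    · exact Nat.mul_le_mul_right _ hg.horizon
  · simp only [op_time]
    lia

end FeasibilityTimes

/-! ## Running time of the approximation algorithm -/

namespace Game

variable {n : ℕ} {G : Game n} {ℓ : ℝ} {cdf : ℕ}

/-- All nodes at time `h` have cumulative costs that are multiples of `ℓ` in a bounded range. -/
theorem reachLayer_subset (hℓ : 0 < ℓ) {h : ℕ} (hh : h ≤ G.H) {v : Node n G.nS}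
    (hv : v ∈ reachLayer (G.approxGame ℓ cdf).val h) (i : Fin n) :
    ∃ z ∈ Finset.Icc (h * G.roundLo ℓ i) (h * G.roundHi ℓ i), (z : ℝ) * ℓ = v.2 i := by
  induction h generalizing v with
  | zero =>
    obtain rfl := Finset.mem_singleton.1 hv
    exact ⟨0, by simp, by simp⟩
  | succ h ih =>
    obtain ⟨u, hu, a, -, hw⟩ := (mem_nextLayer _).1 hv
    obtain ⟨s', c, -, hc, rfl⟩ := (mem_successors _).1 hw
    obtain ⟨z, hz, hzu⟩ := ih (by lia) hu
    obtain ⟨⟨z', hz', hzc⟩, -⟩ := ((roundedCosts_spec cdf hℓ i h u.1 a).1 _).1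
      ((mem_approxGame_dom_iff hh).1 hc i)
    rw [Finset.mem_Icc] at hz hz'
    refine ⟨z + z', Finset.mem_Icc.2 ⟨?_, ?_⟩, ?_⟩
    · push_cast
      linarith
    · push_cast
      linarith
    · rw [show (s', u.2 + c).2 i = u.2 i + c i from rfl, ← hzu, ← hzc]
      push_cast
      ring

/-- Sums of `h` rounded costs are again multiples of `ℓ`, in an interval only `h` times as long.
Their number per player grows linearly in time instead of being multiplied at each step. -/
theorem reachLayer_card_le (hℓ : 0 < ℓ) {m : ℕ}
    (hm : ∀ i, G.roundHi ℓ i - G.roundLo ℓ i + 1 ≤ m) {h : ℕ} (hh : h ≤ G.H) :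
    (reachLayer (G.approxGame ℓ cdf).val h).card ≤ G.nS * (G.H * m + 1) ^ n := by
  classical
  have hsub : reachLayer (G.approxGame ℓ cdf).val h ⊆ Finset.univ ×ˢ Fintype.piFinset fun i =>
      (Finset.Icc (h * G.roundLo ℓ i) (h * G.roundHi ℓ i)).image fun z : ℤ => (z : ℝ) * ℓ := by
    intro v hv
    refine Finset.mem_product.2 ⟨Finset.mem_univ _, Fintype.mem_piFinset.2 fun i => ?_⟩
    exact Finset.mem_image.2 (reachLayer_subset hℓ hh hv i)
  refine (Finset.card_le_card hsub).trans ?_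
  rw [Finset.card_product, Finset.card_univ, Fintype.card_fin, Fintype.card_piFinset]
  refine Nat.mul_le_mul_left _ ((Finset.prod_le_pow_card _ _ (G.H * m + 1) fun i _ => ?_).trans_eq
    (by simp))
  refine Finset.card_image_le.trans ?_
  rw [Int.card_Icc, Int.toNat_le]
  have h1 : (h : ℤ) * (G.roundHi ℓ i - G.roundLo ℓ i) ≤ G.H * m := by
    have h2 : G.roundHi ℓ i - G.roundLo ℓ i ≤ m := by linarith [hm i]
    refine (mul_le_mul_of_nonneg_left h2 (by positivity)).trans ?_
    exact mul_le_mul_of_nonneg_right (by exact_mod_cast hh) (by positivity)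
  push_cast
  linarith

theorem roundedCosts_card_le {m : ℕ} (hℓ : 0 < ℓ)
    (hm : ∀ i, G.roundHi ℓ i - G.roundLo ℓ i + 1 ≤ m)
    (h : ℕ) (s : G.State) (a : G.Act) (i : Fin n) :
    (G.roundedCosts ℓ cdf (h, s, a) i).val.dom.card ≤ m := by
  classical
  have hsub : (G.roundedCosts ℓ cdf (h, s, a) i).val.dom ⊆
      (Finset.Icc (G.roundLo ℓ i) (G.roundHi ℓ i)).image fun z : ℤ => (z : ℝ) * ℓ := fun x hx =>
    Finset.mem_image.2 (((roundedCosts_spec cdf hℓ i h s a).1 x).1 hx).1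
  refine (Finset.card_le_card hsub).trans (Finset.card_image_le.trans ?_)
  rw [Int.card_Icc, Int.toNat_le]
  linarith [hm i]

theorem one_le_prod_nA (G : Game n) : 1 ≤ ∏ i, G.nA i :=
  Finset.prod_pos fun i _ => G.nA_pos i

/-- Apart from the layers, everything is bounded by the input tables, except for the up to `m ^ n`
cost vectors of an action, which are fewer than `(H m + 1) ^ n`. -/
theorem approxGame_sizeBound (hℓ : 0 < ℓ) {m M : ℕ}
    (hm : ∀ i, G.roundHi ℓ i - G.roundLo ℓ i + 1 ≤ m)
    (h1 : G.tableSize + 3 ≤ M) (h2 : G.nS * (G.H * m + 1) ^ n ≤ M) :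
    SizeBound (G.approxGame ℓ cdf).val M := by
  classical
  have hS : 1 ≤ G.nS := (Nat.zero_le _).trans_lt G.s₁.2
  have hA := one_le_prod_nA G
  have hH := G.H_pos
  have hkeys : G.H * G.nS * (∏ i, G.nA i) ≤ G.tableSize := by
    unfold tableSize
    exact (Nat.le_mul_of_pos_right _ (by lia)).trans (Nat.le_add_right _ _)
  have hn : 2 * n ≤ G.tableSize := Nat.le_add_left _ _
  have hHt : G.H ≤ G.tableSize := le_trans (by
    rw [mul_assoc]
    exact Nat.le_mul_of_pos_right _ (Nat.mul_pos hS hA)) hkeys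
  have hSt : G.nS ≤ G.tableSize := le_trans (by
    rw [mul_comm G.H, mul_assoc]
    exact Nat.le_mul_of_pos_right _ (Nat.mul_pos hH hA)) hkeys
  have hAt : ∏ i, G.nA i ≤ G.tableSize := le_trans
    (Nat.le_mul_of_pos_left _ (Nat.mul_pos hH hS)) hkeys
  have hcard : Fintype.card (JAct G.nA) = ∏ i, G.nA i := by simp
  refine ⟨by lia, ?_, by lia, by lia, fun i => ?_, ?_, fun k => ?_, fun h hh => ?_⟩
  · exact (Nat.add_le_add_right hHt 1).trans (by lia)
  · have : G.nA i ≤ ∏ i, G.nA i :=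
      Finset.single_le_prod' (fun j _ => G.nA_pos j) (Finset.mem_univ i)
    lia
  · have : (G.approxGame ℓ cdf).val.C.dom.card = G.H * (G.nS * ∏ i, G.nA i) := by
      change (Finset.range G.H ×ˢ ((Finset.univ : Finset G.State) ×ˢ
        (Finset.univ : Finset G.Act))).card = _
      simp
    rw [this, ← mul_assoc]
    lia
  · obtain ⟨h, s, a⟩ := k
    by_cases hh : h < G.H
    · rw [approxGame_C_get cdf hh, tabulate_dom, Fintype.card_piFinset]
      refine (Finset.prod_le_pow_card _ _ m fun i _ =>
        roundedCosts_card_le hℓ hm h s a i).trans ?_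
      rw [Finset.card_univ, Fintype.card_fin]
      refine le_trans ?_ h2
      refine (Nat.pow_le_pow_left ?_ n).trans (Nat.le_mul_of_pos_left _ hS)
      exact (Nat.le_mul_of_pos_left _ hH).trans (Nat.le_succ _)
    -- From the horizon on the cost table returns its default, an empty table.
    · have : (G.approxGame ℓ cdf).val.C.get (h, s, a) = default :=
        tabulate_get_of_notMem (D := Finset.range G.H ×ˢ (Finset.univ ×ˢ Finset.univ))
          (by simpa using hh)
      rw [this]
      exact Nat.zero_le _
  · exact (reachLayer_card_le hℓ hm hh).trans h2

/-- Time bound for `roundedCosts`. -/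
def roundedCostsBound (M : ℕ) : ℕ :=
  7 + (4 + (3 * M + 1 + (1 + M * (M + 1 + (M + 1 + 4) + 1) + (1 + M * (1 * (M + 1) + 1 + 1) +
    (1 + M * (1 * (M + 1) + 1))))))

/-- Time bound for `approxGame`. -/
def approxGameBound (M : ℕ) : ℕ :=
  1 + M * (1 + M * (roundedCostsBound M + 1) + (1 + M * (1 + M * (1 * (M + 1) + 1) + 1)) + 1) + 1

theorem approxGameBound_poly : PolyBounded approxGameBound := by
  unfold approxGameBound roundedCostsBound
  with_reducible repeat' first
    | exact PolyBounded.const _ | exact PolyBounded.id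
    | apply PolyBounded.add | apply PolyBounded.mul

theorem roundedCosts_time_le {m M : ℕ} (hm : ∀ i, G.roundHi ℓ i - G.roundLo ℓ i + 1 ≤ m)
    (hmM : m ≤ M) (hcdf : cdf ≤ M) (k : ℕ × G.State × G.Act) (i : Fin n) :
    (G.roundedCosts ℓ cdf k i).time ≤ roundedCostsBound M := by
  classical
  have hI : (Finset.Icc ⌊(G.B i - G.H * G.cmax i) / ℓ⌋ ⌊G.cmax i / ℓ⌋).card ≤ M := by
    change (Finset.Icc (G.roundLo ℓ i) (G.roundHi ℓ i)).card ≤ M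
    rw [Int.card_Icc, Int.toNat_le]
    have := hm i
    lia
  have hD : ((Finset.Icc ⌊(G.B i - G.H * G.cmax i) / ℓ⌋ ⌊G.cmax i / ℓ⌋).image
      fun z : ℤ => (z : ℝ) * ℓ).card ≤ M := Finset.card_image_le.trans hI
  unfold roundedCosts
  rw [Timed.time_bind, Timed.time_bind, Timed.time_bind, Timed.time_bind, Timed.time_bind]
  refine add_le_add le_rfl (add_le_add le_rfl (add_le_add (by simp only; lia) (add_le_add
    (tabulate_time_le hD fun x _ => ?_) (add_le_add (tfilter_time_le hD fun x _ => ?_)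
      (tabulate_time_le ?_ fun x _ => ?_)))))
  · rw [Timed.time_bind]
    refine add_le_add (Nat.add_le_add_right hcdf 1) ?_
    split_ifs
    · change 1 + 4 ≤ _
      lia
    · exact Nat.add_le_add_right (Nat.add_le_add_right hcdf 1) 4
  · exact Nat.add_le_add_right (lookup_time_le le_rfl hD x) 1
  · exact (Finset.card_filter_le _ _).trans hD
  · exact lookup_time_le le_rfl hD x

theorem approxGame_time_le (hℓ : 0 < ℓ) {m M : ℕ}
    (hm : ∀ i, G.roundHi ℓ i - G.roundLo ℓ i + 1 ≤ m)
    (hmM : m ≤ M) (hcdf : cdf ≤ M) (hg : SizeBound (G.approxGame ℓ cdf).val M) :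
    (G.approxGame ℓ cdf).time ≤ approxGameBound M := by
  classical
  have hn : n ≤ M := by
    have := hg.players
    lia
  unfold approxGame
  rw [Timed.time_bind, op_time]
  refine Nat.add_le_add_right (tabulate_time_le hg.keys fun k hk => ?_) 1
  obtain ⟨h, s, a⟩ := k
  have hh : h < G.H := by
    have hk' : (h, s, a) ∈ Finset.range G.H ×ˢ ((Finset.univ : Finset G.State) ×ˢ
      (Finset.univ : Finset G.Act)) := hk
    simpa using hk'
  rw [Timed.time_bind]
  refine add_le_add (tarray_time_le hn fun i => roundedCosts_time_le hm hmM hcdf _ i)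
    (tabulate_time_le ?_ fun c _ => tprodOver_time_le hn fun i => ?_)
  · have := hg.costs (h, s, a)
    rwa [approxGame_C_get cdf hh, tabulate_dom] at this
  · exact lookup_time_le le_rfl ((roundedCosts_card_le hℓ hm h s a i).trans hmM) _

/-- Time bound for `approximation`. -/
def approximationBound (p : Polynomial ℕ) (M : ℕ) : ℕ := approxGameBound M + reductionBound p M

theorem approximation_time_le (hℓ : 0 < ℓ) {m M : ℕ} {lp : LPSolver} {p : Polynomial ℕ}
    (e : EqKind) (hlp : lp.RunsIn p) (hm : ∀ i, G.roundHi ℓ i - G.roundLo ℓ i + 1 ≤ m)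
    (h1 : G.tableSize + 3 ≤ M) (h2 : G.nS * (G.H * m + 1) ^ n ≤ M) (hmM : m ≤ M)
    (hcdf : cdf ≤ M) : (G.approximation lp e ℓ cdf).time ≤ approximationBound p M := by
  have hg : SizeBound (G.approxGame ℓ cdf).val M := approxGame_sizeBound hℓ hm h1 h2
  rw [approximation, Timed.time_bind]
  exact add_le_add (approxGame_time_le hℓ hm hmM hcdf hg) (reduction_time_le e hg hlp)

/-- The number of rounded costs of a player. -/
theorem roundHi_sub_roundLo_le {ε : ℝ} (hε : 0 < ε) {N Q : ℕ} (hN : G.tableSize ≤ N)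
    (hQ : ‖fun i => ((G.H : ℝ) + 1) * G.cmax i - G.B i‖ ≤ Q) (i : Fin n) :
    G.roundHi (ε / G.H) i - G.roundLo (ε / G.H) i + 1 ≤ (⌈(Q * N : ℝ) / ε⌉₊ + 2 : ℕ) := by
  have hH : (0 : ℝ) < G.H := by exact_mod_cast G.H_pos
  have hHN : (G.H : ℝ) ≤ N := by
    have hS : 1 ≤ G.nS := (Nat.zero_le _).trans_lt G.s₁.2
    have : G.H ≤ G.tableSize := by
      unfold tableSize
      rw [mul_assoc, mul_assoc]
      refine (Nat.le_mul_of_pos_right _ (Nat.mul_pos hS (Nat.mul_pos (one_le_prod_nA G) ?_))).trans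
        (Nat.le_add_right _ _)
      lia
    exact_mod_cast this.trans hN
  have hq : (G.H + 1) * G.cmax i - G.B i ≤ Q :=
    ((le_abs_self _).trans (norm_le_pi_norm (fun i => ((G.H : ℝ) + 1) * G.cmax i - G.B i) i)).trans
      hQ
  have h1 : (G.roundHi (ε / G.H) i : ℝ) ≤ G.cmax i / (ε / G.H) := Int.floor_le _
  have h2 : (G.B i - G.H * G.cmax i) / (ε / G.H) < G.roundLo (ε / G.H) i + 1 :=
    Int.lt_floor_add_one _
  -- The range of costs has width `(H + 1) c_max - B`, which explains the hypothesis on the norm;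
  -- division by `ℓ = ε / H` brings in the factor `H`. The two floors and the count of endpoints
  -- account for the final `2`.
  have h3 : G.cmax i / (ε / G.H) - (G.B i - G.H * G.cmax i) / (ε / G.H) ≤ Q * N / ε := by
    rw [← sub_div, div_div_eq_mul_div]
    refine div_le_div_of_nonneg_right ?_ hε.le
    calc (G.cmax i - (G.B i - G.H * G.cmax i)) * G.H ≤ Q * G.H :=
          mul_le_mul_of_nonneg_right (by linarith) hH.le
      _ ≤ Q * N := mul_le_mul_of_nonneg_left hHN (Nat.cast_nonneg _)
  have h4 : (Q * N : ℝ) / ε ≤ ⌈(Q * N : ℝ) / ε⌉₊ := Nat.le_ceil _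
  have h5 : (G.roundHi (ε / G.H) i : ℝ) - G.roundLo (ε / G.H) i + 1 ≤
      ((⌈(Q * N : ℝ) / ε⌉₊ + 2 : ℕ) : ℝ) := by
    push_cast
    linarith
  exact_mod_cast h5

end Game

/-! ### The bound in terms of the description size and the accuracy -/

/-- From `x = 2` on, constants fit into the exponent, as `K ≤ x ^ K` and `x + 1 ≤ x ^ 2`. This is
essential for uniformity in `n`: the `n`-th power of `x ^ j` is `(x ^ n) ^ j`, whereas a constant
factor `K` would turn into `K ^ n`. -/
theorem PolyBounded.exists_le_pow {F : ℕ → ℕ} (hF : PolyBounded F) :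
    ∃ j : ℕ, ∀ x, 2 ≤ x → F x ≤ x ^ j := by
  obtain ⟨K, d, hK⟩ := hF
  refine ⟨K + 2 * d, fun x hx => (hK x).trans ?_⟩
  have h1 : K ≤ x ^ K := (Nat.lt_two_pow_self.le).trans (Nat.pow_le_pow_left hx K)
  have h2 : (x + 1) ^ d ≤ x ^ (2 * d) := by
    rw [pow_mul]
    exact Nat.pow_le_pow_left (by nlinarith) d
  rw [pow_add]
  exact Nat.mul_le_mul h1 h2

/-- The number of cost vectors is polynomial in `N ^ n` and `1 / ε ^ n`. -/
theorem pow_ceil_le {n N a j : ℕ} {ε y : ℝ} (hε : 0 < ε) (hN : 1 ≤ N) (ha : a ≤ N ^ j)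
    (hy0 : 0 ≤ y) (hy : y ≤ a * max 1 (1 / ε)) :
    y ^ n ≤ ((N : ℝ) ^ n + 1 / ε ^ n) ^ (j + 1) := by
  have hε' : 0 < 1 / ε ^ n := by positivity
  have hN1 : (1 : ℝ) ≤ (N : ℝ) ^ n := one_le_pow₀ (by exact_mod_cast hN)
  have h1 : (a : ℝ) ^ n ≤ ((N : ℝ) ^ n + 1 / ε ^ n) ^ j := by
    have h2 : (a : ℝ) ≤ (N : ℝ) ^ j := by exact_mod_cast ha
    calc (a : ℝ) ^ n ≤ ((N : ℝ) ^ j) ^ n := pow_le_pow_left₀ (Nat.cast_nonneg _) h2 n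
      _ = ((N : ℝ) ^ n) ^ j := pow_right_comm _ _ _
      _ ≤ _ := pow_le_pow_left₀ (by positivity) (by linarith) j
  -- Powers commute with the maximum, and each of `1` and `1 / ε ^ n` is covered by one summand.
  have h3 : (max 1 (1 / ε)) ^ n ≤ (N : ℝ) ^ n + 1 / ε ^ n := by
    rcases max_choice 1 (1 / ε) with h | h
    · rw [h, one_pow]
      linarith
    · rw [h, one_div_pow]
      linarith
  calc y ^ n ≤ (a * max 1 (1 / ε)) ^ n := pow_le_pow_left₀ hy0 hy n
    _ = (a : ℝ) ^ n * (max 1 (1 / ε)) ^ n := mul_pow _ _ _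
    _ ≤ _ := by
      rw [pow_succ]
      exact mul_le_mul h1 h3 (by positivity) (by positivity)

/-- Running time of the approximation algorithm. -/
theorem exists_approximation_time_bound (p q : Polynomial ℕ) : ∃ K d : ℕ,
    ∀ (n : ℕ) (G : Game n) (lp : LPSolver) (e : EqKind) (cdf : ℕ) (ε : ℝ) (N : ℕ), 0 < n →
      0 < ε → lp.RunsIn p → G.tableSize ≤ N → cdf ≤ q.eval N →
      ‖fun i => ((G.H : ℝ) + 1) * G.cmax i - G.B i‖ ≤ (q.eval N : ℕ) →
      ((G.approximation lp e (ε / G.H) cdf).time : ℝ) ≤ K * ((N : ℝ) ^ n + 1 / ε ^ n) ^ d := by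
  obtain ⟨K, d, hKd⟩ : PolyBounded (Game.approximationBound p) :=
    Game.approxGameBound_poly.add (reductionBound_poly p)
  -- The first two summands form the coefficient in the estimate of `N * m + 1` by a multiple of
  -- `max 1 (1 / ε)`; the last one allows bounding `q` by the same power.
  obtain ⟨j, hj⟩ : ∃ j : ℕ, ∀ x, 2 ≤ x → x * (q.eval x * x + 3) + 1 + q.eval x ≤ x ^ j := by
    refine PolyBounded.exists_le_pow (F := fun x => x * (q.eval x * x + 3) + 1 + q.eval x) ?_
    with_reducible repeat' first
      | exact PolyBounded.const _ | exact PolyBounded.id | exact PolyBounded.eval q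
      | apply PolyBounded.add | apply PolyBounded.mul
  -- In `M + 1 = N + 4 + Q + N * S` the constant `4` is at most `4 X ^ (j + 2)` and each other
  -- summand is at most `X ^ (j + 2)`, so the factor `8` suffices.
  refine ⟨K * 8 ^ d, (j + 2) * d, fun n G lp e cdf ε N hn hε hlp hN hcdf hQ => ?_⟩
  set Q := q.eval N with hQd
  set X : ℝ := (N : ℝ) ^ n + 1 / ε ^ n with hX
  -- The `2 n` table entries for budgets and maximal costs, with `n` positive, give the lower bound
  -- needed for `hj`.
  have hN2 : 2 ≤ N := by
    have : 2 * n ≤ G.tableSize := Nat.le_add_left _ _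
    lia
  have hH : 0 < G.H := G.H_pos
  have hS : 1 ≤ G.nS := (Nat.zero_le _).trans_lt G.s₁.2
  have hkeys : G.H * G.nS ≤ N := by
    refine le_trans ?_ hN
    unfold Game.tableSize
    rw [mul_assoc (G.H * G.nS)]
    refine (Nat.le_mul_of_pos_right _ (Nat.mul_pos (Game.one_le_prod_nA G) ?_)).trans
      (Nat.le_add_right _ _)
    lia
  have hHN : G.H ≤ N := (Nat.le_mul_of_pos_right _ hS).trans hkeys
  have hSN : G.nS ≤ N := (Nat.le_mul_of_pos_left _ hH).trans hkeys
  set m := ⌈(Q * N : ℝ) / ε⌉₊ + 2 with hm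
  set S := (N * m + 1) ^ n with hSd
  set M := N + 3 + Q + N * S with hM
  have hmS : m ≤ S := by
    refine le_trans ?_ (Nat.le_self_pow hn.ne' _)
    exact (Nat.le_mul_of_pos_left _ (by lia)).trans (Nat.le_succ _)
  have hSNS : S ≤ N * S := Nat.le_mul_of_pos_left _ (by lia)
  have htime : (G.approximation lp e (ε / G.H) cdf).time ≤ Game.approximationBound p M := by
    refine Game.approximation_time_le (m := m) (div_pos hε (by exact_mod_cast hH)) e hlp
      (fun i => Game.roundHi_sub_roundLo_le hε hN hQ i) (by lia) ?_ (by lia) (by lia)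
    have : G.nS * (G.H * m + 1) ^ n ≤ N * S :=
      Nat.mul_le_mul hSN (Nat.pow_le_pow_left (by gcongr) n)
    lia
  have hN1 : (1 : ℝ) ≤ N := by exact_mod_cast (show 1 ≤ N by lia)
  have hε' : 0 < 1 / ε ^ n := by positivity
  have hNX : (N : ℝ) ≤ X := by
    have : (N : ℝ) ≤ (N : ℝ) ^ n := le_self_pow₀ hN1 hn.ne'
    linarith
  have hX1 : 1 ≤ X := hN1.trans hNX
  have hSX : (S : ℝ) ≤ X ^ (j + 1) := by
    have := pow_ceil_le (n := n) (y := (N * m + 1 : ℕ)) (a := N * (Q * N + 3) + 1) hε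
      (by lia : 1 ≤ N) ((Nat.le_add_right _ _).trans (hj N hN2)) (Nat.cast_nonneg _) ?_
    · rw [hSd, Nat.cast_pow]
      exact this
    · have h1 : (m : ℝ) ≤ (Q * N : ℝ) / ε + 3 := by
        have := Nat.ceil_lt_add_one (a := (Q * N : ℝ) / ε) (by positivity)
        rw [hm]
        push_cast
        linarith
      have h2 : (1 : ℝ) ≤ max 1 (1 / ε) := le_max_left _ _
      have h3 : (Q * N : ℝ) / ε ≤ Q * N * max 1 (1 / ε) := by
        rw [div_eq_mul_one_div]
        exact mul_le_mul_of_nonneg_left (le_max_right _ _) (by positivity)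
      have h4 : (m : ℝ) ≤ (Q * N + 3) * max 1 (1 / ε) := by
        rw [add_mul]
        linarith
      push_cast
      have h5 := mul_le_mul_of_nonneg_left h4 (Nat.cast_nonneg (α := ℝ) N)
      rw [add_mul (_ * _ : ℝ)]
      linarith
  have hQX : (Q : ℝ) ≤ X ^ (j + 2) := by
    have h1 : (Q : ℝ) ≤ (N : ℝ) ^ j := by
      exact_mod_cast (Nat.le_add_left _ _).trans (hj N hN2)
    calc (Q : ℝ) ≤ (N : ℝ) ^ j := h1
      _ ≤ X ^ j := pow_le_pow_left₀ (Nat.cast_nonneg _) hNX j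
      _ ≤ X ^ (j + 2) := pow_le_pow_right₀ hX1 (by lia)
  have hMX : ((M + 1 : ℕ) : ℝ) ≤ 8 * X ^ (j + 2) := by
    have h1 : (N : ℝ) * S ≤ X ^ (j + 2) := by
      rw [show j + 2 = j + 1 + 1 by lia, pow_succ' X (j + 1)]
      exact mul_le_mul hNX hSX (Nat.cast_nonneg _) (by linarith)
    have h2 : X ≤ X ^ (j + 2) := le_self_pow₀ hX1 (by lia)
    rw [hM]
    push_cast
    linarith
  calc ((G.approximation lp e (ε / G.H) cdf).time : ℝ)
      ≤ ((K * (M + 1) ^ d : ℕ) : ℝ) := by exact_mod_cast htime.trans (hKd M)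
    _ = K * ((M + 1 : ℕ) : ℝ) ^ d := by push_cast; ring
    _ ≤ K * (8 * X ^ (j + 2)) ^ d :=
        mul_le_mul_of_nonneg_left (pow_le_pow_left₀ (Nat.cast_nonneg _) hMX d) (Nat.cast_nonneg _)
    _ = ((K * 8 ^ d : ℕ) : ℝ) * X ^ ((j + 2) * d) := by
        rw [mul_pow, ← pow_mul]
        push_cast
        ring

end AnytimeGame

end

theorem mainTheorem11 :
    (∀ (n : ℕ) (G : AnytimeGame.Game n) (lp : AnytimeGame.LPSolver) (e : AnytimeGame.EqKind)
        (cdf : ℕ) (ε : ℝ), G.Normalized → 0 < ε →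
      ((G.approximation lp e (ε / G.H) cdf).val = none →
        ¬ ∃ π : G.Policy, π.Feasible) ∧
      (∀ σ, (G.approximation lp e (ε / G.H) cdf).val = some σ →
        (G.play (ε / G.H) σ).AddFeasible ε ∧ (G.play (ε / G.H) σ).IsApproxACSPE e ε)) ∧
    (∀ p q : Polynomial ℕ, ∃ K d : ℕ,
      ∀ (n : ℕ) (G : AnytimeGame.Game n) (lp : AnytimeGame.LPSolver) (e : AnytimeGame.EqKind)
        (cdf : ℕ) (ε : ℝ) (N : ℕ), 0 < n → G.Normalized → 0 < ε → lp.RunsIn p →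
      G.tableSize ≤ N → cdf ≤ q.eval N →
      ‖fun i => ((G.H : ℝ) + 1) * G.cmax i - G.B i‖ ≤ (q.eval N : ℕ) →
        ((G.approximation lp e (ε / G.H) cdf).time : ℝ) ≤
          K * ((N : ℝ) ^ n + 1 / ε ^ n) ^ d) := by
  refine ⟨fun n G lp e cdf ε hN hε =>
    AnytimeGame.Game.approximation_correct G lp e cdf ε hN hε, fun p q => ?_⟩
  obtain ⟨K, d, h⟩ := AnytimeGame.exists_approximation_time_bound p q
  exact ⟨K, d, fun n G lp e cdf ε N hn _ hε hlp hN hcdf hQ =>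
    h n G lp e cdf ε N hn hε hlp hN hcdf hQ⟩
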